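/- **Notation.** Let $1\le m\le n$. Superforms on $\mathbb R^n$ are forms $a=\sum a_{I,K}(x)\,dx_I\wedge d\xi_K$ on $\mathbb R^n_x\oplus\mathbb R^n_\xi$ with coefficients independent of $\xi$; $d a=\sum_k dx_k\wedge\partial_{x_k}a$, $d^{\#}a=\sum_k d\xi_k\wedge\partial_{x_k}a$; $J$ is the multiplicative map with $J(dx_j)=d\xi_j$, $J(d\xi_j)=-dx_j$, and $v^{\#}=J(v)$ for forms $v$ in $dx$ only. Put $\beta=\sum_j dx_j\wedge d\xi_j$ and $\beta_k=\beta^k/k!$. The superintegral is normalized by $\int a_0\,dx_1\wedge d\xi_1\wedge\dots\wedge dx_n\wedge d\xi_n\;{*\mu}=\int a_0\,d\mu$ for a measure $\mu$ on $\mathbb R^n$. For a smooth $m$-dimensional submanifold $M\subset\mathbb R^n$ with surface measure $dS_M$, codimension $p=n-m$ and orthonormal conormal frame $n_1,\dots,n_p$ put $\nu=n_1\wedge\dots\wedge n_p$ and $$[M]_s=(-1)^{p(p-1)/2}\,\nu\wedge\nu^{\#}\,{*dS_M},\qquad \sigma_M=[M]_s\wedge\beta_m,\qquad S_M=[M]_s\wedge\beta_{m-1}.$$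 If $n_j=d\rho_j$, where $\rho_1,\dots,\rho_p$ are local defining functions of $M$ with $d\rho_j$ orthonormal on $M$, the mean curvature vector is $\vec H=\sum_j H_j\vec n_j$ with $H_j$ the trace over the tangent space of $M$ of the Hessian of $\rho_j$ (so $\vec H$ points outwards on a sphere). A $C^2$ function $u$ is $m$-subharmonic if $dd^{\#}u\wedge\beta^{m-1}\wedge\alpha\ge 0$ for every form $\alpha$ of bidegree $(n-m,n-m)$ that is weakly positive, i.e. $\alpha\wedge\alpha_1\wedge\alpha_1^{\#}\wedge\dots\wedge\alpha_m\wedge\alpha_m^{\#}\ge0$ for all $(1,0)$-forms $\alpha_j$. Let $I\subset\mathbb R$ be an interval of positive length with $0\in I$, and let $(M_t)_{t\in I}$ be a family of compact smooth $m$-dimensional submanifolds (without boundary) of $\mathbb R^n$ moving by the mean curvature flow: there is a smooth, possibly time-dependent, vector field $\vec H$ on $\mathbb R^n$ which on each $M_t$ restricts at time $t$ to the mean curvature vector field of $M_t$, and $F_t(M_0)=M_t$, where $F_t$ is the smooth flow of $-\vec H$ on $\mathbb R^n$ for $t\in I$ with $F_0=\mathrm{id}$. Write $\sigma_t=\sigma_{M_t}$,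 $S_t=S_{M_t}$. **Statement.** Let $\rho:\mathbb R^n\to\mathbb R$ be of class $C^2$. 1. For every $t_0\in I$, in particular for $t_0=0$, $$\frac{d}{dt}\Big|_{t=t_0}\int\rho\,d\sigma_t=-\int\rho\,|\vec H|^2\,d\sigma_{t_0}-\int dd^{\#}\rho\wedge S_{t_0}$$ (a one-sided derivative if $t_0$ is an end point of $I$). 2. If $\rho$ is convex, then $\rho$ is $m$-subharmonic. 3. If $\rho$ is convex or, more generally, $m$-subharmonic, and $\rho\ge0$ on $M_t$ for all $t\in I$, then $t\mapsto\int\rho\,d\sigma_t$ is decreasing (non-increasing) on $I$. -/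

import Mathlib

open Set MeasureTheory
open scoped ContDiff Nat

noncomputable section

namespace SuperMCF

/-! ### Superforms

Covectors on `ℝⁿ` are identified with vectors through the scalar product, so that the cotangent
space of `E_s = E₀ ⊕ E₁` is `Space n × Space n`. -/

/-- Euclidean space `E = ℝⁿ`. -/
abbrev Space (n : ℕ) := EuclideanSpace ℝ (Fin n)

/-- Constant superforms: the exterior algebra of `T*(E₀) ⊕ T*(E₁)`; its product is `∧`. -/
abbrev SuperAlg (n : ℕ) := ExteriorAlgebra ℝ (Space n × Space n)

instance finite_superAlg (n : ℕ) : Module.Finite ℝ (SuperAlg n) := by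
  set V := Space n × Space n
  have htop : (⨆ i : ℕ, ⋀[ℝ]^i V) = ⊤ :=
    (DirectSum.Decomposition.isInternal (fun i : ℕ => ⋀[ℝ]^i V)).submodule_iSup_eq_top
  have hle : (⊤ : Submodule ℝ (SuperAlg n)) =
      ⨆ i ∈ Finset.range (Module.finrank ℝ V + 1), ⋀[ℝ]^i V := by
    refine le_antisymm ?_ le_top
    rw [← htop]
    refine iSup_le fun i => ?_
    by_cases hi : i < Module.finrank ℝ V + 1
    · exact le_iSup₂_of_le i (Finset.mem_range.2 hi) le_rfl
    · have h0 : Module.finrank ℝ (⋀[ℝ]^i V) = 0 := by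
        rw [exteriorPower.finrank_eq]
        exact Nat.choose_eq_zero_of_lt (by omega)
      rw [Submodule.finrank_eq_zero.1 h0]
      exact bot_le
  refine ⟨?_⟩
  rw [hle]
  exact Submodule.fg_biSup _ _ fun i _ => Module.Finite.iff_fg.1 inferInstance

/-- The constant `(1,0)`-form `∑ vⱼ dxⱼ`. -/
def dx {n : ℕ} (v : Space n) : SuperAlg n := ExteriorAlgebra.ι ℝ (v, 0)

/-- The constant `(0,1)`-form `∑ vⱼ dξⱼ`. -/
def dxi {n : ℕ} (v : Space n) : SuperAlg n := ExteriorAlgebra.ι ℝ (0, v)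

/-- The complex structure, `J(dxⱼ) = dξⱼ`, `J(dξⱼ) = -dxⱼ`, extended by
`J(a ∧ b) = J(a) ∧ J(b)`. -/
def J {n : ℕ} : SuperAlg n →ₐ[ℝ] SuperAlg n :=
  ExteriorAlgebra.map
    ((-LinearMap.snd ℝ (Space n) (Space n)).prod (LinearMap.fst ℝ (Space n) (Space n)))

/-- The `j`-th vector of the standard basis of `ℝⁿ`. -/
def e {n : ℕ} (j : Fin n) : Space n := EuclideanSpace.single j 1

/-- The Euclidean Kähler form `β = ∑ dxⱼ ∧ dξⱼ`. -/
def beta (n : ℕ) : SuperAlg n := ∑ j : Fin n, dx (e j) * dxi (e j)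

/-- `β_k = β^k / k!`. -/
def betaPow (n k : ℕ) : SuperAlg n := ((k ! : ℝ)⁻¹) • beta n ^ k

/-- The space of constant superforms of bidegree `(p, q)`, spanned by the `dx_I ∧ dξ_K` with
`|I| = p`, `|K| = q`. -/
def bidegree (n p q : ℕ) : Submodule ℝ (SuperAlg n) :=
  Submodule.span ℝ (Set.range fun IK : (Fin p → Fin n) × (Fin q → Fin n) =>
    (List.ofFn fun i => dx (e (IK.1 i))).prod * (List.ofFn fun k => dxi (e (IK.2 k))).prod)

/-- The coordinates of a covector on `E_s`, in the order `dx₁, dξ₁, dx₂, dξ₂, …`. -/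
def coords (n : ℕ) : (Space n × Space n) →ₗ[ℝ] (Fin n × Fin 2 → ℝ) where
  toFun v := fun jk => if jk.2 = 0 then v.1 jk.1 else v.2 jk.1
  map_add' v w := by
    funext jk
    by_cases h : jk.2 = 0 <;> simp [h]
  map_smul' c v := by
    funext jk
    by_cases h : jk.2 = 0 <;> simp [h]

/-- The alternating form of degree `2n` with value `1` on `(dx₁, dξ₁, …, dxₙ, dξₙ)`. -/
def topForm (n : ℕ) : (Space n × Space n) [⋀^Fin (n * 2)]→ₗ[ℝ] ℝ :=
  ((Matrix.detRowAlternating (R := ℝ) (n := Fin n × Fin 2)).compLinearMap (coords n)).domDomCongr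
    finProdFinEquiv

/-- The Berezin functional (normalised): the coefficient `a₀` in the component
`a₀ dx₁ ∧ dξ₁ ∧ … ∧ dxₙ ∧ dξₙ` of bidegree `(n, n)` of a constant superform. -/
def berezin (n : ℕ) : SuperAlg n →ₗ[ℝ] ℝ :=
  ExteriorAlgebra.liftAlternating (R := ℝ) (Pi.single (n * 2) (topForm n))

/-- Superforms on `ℝⁿ`; the coefficients depend on `x` only. -/
abbrev Superform (n : ℕ) := Space n → SuperAlg n

/-- A function, as a superform of bidegree `(0,0)`. -/
def ofFun {n : ℕ} (f : Space n → ℝ) : Superform n := fun x => algebraMap ℝ (SuperAlg n) (f x)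

/-- The derivative in the direction `v` of the coefficients of a superform. (For differentiable
coefficients this does not depend on the basis of `SuperAlg n`.) -/
def coeffDeriv {n : ℕ} (v : Space n) (a : Superform n) : Superform n := fun x =>
  ∑ i, (fderiv ℝ (fun y => (Module.finBasis ℝ (SuperAlg n)).repr (a y) i) x v) •
    Module.finBasis ℝ (SuperAlg n) i

/-- The exterior derivative `d`. -/
def d {n : ℕ} (a : Superform n) : Superform n := fun x =>
  ∑ k : Fin n, dx (e k) * coeffDeriv (e k) a x

/-- The operator `d^#`. -/
def dsharp {n : ℕ} (a : Superform n) : Superform n := fun x =>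
  ∑ k : Fin n, dxi (e k) * coeffDeriv (e k) a x

/-! ### Supercurrents with measure coefficients -/

/-- A supercurrent of order zero `T = θ *μ`, with a measure `μ` on `ℝⁿ` and a density `θ` with
values in the constant superforms. -/
structure Supercurrent (n : ℕ) where
  measure : Measure (Space n)
  density : Superform n

/-- `T ∧ a`. -/
def Supercurrent.wedge {n : ℕ} (T : Supercurrent n) (a : Superform n) : Supercurrent n :=
  ⟨T.measure, fun x => T.density x * a x⟩

/-- `a ∧ T`. -/
def wedgeLeft {n : ℕ} (a : Superform n) (T : Supercurrent n) : Supercurrent n :=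
  ⟨T.measure, fun x => a x * T.density x⟩

/-- The superintegral of a supercurrent over `ℝⁿ_s`: only the component of bidegree `(n, n)`
contributes, and `∫ (a₀ dx₁ ∧ dξ₁ ∧ … ∧ dxₙ ∧ dξₙ) *μ = ∫ a₀ dμ`. -/
def superIntegral {n : ℕ} (T : Supercurrent n) : ℝ :=
  ∫ x, berezin n (T.density x) ∂T.measure

/-- The action `T.a = ∫ T ∧ a` of a supercurrent on a superform. -/
def Supercurrent.pair {n : ℕ} (T : Supercurrent n) (a : Superform n) : ℝ :=
  superIntegral (T.wedge a)

/-! ### Submanifolds and their supercurrents -/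

/-- In the open set `U` the set `M` is given by the equations `ρⱼ = 0`, with smooth `ρⱼ`. -/
def IsDefinedBy {n p : ℕ} (M U : Set (Space n)) (ρ : Fin p → Space n → ℝ) : Prop :=
  IsOpen U ∧ (∀ j, ContDiffOn ℝ ∞ (ρ j) U) ∧ M ∩ U = {y ∈ U | ∀ j, ρ j y = 0}

/-- `M` is a smooth (embedded) `m`-dimensional submanifold of `ℝⁿ`, `m ≤ n`: locally it is defined
by `n - m` smooth equations whose differentials are linearly independent on `M`. -/
def IsSubmanifold {n : ℕ} (m : ℕ) (M : Set (Space n)) : Prop :=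
  m ≤ n ∧ ∀ x ∈ M, ∃ (U : Set (Space n)) (ρ : Fin (n - m) → Space n → ℝ),
    x ∈ U ∧ IsDefinedBy M U ρ ∧
      ∀ y ∈ M ∩ U, LinearIndependent ℝ fun j => gradient (ρ j) y

/-- The tangent space of `M` at `x`. -/
def tangent {n : ℕ} (M : Set (Space n)) (x : Space n) : Submodule ℝ (Space n) :=
  Submodule.span ℝ (tangentConeAt ℝ M x)

/-- The normal space of `M` at `x`. -/
def normal {n : ℕ} (M : Set (Space n)) (x : Space n) : Submodule ℝ (Space n) :=
  (tangent M x)ᗮ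

/-- The form `n₁ ∧ … ∧ n_p`, where `n₁, …, n_p` is an orthonormal basis of the conormal space of
`M` at `x`. -/
def normalForm {n : ℕ} (M : Set (Space n)) (x : Space n) : SuperAlg n :=
  (List.ofFn fun j => dx ((stdOrthonormalBasis ℝ (normal M x) j : normal M x) : Space n)).prod

/-- `c_p = (-1)^{p(p-1)/2}`. -/
def signC (p : ℕ) : ℝ := (-1) ^ (p * (p - 1) / 2)

/-- The supercurrent `[M]_s = c_p n ∧ n^# *dS_M` of an `m`-dimensional submanifold of `ℝⁿ`, where
`p = n - m`, `n = n₁ ∧ … ∧ n_p` with an orthonormal conormal frame, `n^# = J(n)`, and `dS_M` is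
the surface measure. -/
def current {n : ℕ} (m : ℕ) (M : Set (Space n)) : Supercurrent n where
  measure := (Measure.euclideanHausdorffMeasure m).restrict M
  density := fun x => signC (n - m) • (normalForm M x * J (normalForm M x))

/-- `S = [M]_s ∧ β_{m-1}` (for `m ≥ 1`). -/
def currentS {n : ℕ} (m : ℕ) (M : Set (Space n)) : Supercurrent n :=
  (current m M).wedge fun _ => betaPow n (m - 1)

/-- The volume form `σ = [M]_s ∧ β_m`. -/
def volForm {n : ℕ} (m : ℕ) (M : Set (Space n)) : Supercurrent n :=
  (current m M).wedge fun _ => betaPow n m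

/-- `∫ f dσ_M`: the volume form, a current of bidegree `(n, n)`, acting on a function. -/
def volIntegral {n : ℕ} (m : ℕ) (M : Set (Space n)) (f : Space n → ℝ) : ℝ :=
  (volForm m M).pair (ofFun f)

/-! ### Mean curvature flow -/

/-- The trace over a subspace `W` of the Hessian of `f` at `x`. For a unit normal form `n = df` and
`W` the tangent space of `M` this is the trace of the restriction of `F = d n^#` to `M_s`. -/
def hessTrace {n : ℕ} (W : Submodule ℝ (Space n)) (f : Space n → ℝ) (x : Space n) : ℝ :=
  ∑ i, fderiv ℝ (fderiv ℝ f) x ((stdOrthonormalBasis ℝ W i : W) : Space n)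
    ((stdOrthonormalBasis ℝ W i : W) : Space n)

/-- `v` is the mean curvature vector `∑ Hⱼ nⱼ`, `Hⱼ = tr'(d nⱼ^#)`, of the `m`-dimensional
submanifold `M` at `x`, where `nⱼ = dρⱼ` for local defining functions `ρⱼ` with differentials
orthonormal on `M`. With this sign the mean curvature vector of a sphere points outwards. -/
def IsMeanCurvatureVector {n : ℕ} (m : ℕ) (M : Set (Space n)) (x v : Space n) : Prop :=
  ∃ (U : Set (Space n)) (ρ : Fin (n - m) → Space n → ℝ),
    x ∈ U ∧ IsDefinedBy M U ρ ∧ (∀ y ∈ M ∩ U, Orthonormal ℝ fun j => gradient (ρ j) y) ∧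
      v = ∑ j, hessTrace (tangent M x) (ρ j) x • gradient (ρ j) x

/-- `F` is the (smooth) flow on `ℝⁿ`, starting at time `0`, of the time-dependent vector field `X`,
for times in the interval `I`. -/
structure IsFlow {n : ℕ} (I : Set ℝ) (X : ℝ → Space n → Space n)
    (F : ℝ → Space n → Space n) : Prop where
  smooth : ContDiffOn ℝ ∞ (fun q : ℝ × Space n => F q.1 q.2) (I ×ˢ univ)
  initial : ∀ x, F 0 x = x
  ode : ∀ x, ∀ t ∈ I, HasDerivWithinAt (fun s => F s x) (X t (F t x)) I t

/-- The family `M_t`, `t ∈ I`, of smooth `m`-dimensional submanifolds moves by the mean curvature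
flow: there is a smooth vector field `H` on the ambient space (which may depend on time), that
restricts to the mean curvature vector field of `M_t` on each `M_t`, such that `F_t(M_0) = M_t`,
where `F_t` is the flow of `-H`. -/
structure IsMeanCurvatureFlow {n : ℕ} (m : ℕ) (I : Set ℝ) (M : ℝ → Set (Space n))
    (H : ℝ → Space n → Space n) : Prop where
  submanifold : ∀ t ∈ I, IsSubmanifold m (M t)
  smooth : ContDiffOn ℝ ∞ (fun q : ℝ × Space n => H q.1 q.2) (I ×ˢ univ)
  meanCurvature : ∀ t ∈ I, ∀ x ∈ M t, IsMeanCurvatureVector m (M t) x (H t x)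
  flow : ∃ F : ℝ → Space n → Space n,
    IsFlow I (fun t x => -H t x) F ∧ ∀ t ∈ I, F t '' M 0 = M t

/-! ### `m`-subharmonic functions -/

/-- A constant superform `α` of bidegree `(n-m, n-m)` is weakly positive if
`α ∧ α₁ ∧ α₁^# ∧ … ∧ α_m ∧ α_m^# ≥ 0` for all `(1,0)`-forms `α₁, …, α_m`. -/
def IsWeaklyPositive {n : ℕ} (m : ℕ) (α : SuperAlg n) : Prop :=
  α ∈ bidegree n (n - m) (n - m) ∧
    ∀ v : Fin m → Space n, 0 ≤ berezin n (α * (List.ofFn fun j => dx (v j) * J (dx (v j))).prod)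

/-- A function `u` of class `C²` is `m`-subharmonic (`1 ≤ m ≤ n`) if `d d^# u ∧ β^{m-1} ∧ α` is
positive for every weakly positive form `α` of bidimension `(m, m)`; as the coefficients of
`d d^# u` are continuous functions this is a pointwise condition. -/
def IsMSubharmonic {n : ℕ} (m : ℕ) (u : Space n → ℝ) : Prop :=
  ∀ α : SuperAlg n, IsWeaklyPositive m α →
    ∀ x, 0 ≤ berezin n (d (dsharp (ofFun u)) x * beta n ^ (m - 1) * α)

end SuperMCF

end

open Set MeasureTheory
open scoped ContDiff Nat

noncomputable section

namespace SuperMCF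

/-! ### Constant superforms -/

section Superalgebra

variable {n : ℕ}

/-! The algebra reduces to two pointwise identities. The sign $c_p$ is exactly the one that reorders
$\nu\wedge\nu^{\#}$ into the product of the 2-forms $n_i\wedge n_i^{\#}$ (`signC_smul_prod`). That
product is central and is killed by every normal covector, so it retains only the tangential part of
$\beta$ and of $dd^{\#}\rho$. Expanding $\beta^{m-1}$ in an adapted orthonormal basis leaves
$(m-1)!$ orderings for each tangential direction. Hence $\sigma_M$ has density $1$, and
$dd^{\#}\rho\wedge S_M$ has as density the trace of the Hessian over the tangent space
(`berezin_bilinForm_mul`, `pairProd_mul_betaPow_succ`). What remains is a statement about Hausdorff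
integrals over $M_t$.

If $\psi$ is a chart of $M_0$, then $F_t\circ\psi$ parametrizes a piece of $M_t$ over a fixed
domain, and the area formula (`IsInjImmersion.measure_image`) turns the integral into one of
$\rho(F_t\psi)$ times a Jacobian. By the linearized flow equation and `fderiv_jac`, the relative
rate of change of the Jacobian is the tangential trace of $D(-\vec H)$. Since $\vec H$ is normal,
this trace equals $-|\vec H|^2$ (`tangentTrace_of_normal`). The integrand therefore changes at the
rate $-\langle\nabla\rho,\vec H\rangle-\rho|\vec H|^2$ with respect to surface measure. The
divergence theorem on the compact $M_t$ (`integral_divergence`), applied to $\nabla\rho$, replaces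
the integral of $\langle\nabla\rho,\vec H\rangle$ by that of the tangential Hessian trace, which is
the superform term.

For convex $\rho$, the Hessian is diagonalized and $\beta$ is expanded in the same eigenbasis:
$dd^{\#}\rho\wedge\beta^{m-1}$ becomes a non-negative combination of the products that test weak
positivity. For monotonicity, the density of $[M_t]_s$ is itself weakly positive, its pairings being
squares of determinants. So $m$-subharmonicity makes the Hessian trace non-negative, and both terms
of the derivative are non-positive. -/

theorem dx_add (v w : Space n) : dx (v + w) = dx v + dx w := by
  simp only [dx, ← map_add, Prod.mk_add_mk, add_zero]

theorem dx_smul (c : ℝ) (v : Space n) : dx (c • v) = c • dx v := by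
  simp only [dx, ← map_smul, Prod.smul_mk, smul_zero]

theorem dxi_add (v w : Space n) : dxi (v + w) = dxi v + dxi w := by
  simp only [dxi, ← map_add, Prod.mk_add_mk, add_zero]

theorem dxi_smul (c : ℝ) (v : Space n) : dxi (c • v) = c • dxi v := by
  simp only [dxi, ← map_smul, Prod.smul_mk, smul_zero]

theorem J_dx (v : Space n) : J (dx v) = dxi v := by
  simp [J, dx, dxi]

theorem dx_mul_dx_self (v : Space n) : dx v * dx v = 0 := ExteriorAlgebra.ι_sq_zero _

theorem dxi_mul_dxi_self (v : Space n) : dxi v * dxi v = 0 := ExteriorAlgebra.ι_sq_zero _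

theorem dxi_mul_dx (v w : Space n) : dxi v * dx w = -(dx w * dxi v) :=
  eq_neg_of_add_eq_zero_left (ExteriorAlgebra.ι_add_mul_swap _ _)

/-- Passing a generator across two others changes the sign twice, so even products are central. -/
theorem ι_mul_ι_commute (a b : Space n × Space n) (x : SuperAlg n) :
    Commute (ExteriorAlgebra.ι ℝ a * ExteriorAlgebra.ι ℝ b) x := by
  induction x using ExteriorAlgebra.induction with
  | algebraMap r => exact (Algebra.commutes r _).symm
  | ι c =>
    have h1 := eq_neg_of_add_eq_zero_left (ExteriorAlgebra.ι_add_mul_swap (R := ℝ) b c)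
    have h2 := eq_neg_of_add_eq_zero_left (ExteriorAlgebra.ι_add_mul_swap (R := ℝ) a c)
    change _ * _ = _ * _
    rw [mul_assoc, h1, mul_neg, ← mul_assoc, h2, neg_mul, neg_neg, mul_assoc]
  | mul x y hx hy => exact hx.mul_right hy
  | add x y hx hy => exact hx.add_right hy

theorem dx_mul_dxi_commute (v w : Space n) (x : SuperAlg n) : Commute (dx v * dxi w) x :=
  ι_mul_ι_commute _ _ _

/-- Products of elementary forms of bidegree `(1, 1)` are central. -/
theorem prod_commute (l : List (SuperAlg n)) (hl : ∀ a ∈ l, ∀ x, Commute a x) (x : SuperAlg n) :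
    Commute l.prod x := by
  induction l with
  | nil => exact Commute.one_left x
  | cons a l ih =>
    rw [List.prod_cons]
    exact (hl a (by simp) x).mul_left (ih fun b hb => hl b (by simp [hb]))

theorem prod_ofFn_commute {k : ℕ} (v w : Fin k → Space n) (x : SuperAlg n) :
    Commute (List.ofFn fun i => dx (v i) * dxi (w i)).prod x := by
  refine prod_commute _ (fun a ha y => ?_) x
  obtain ⟨i, rfl⟩ := (List.mem_ofFn' _ _).1 ha
  exact dx_mul_dxi_commute _ _ _

/-- Since `y` commutes with every factor, it can be moved next to the factor that annihilates it. -/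
theorem prod_mul_eq_zero {A : Type*} [Ring A] (l : List A) {a y : A} (ha : a ∈ l)
    (hay : a * y = 0) (hl : ∀ z ∈ l, Commute z y) : l.prod * y = 0 := by
  induction l with
  | nil => simp at ha
  | cons b l ih =>
    rw [List.prod_cons]
    rcases List.mem_cons.1 ha with rfl | h
    · have h2 : Commute l.prod y := by
        refine Commute.symm (Commute.list_prod_right _ _ fun z hz => (hl z (by simp [hz])).symm)
      rw [mul_assoc, h2.eq, ← mul_assoc, hay, zero_mul]
    · rw [mul_assoc, ih h fun z hz => hl z (by simp [hz]), mul_zero]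

theorem prod_ofFn_mul_dx {k : ℕ} (v : Fin k → Space n) (i : Fin k) :
    (List.ofFn fun i => dx (v i) * dxi (v i)).prod * dx (v i) = 0 := by
  refine prod_mul_eq_zero _ (a := dx (v i) * dxi (v i)) ?_ ?_ ?_
  · rw [List.mem_ofFn']; exact ⟨i, rfl⟩
  · rw [(dx_mul_dxi_commute _ _ _).eq, ← mul_assoc, dx_mul_dx_self, zero_mul]
  · intro z hz
    obtain ⟨i, rfl⟩ := (List.mem_ofFn' _ _).1 hz
    exact dx_mul_dxi_commute _ _ _

theorem prod_ofFn_mul_dxi {k : ℕ} (v : Fin k → Space n) (i : Fin k) :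
    (List.ofFn fun i => dx (v i) * dxi (v i)).prod * dxi (v i) = 0 := by
  refine prod_mul_eq_zero _ (a := dx (v i) * dxi (v i)) ?_ ?_ ?_
  · rw [List.mem_ofFn']; exact ⟨i, rfl⟩
  · rw [mul_assoc, dxi_mul_dxi_self, mul_zero]
  · intro z hz
    obtain ⟨i, rfl⟩ := (List.mem_ofFn' _ _).1 hz
    exact dx_mul_dxi_commute _ _ _

/-- The matrix whose rows are the vectors `v j`. -/
def rows {N : ℕ} (h : N = n) (v : Fin N → Space n) : Matrix (Fin n) (Fin n) ℝ :=
  Matrix.of fun j k => v (Fin.cast h.symm j) k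

/-- The interleaved order $dx_1, d\xi_1, dx_2,\dots$ of `topForm` matches the order of the factors,
so no sign appears. The coordinate matrix splits into one block for the $dx$-factors and one for the
$d\xi$-factors. -/
theorem berezin_prod {N : ℕ} (h : N = n) (v w : Fin N → Space n) :
    berezin n (List.ofFn fun i => dx (v i) * dxi (w i)).prod =
      (rows h v).det * (rows h w).det := by
  subst h
  set u : Fin (N * 2) → Space N × Space N := fun i =>
    if (finProdFinEquiv.symm i).2 = 0 then (v (finProdFinEquiv.symm i).1, 0)
    else (0, w (finProdFinEquiv.symm i).1) with hu
  have h1 : (List.ofFn fun i => dx (v i) * dxi (w i)).prod = ExteriorAlgebra.ιMulti ℝ (N * 2) u := by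
    rw [ExteriorAlgebra.ιMulti_apply, List.ofFn_mul, List.prod_flatten, List.map_ofFn]
    congr 2
    funext i
    have e0 : finProdFinEquiv.symm (⟨(i : ℕ) * 2 + ((0 : Fin 2) : ℕ), by omega⟩ : Fin (N * 2)) =
        (i, 0) := by
      rw [Equiv.symm_apply_eq]; ext; simp [finProdFinEquiv]; omega
    have e1 : finProdFinEquiv.symm (⟨(i : ℕ) * 2 + ((1 : Fin 2) : ℕ), by
        have := i.2; simp; omega⟩ : Fin (N * 2)) = (i, 1) := by
      rw [Equiv.symm_apply_eq]; ext; simp [finProdFinEquiv]; omega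
    simp only [Function.comp, List.ofFn_succ, List.ofFn_zero, List.prod_cons, List.prod_nil,
      mul_one, hu]
    have e1' : finProdFinEquiv.symm (⟨(i : ℕ) * 2 + ((Fin.succ (0 : Fin 1) : Fin 2) : ℕ), by
        have := i.2; simp; omega⟩ : Fin (N * 2)) = (i, 1) := e1
    rw [e0, e1']
    simp [dx, dxi]
  rw [h1, berezin, ExteriorAlgebra.liftAlternating_apply_ιMulti, Pi.single_eq_same, topForm,
    AlternatingMap.domDomCongr_apply, AlternatingMap.compLinearMap_apply]
  have h2 : (fun i => coords N ((u ∘ finProdFinEquiv) i)) =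
      Matrix.blockDiagonal fun s : Fin 2 => if s = 0 then rows rfl v else rows rfl w := by
    funext i k
    obtain ⟨j, s⟩ := i
    obtain ⟨k, s'⟩ := k
    simp only [Function.comp, hu, Equiv.symm_apply_apply, coords, LinearMap.coe_mk, AddHom.coe_mk,
      Matrix.blockDiagonal_apply]
    fin_cases s <;> fin_cases s' <;> simp [rows]
  have h3 := Matrix.det_blockDiagonal
    (fun s : Fin 2 => if s = 0 then rows rfl v else rows rfl w)
  rw [← h2, Fin.prod_univ_two] at h3
  exact h3

theorem rows_det_sq {N : ℕ} (h : N = n) {v : Fin N → Space n} (hv : Orthonormal ℝ v) :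
    (rows h v).det * (rows h v).det = 1 := by
  subst h
  have h1 : rows rfl v * (rows rfl v).transpose = 1 := by
    ext i j
    rw [Matrix.mul_apply]
    have := orthonormal_iff_ite.1 hv j i
    simp only [PiLp.inner_apply, RCLike.inner_apply, conj_trivial] at this
    simp only [rows, Matrix.transpose_apply, Matrix.of_apply, Fin.cast_eq_self, Matrix.one_apply]
    rw [this]
    simp [eq_comm]
  have h2 := congrArg Matrix.det h1
  rwa [Matrix.det_mul, Matrix.det_transpose, Matrix.det_one] at h2

theorem rows_det_eq_zero {N : ℕ} (h : N = n) {v : Fin N → Space n} {i j : Fin N} (hij : i ≠ j)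
    (hv : v i = v j) : (rows h v).det = 0 := by
  subst h
  refine Matrix.det_zero_of_row_eq hij ?_
  funext k
  simp [rows, hv]

theorem signC_succ (p : ℕ) : signC (p + 1) = signC p * (-1) ^ p := by
  have : (p + 1) * (p + 1 - 1) / 2 = p * (p - 1) / 2 + p := by
    rcases p with _ | p
    · rfl
    · have : (p + 1 + 1) * (p + 1 + 1 - 1) = (p + 1) * (p + 1 - 1) + (p + 1) * 2 := by
        simp only [Nat.add_sub_cancel]; ring
      rw [this, Nat.add_mul_div_right _ _ two_pos]
  rw [signC, signC, this, pow_add]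

theorem dxi_mul_prod_dx (a : Space n) {p : ℕ} (v : Fin p → Space n) :
    (List.ofFn fun i => dx (v i)).prod * dxi a =
      ((-1 : ℝ) ^ p) • (dxi a * (List.ofFn fun i => dx (v i)).prod) := by
  induction p with
  | zero => simp
  | succ p ih =>
    rw [List.ofFn_succ, List.prod_cons, mul_assoc, ih, pow_succ, mul_smul_comm, ← mul_assoc,
      ← mul_assoc, dxi_mul_dx]
    simp

/-- By induction: moving the new $d\xi$-factor to the left across $p$ factors $dx$ costs $(-1)^p$,
which is precisely the quotient $c_{p+1}/c_p$. -/
theorem signC_smul_prod {p : ℕ} (v : Fin p → Space n) :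
    signC p • ((List.ofFn fun i => dx (v i)).prod * J (List.ofFn fun i => dx (v i)).prod) =
      (List.ofFn fun i => dx (v i) * dxi (v i)).prod := by
  induction p with
  | zero => simp [signC]
  | succ p ih =>
    rw [List.ofFn_succ, List.prod_cons, map_mul, J_dx, List.ofFn_succ, List.prod_cons, ← ih,
      signC_succ]
    set X := (List.ofFn fun i => dx (v (Fin.succ i))).prod with hX
    have h : X * dxi (v 0) = ((-1 : ℝ) ^ p) • (dxi (v 0) * X) := dxi_mul_prod_dx _ _
    rw [show dx (v 0) * X * (dxi (v 0) * J X) = dx (v 0) * (X * dxi (v 0)) * J X by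
      simp only [mul_assoc], h]
    simp only [mul_smul_comm, smul_mul_assoc, smul_smul, mul_assoc]
    rw [← mul_pow]
    simp

/-- A finite sum to a power, as a sum of ordered products. -/
theorem sum_pow_eq_sum_prod {A ι : Type*} [Semiring A] [Fintype ι] [DecidableEq ι] (a : ι → A)
    (k : ℕ) : (∑ i, a i) ^ k = ∑ f : Fin k → ι, (List.ofFn fun j => a (f j)).prod := by
  induction k with
  | zero => simp
  | succ k ih =>
    rw [pow_succ', ih, Finset.sum_mul_sum, ← Fintype.sum_prod_type' (fun (i : ι)
      (f : Fin k → ι) => a i * (List.ofFn fun j => a (f j)).prod)]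
    refine Fintype.sum_equiv (Fin.consEquiv fun _ => ι) _ _ fun x => ?_
    simp [Fin.consEquiv, List.ofFn_succ]

/-- Contraction does not depend on the orthonormal basis. -/
theorem sum_bilin_orthonormalBasis {E A ι κ : Type*} [NormedAddCommGroup E]
    [InnerProductSpace ℝ E] [FiniteDimensional ℝ E] [AddCommGroup A] [Module ℝ A] [Fintype ι]
    [Fintype κ] (b : OrthonormalBasis ι ℝ E) (c : OrthonormalBasis κ ℝ E) (Q : E →ₗ[ℝ] E →ₗ[ℝ] A) :
    ∑ i, Q (b i) (b i) = ∑ i, Q (c i) (c i) := by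
  classical
  -- The tensor $\sum b_i\otimes b_i$ is the same for all orthonormal bases, and both sums are its
  -- image under the linear map induced by `Q`.
  have h := InnerProductSpace.canonicalCovariantTensor_eq_sum E b
  rw [InnerProductSpace.canonicalCovariantTensor_eq_sum E c] at h
  have := congrArg (TensorProduct.lift Q) h
  simpa using this.symm

/-- The form `dx v ∧ dξ w`, as a bilinear function. -/
def dxdxi (n : ℕ) : Space n →ₗ[ℝ] Space n →ₗ[ℝ] SuperAlg n :=
  LinearMap.mk₂ ℝ (fun v w => dx v * dxi w) (fun _ _ _ => by rw [dx_add, add_mul])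
    (fun _ _ _ => by rw [dx_smul, smul_mul_assoc]) (fun _ _ _ => by rw [dxi_add, mul_add])
    (fun _ _ _ => by rw [dxi_smul, mul_smul_comm])

@[simp] theorem dxdxi_apply (v w : Space n) : dxdxi n v w = dx v * dxi w := rfl

theorem basisFun_apply_eq_e (j : Fin n) : EuclideanSpace.basisFun (Fin n) ℝ j = e j := by
  simp [e]

theorem beta_eq_sum {ι : Type*} [Fintype ι] (b : OrthonormalBasis ι ℝ (Space n)) :
    beta n = ∑ i, dx (b i) * dxi (b i) := by
  have := sum_bilin_orthonormalBasis (EuclideanSpace.basisFun (Fin n) ℝ) b (dxdxi n)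
  simp only [dxdxi_apply, basisFun_apply_eq_e] at this
  exact this

/-- The superform `∑ B(eⱼ, eₖ) dxⱼ ∧ dξₖ` of a bilinear form `B`. -/
def bilinForm (B : Space n →ₗ[ℝ] Space n →ₗ[ℝ] ℝ) : SuperAlg n :=
  ∑ j, ∑ k, B (e j) (e k) • (dx (e j) * dxi (e k))

/-- Independence of the basis is obtained by contracting one slot at a time, the other being held
fixed. -/
theorem bilinForm_eq_sum {ι : Type*} [Fintype ι] (B : Space n →ₗ[ℝ] Space n →ₗ[ℝ] ℝ)
    (b : OrthonormalBasis ι ℝ (Space n)) :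
    bilinForm B = ∑ i, ∑ j, B (b i) (b j) • (dx (b i) * dxi (b j)) := by
  let c := EuclideanSpace.basisFun (Fin n) ℝ
  have h1 : ∀ v w : Space n, ∑ k, B v (c k) • (dx w * dxi (c k)) =
      ∑ k, B v (b k) • (dx w * dxi (b k)) := by
    intro v w
    exact sum_bilin_orthonormalBasis c b (LinearMap.mk₂ ℝ (fun x y => B v x • (dx w * dxi y))
      (by intros; simp [add_smul]) (by intros; simp [mul_smul])
      (by intros; simp [dxi_add, mul_add]) (by intros; rw [dxi_smul, mul_smul_comm, smul_comm]))
  have h2 : ∀ v w : Space n, ∑ k, B (c k) v • (dx (c k) * dxi w) =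
      ∑ k, B (b k) v • (dx (b k) * dxi w) := by
    intro v w
    exact sum_bilin_orthonormalBasis c b (LinearMap.mk₂ ℝ (fun x y => B x v • (dx y * dxi w))
      (by intros; simp [add_smul]) (by intros; simp [mul_smul])
      (by intros; simp [dx_add, add_mul]) (by intros; rw [dx_smul, smul_mul_assoc, smul_comm]))
  calc bilinForm B = ∑ j, ∑ k, B (c j) (c k) • (dx (c j) * dxi (c k)) := by
        simp only [bilinForm, c, basisFun_apply_eq_e]
    _ = ∑ j, ∑ k, B (c j) (b k) • (dx (c j) * dxi (b k)) := by simp only [h1]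
    _ = ∑ k, ∑ j, B (c j) (b k) • (dx (c j) * dxi (b k)) := Finset.sum_comm
    _ = ∑ k, ∑ j, B (b j) (b k) • (dx (b j) * dxi (b k)) := by simp only [h2]
    _ = _ := Finset.sum_comm

end Superalgebra

/-! ### Products of the current with $\beta^k$ and with a bilinear form -/

section Contraction

variable {n p k : ℕ}

/-- The product of the `dx νᵢ ∧ dξ νᵢ`. -/
def pairProd {p : ℕ} (ν : Fin p → Space n) : SuperAlg n :=
  (List.ofFn fun i => dx (ν i) * dxi (ν i)).prod

theorem pairProd_commute (ν : Fin p → Space n) (x : SuperAlg n) : Commute (pairProd ν) x :=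
  prod_ofFn_commute _ _ x

/-- An injective self-map of a finite set is onto, so the first entry must be the only value missed
by `f`. -/
theorem injective_cons_unique {j l : Fin (k + 1)} {f : Fin k → Fin (k + 1)}
    (hj : Function.Injective (Fin.cons j f : Fin (k + 1) → Fin (k + 1)))
    (hl : Function.Injective (Fin.cons l f : Fin (k + 1) → Fin (k + 1))) : j = l := by
  obtain ⟨i, hi⟩ := Finite.surjective_of_injective hl j
  rcases Fin.eq_zero_or_eq_succ i with rfl | ⟨i, rfl⟩
  · simpa using hi.symm
  · rw [Fin.cons_succ] at hi
    have := @hj i.succ 0 (by simpa using hi)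
    exact absurd this (Fin.succ_ne_zero i)

theorem finrank_space_eq (b : OrthonormalBasis (Fin p ⊕ Fin k) ℝ (Space n)) : p + k = n := by
  have h1 := Module.finrank_eq_card_basis b.toBasis
  simpa using h1.symm

/-- The value is a product of two determinants whose rows come from one orthonormal basis. A
repeated row makes a determinant vanish; if neither list repeats, the lists coincide and the square
of an orthogonal determinant is $1$. -/
theorem berezin_pairProd_mul (b : OrthonormalBasis (Fin p ⊕ Fin (k + 1)) ℝ (Space n))
    (j l : Fin (k + 1)) (f : Fin k → Fin (k + 1)) :
    berezin n (pairProd (fun i => b (Sum.inl i)) * (dx (b (Sum.inr j)) * dxi (b (Sum.inr l))) *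
      (List.ofFn fun i => dx (b (Sum.inr (f i))) * dxi (b (Sum.inr (f i)))).prod) =
    if Function.Injective (Fin.cons j f : Fin (k + 1) → Fin (k + 1)) ∧ j = l then 1 else 0 := by
  have hn := finrank_space_eq b
  set ν : Fin p → Space n := fun i => b (Sum.inl i)
  let g : Fin (k + 1) → Fin (p + (k + 1)) → Fin p ⊕ Fin (k + 1) := fun j =>
    Fin.append Sum.inl (Sum.inr ∘ (Fin.cons j f : Fin (k + 1) → Fin (k + 1)))
  have hprod : pairProd ν * (dx (b (Sum.inr j)) * dxi (b (Sum.inr l))) *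
      (List.ofFn fun i => dx (b (Sum.inr (f i))) * dxi (b (Sum.inr (f i)))).prod =
      (List.ofFn fun i => dx (b (g j i)) * dxi (b (g l i))).prod := by
    have : (fun i => dx (b (g j i)) * dxi (b (g l i))) =
        Fin.append (fun i => dx (ν i) * dxi (ν i)) (Fin.cons
          (dx (b (Sum.inr j)) * dxi (b (Sum.inr l)))
          fun i => dx (b (Sum.inr (f i))) * dxi (b (Sum.inr (f i)))) := by
      funext i
      refine Fin.addCases (fun i => ?_) (fun i => ?_) i
      · simp [g, ν]
      · refine Fin.cases ?_ (fun i => ?_) i <;> simp [g]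
    rw [this, List.ofFn_fin_append, List.prod_append, List.ofFn_succ (f := Fin.cons _ _),
      List.prod_cons, mul_assoc]
    simp only [Fin.cons_zero, Fin.cons_succ]
    rfl
  rw [hprod, berezin_prod hn]
  have hzero : ∀ j, ¬ Function.Injective (Fin.cons j f : Fin (k + 1) → Fin (k + 1)) →
      (rows hn fun i => b (g j i)).det = 0 := by
    intro j hj
    simp only [Function.Injective, not_forall] at hj
    obtain ⟨a, c, hac, hne⟩ := hj
    refine rows_det_eq_zero hn (i := Fin.natAdd p a) (j := Fin.natAdd p c) ?_ ?_
    · intro h; exact hne (by simpa using h)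
    · simp only [g, Fin.append_right, Function.comp, hac]
  have hone : ∀ j, Function.Injective (Fin.cons j f : Fin (k + 1) → Fin (k + 1)) →
      (rows hn fun i => b (g j i)).det * (rows hn fun i => b (g j i)).det = 1 := by
    intro j hj
    refine rows_det_sq hn (b.orthonormal.comp (g j) ?_)
    refine Fin.append_injective_iff.2 ⟨Sum.inl_injective, Sum.inr_injective.comp hj, ?_⟩
    simp
  by_cases hj : Function.Injective (Fin.cons j f : Fin (k + 1) → Fin (k + 1))
  · by_cases hjl : j = l
    · subst hjl
      rw [if_pos ⟨hj, rfl⟩, hone j hj]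
    · rw [if_neg fun h => hjl h.2, hzero l fun hl => hjl (injective_cons_unique hj hl), mul_zero]
  · rw [if_neg fun h => hj h.1, hzero j hj, zero_mul]

/-- A summand containing a normal $dx$ or $d\xi$ repeats a factor of `pairProd` and vanishes; only
the tangential block survives. -/
theorem pairProd_mul_bilinForm (B : Space n →ₗ[ℝ] Space n →ₗ[ℝ] ℝ)
    (b : OrthonormalBasis (Fin p ⊕ Fin k) ℝ (Space n)) :
    pairProd (fun i => b (Sum.inl i)) * bilinForm B =
      ∑ j, ∑ l, B (b (Sum.inr j)) (b (Sum.inr l)) •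
        (pairProd (fun i => b (Sum.inl i)) * (dx (b (Sum.inr j)) * dxi (b (Sum.inr l)))) := by
  have h1 : ∀ (i : Fin p) x, pairProd (fun i => b (Sum.inl i)) * (dx (b (Sum.inl i)) * x) = 0 := by
    intro i x
    rw [← mul_assoc, pairProd, prod_ofFn_mul_dx (fun i => b (Sum.inl i)) i, zero_mul]
  have h2 : ∀ (i : Fin p) x, pairProd (fun i => b (Sum.inl i)) * (x * dxi (b (Sum.inl i))) = 0 := by
    intro i x
    rw [← mul_assoc, (pairProd_commute _ x).eq, mul_assoc, pairProd,
      prod_ofFn_mul_dxi (fun i => b (Sum.inl i)) i, mul_zero]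
  rw [bilinForm_eq_sum B b]
  simp only [Fintype.sum_sum_type, mul_add, Finset.mul_sum, mul_smul_comm, h1, h2, smul_zero,
    Finset.sum_const_zero, zero_add]

theorem pairProd_mul_beta_pow (b : OrthonormalBasis (Fin p ⊕ Fin k) ℝ (Space n)) (r : ℕ) :
    pairProd (fun i => b (Sum.inl i)) * beta n ^ r =
      pairProd (fun i => b (Sum.inl i)) *
        (∑ j, dx (b (Sum.inr j)) * dxi (b (Sum.inr j))) ^ r := by
  induction r with
  | zero => simp
  | succ r ih =>
    have h1 : pairProd (fun i => b (Sum.inl i)) * beta n =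
        pairProd (fun i => b (Sum.inl i)) * ∑ j, dx (b (Sum.inr j)) * dxi (b (Sum.inr j)) := by
      rw [beta_eq_sum b, Fintype.sum_sum_type, mul_add, Finset.mul_sum, Finset.sum_eq_zero,
        zero_add]
      intro i _
      rw [← mul_assoc, pairProd, prod_ofFn_mul_dx (fun i => b (Sum.inl i)) i, zero_mul]
    set S := ∑ j, dx (b (Sum.inr j)) * dxi (b (Sum.inr j))
    rw [pow_succ, ← mul_assoc, ih, (pairProd_commute _ (S ^ r)).eq, mul_assoc, h1, ← mul_assoc,
      ← (pairProd_commute _ (S ^ r)).eq, mul_assoc, ← pow_succ]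

/-- The pairs $(j,f)$ that contribute are the permutations of $k+1$ letters, and each value at $0$
is taken by $k!$ of them. -/
theorem sum_injective_cons (c : Fin (k + 1) → ℝ) :
    ∑ j, ∑ f : Fin k → Fin (k + 1),
      (if Function.Injective (Fin.cons j f : Fin (k + 1) → Fin (k + 1)) then c j else 0) =
      (k ! : ℝ) * ∑ j, c j := by
  have h1 : ∑ j, ∑ f : Fin k → Fin (k + 1),
      (if Function.Injective (Fin.cons j f : Fin (k + 1) → Fin (k + 1)) then c j else 0) =
      ∑ g : Fin (k + 1) → Fin (k + 1), if Function.Injective g then c (g 0) else 0 := by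
    rw [← Fintype.sum_prod_type' (fun (j : Fin (k + 1)) (f : Fin k → Fin (k + 1)) =>
      if Function.Injective (Fin.cons j f : Fin (k + 1) → Fin (k + 1)) then c j else 0)]
    refine Fintype.sum_equiv (Fin.consEquiv fun _ => Fin (k + 1)) _ _ fun x => ?_
    simp [Fin.consEquiv]
  have h2 : (∑ g : Fin (k + 1) → Fin (k + 1), if Function.Injective g then c (g 0) else 0) =
      ∑ σ : Equiv.Perm (Fin (k + 1)), c (σ 0) := by
    rw [← Finset.sum_filter]
    symm
    refine Finset.sum_bij (fun σ _ => (σ : Fin (k + 1) → Fin (k + 1))) ?_ ?_ ?_ ?_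
    · intro σ _; simpa using σ.injective
    · intro σ _ τ _ h; exact DFunLike.coe_injective h
    · intro g hg
      have hg' : Function.Injective g := by simpa using hg
      exact ⟨Equiv.ofBijective g (Finite.injective_iff_bijective.1 hg'), Finset.mem_univ _, rfl⟩
    · intro σ _; rfl
  -- `Equiv.Perm.decomposeFin` separates the value at $0$ from a permutation of the other $k$
  -- letters.
  rw [h1, h2, ← Equiv.sum_comp Equiv.Perm.decomposeFin.symm, Fintype.sum_prod_type]
  simp [Finset.mul_sum, Fintype.card_perm]

/-- This is why $dd^{\#}\rho\wedge S_M$ is a trace: off-diagonal terms vanish, each diagonal entry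
is counted $k!$ times, and this cancels the factorial in `betaPow`. -/
theorem berezin_bilinForm_mul (B : Space n →ₗ[ℝ] Space n →ₗ[ℝ] ℝ)
    (b : OrthonormalBasis (Fin p ⊕ Fin (k + 1)) ℝ (Space n)) :
    berezin n (bilinForm B * (pairProd (fun i => b (Sum.inl i)) * betaPow n k)) =
      ∑ j, B (b (Sum.inr j)) (b (Sum.inr j)) := by
  set ν : Fin p → Space n := fun i => b (Sum.inl i)
  have h1 : bilinForm B * (pairProd ν * betaPow n k) = (k ! : ℝ)⁻¹ • ∑ j, ∑ l,
      B (b (Sum.inr j)) (b (Sum.inr l)) • ∑ f : Fin k → Fin (k + 1),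
        (pairProd ν * (dx (b (Sum.inr j)) * dxi (b (Sum.inr l))) *
        (List.ofFn fun i => dx (b (Sum.inr (f i))) * dxi (b (Sum.inr (f i)))).prod) := by
    rw [betaPow, mul_smul_comm, mul_smul_comm, pairProd_mul_beta_pow b k, ← mul_assoc,
      ← (pairProd_commute ν _).eq, pairProd_mul_bilinForm B b, sum_pow_eq_sum_prod]
    rw [Finset.sum_mul]
    congr 1
    refine Finset.sum_congr rfl fun j _ => ?_
    rw [Finset.sum_mul]
    refine Finset.sum_congr rfl fun l _ => ?_
    rw [smul_mul_assoc, Finset.mul_sum]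
  rw [h1]
  simp only [map_smul, map_sum, ν, berezin_pairProd_mul]
  have h2 : ∀ j : Fin (k + 1), ∑ l, B (b (Sum.inr j)) (b (Sum.inr l)) • ∑ f : Fin k → Fin (k + 1),
      (if Function.Injective (Fin.cons j f : Fin (k + 1) → Fin (k + 1)) ∧ j = l then (1 : ℝ) else 0)
      = ∑ f : Fin k → Fin (k + 1), if Function.Injective (Fin.cons j f : Fin (k + 1) → Fin (k + 1))
        then B (b (Sum.inr j)) (b (Sum.inr j)) else 0 := by
    intro j
    rw [Finset.sum_eq_single j]
    · simp only [smul_eq_mul, and_true, Finset.mul_sum, mul_ite, mul_one, mul_zero]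
    · intro l _ hl
      simp [hl.symm]
    · simp
  simp only [h2]
  rw [sum_injective_cons (fun j => B (b (Sum.inr j)) (b (Sum.inr j))), smul_eq_mul, ← mul_assoc,
    inv_mul_cancel₀ (by positivity), one_mul]

/-- Take for the bilinear form the scalar product, whose superform is $\beta$. Its tangential trace
$k+1$ is the factor between $\beta\wedge\beta_k$ and $\beta_{k+1}$. -/
theorem pairProd_mul_betaPow_succ (b : OrthonormalBasis (Fin p ⊕ Fin (k + 1)) ℝ (Space n)) :
    berezin n (pairProd (fun i => b (Sum.inl i)) * betaPow n (k + 1)) = 1 := by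
  have h := berezin_bilinForm_mul (innerₗ (Space n)) b
  have h1 : bilinForm (innerₗ (Space n)) = beta n := by
    rw [bilinForm_eq_sum _ (EuclideanSpace.basisFun (Fin n) ℝ),
      beta_eq_sum (EuclideanSpace.basisFun (Fin n) ℝ)]
    refine Finset.sum_congr rfl fun i _ => ?_
    rw [Finset.sum_eq_single i]
    · simp
    · intro j _ hj
      rw [innerₗ_apply_apply, (EuclideanSpace.basisFun (Fin n) ℝ).orthonormal.2 hj.symm, zero_smul]
    · simp
  rw [h1, ← mul_assoc, ← (pairProd_commute _ _).eq, mul_assoc, betaPow, mul_smul_comm,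
    ← pow_succ', mul_smul_comm, map_smul] at h
  simp only [innerₗ_apply_apply, real_inner_self_eq_norm_sq, b.orthonormal.1, one_pow,
    Finset.sum_const, Finset.card_univ, Fintype.card_fin, nsmul_eq_mul, mul_one] at h
  rw [betaPow, mul_smul_comm, map_smul, Nat.factorial_succ, Nat.cast_mul, mul_inv, mul_smul, h,
    smul_eq_mul, inv_mul_cancel₀ (by positivity)]

end Contraction

/-! ### Bases adapted to the tangent and normal spaces -/

section TangentSplitting

variable {n : ℕ}

/-- The orthonormal basis of `ℝⁿ` adapted to a subspace and its orthogonal complement. -/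
theorem exists_adapted_orthonormalBasis {m : ℕ} (T : Submodule ℝ (Space n))
    (hT : Module.finrank ℝ T = m) :
    ∃ b : OrthonormalBasis (Fin (Module.finrank ℝ Tᗮ) ⊕ Fin m) ℝ (Space n),
      (∀ i, b (Sum.inl i) = ((stdOrthonormalBasis ℝ Tᗮ i : Tᗮ) : Space n)) ∧
      ∀ i, b (Sum.inr i) = ((stdOrthonormalBasis ℝ T (Fin.cast hT.symm i) : T) : Space n) := by
  subst hT
  let f : Fin (Module.finrank ℝ Tᗮ) ⊕ Fin (Module.finrank ℝ T) → Space n :=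
    Sum.elim (fun i => ((stdOrthonormalBasis ℝ Tᗮ i : Tᗮ) : Space n))
      (fun i => ((stdOrthonormalBasis ℝ T i : T) : Space n))
  have hf : Orthonormal ℝ f := by
    rw [orthonormal_iff_ite]
    have h1 := orthonormal_iff_ite.1 (stdOrthonormalBasis ℝ Tᗮ).orthonormal
    have h2 := orthonormal_iff_ite.1 (stdOrthonormalBasis ℝ T).orthonormal
    rintro (i | i) (j | j)
    · simpa [f] using h1 i j
    · simpa [f] using (Submodule.inner_left_of_mem_orthogonal (stdOrthonormalBasis ℝ T j).2
        (stdOrthonormalBasis ℝ Tᗮ i).2)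
    · simpa [f] using (Submodule.inner_right_of_mem_orthogonal (stdOrthonormalBasis ℝ T i).2
        (stdOrthonormalBasis ℝ Tᗮ j).2)
    · simpa [f] using h2 i j
  have hc : Fintype.card (Fin (Module.finrank ℝ Tᗮ) ⊕ Fin (Module.finrank ℝ T)) =
      Module.finrank ℝ (Space n) := by
    rw [Fintype.card_sum, Fintype.card_fin, Fintype.card_fin, add_comm,
      Submodule.finrank_add_finrank_orthogonal]
  have hs : ⊤ ≤ Submodule.span ℝ (Set.range f) :=
    (hf.linearIndependent.span_eq_top_of_card_eq_finrank' hc).ge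
  exact ⟨OrthonormalBasis.mk hf hs, fun i => by simp [f], fun i => by simp [f]⟩

end TangentSplitting

/-! ### Densities of $\sigma_M$ and of $dd^{\#}\rho\wedge S_M$ -/

section GeometricDensities

variable {n : ℕ}

/-- `coeffDeriv` refers to an arbitrary basis of the algebra; linearity of the coordinates frees it
from that choice and lets any convenient expansion be differentiated termwise. -/
theorem coeffDeriv_sum_smul {ι : Type*} [Fintype ι] (c : ι → Space n → ℝ) (A : ι → SuperAlg n)
    {x : Space n} (hc : ∀ k, DifferentiableAt ℝ (c k) x) (v : Space n) :
    coeffDeriv v (fun y => ∑ k, c k y • A k) x = ∑ k, fderiv ℝ (c k) x v • A k := by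
  set b := Module.finBasis ℝ (SuperAlg n)
  have h1 : ∀ i, fderiv ℝ (fun y => b.repr (∑ k, c k y • A k) i) x v =
      b.repr (∑ k, fderiv ℝ (c k) x v • A k) i := by
    intro i
    have h2 : HasFDerivAt (fun y => ∑ k, c k y * b.repr (A k) i)
        (∑ k, b.repr (A k) i • fderiv ℝ (c k) x) x :=
      HasFDerivAt.fun_sum fun k _ => (hc k).hasFDerivAt.mul_const _
    have h3 : (fun y => b.repr (∑ k, c k y • A k) i) = fun y => ∑ k, c k y * b.repr (A k) i := by
      funext y
      simp [Finsupp.finsetSum_apply]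
    rw [h3, h2.fderiv]
    simp [Finsupp.finsetSum_apply, mul_comm]
  unfold coeffDeriv
  simp only [b] at h1
  simp only [h1]
  exact b.sum_repr _

/-- The Hessian of a function at a point, as a bilinear form. -/
def hess (f : Space n → ℝ) (x : Space n) : Space n →ₗ[ℝ] Space n →ₗ[ℝ] ℝ :=
  (ContinuousLinearMap.coeLM ℝ).comp (fderiv ℝ (fderiv ℝ f) x).toLinearMap

@[simp] theorem hess_apply (f : Space n → ℝ) (x v w : Space n) :
    hess f x v w = fderiv ℝ (fderiv ℝ f) x v w := rfl

theorem d_dsharp_ofFun {f : Space n → ℝ} (hf : ContDiff ℝ 2 f) (x : Space n) :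
    d (dsharp (ofFun f)) x = bilinForm (hess f x) := by
  have hf1 : Differentiable ℝ f := hf.differentiable (by norm_num)
  have hf2 : Differentiable ℝ (fderiv ℝ f) :=
    (hf.fderiv_right (m := 1) (by norm_num)).differentiable (by norm_num)
  have h1 : dsharp (ofFun f) = fun y => ∑ k : Fin n, fderiv ℝ f y (e k) • dxi (e k) := by
    funext y
    refine Finset.sum_congr rfl fun k _ => ?_
    -- The function is viewed as a one-term sum with constant form $1$.
    have h := coeffDeriv_sum_smul (ι := Unit) (fun _ => f) (fun _ => (1 : SuperAlg n))
      (fun _ => hf1 y) (e k)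
    have h2 : ofFun f = fun y => ∑ _k : Unit, f y • (1 : SuperAlg n) := by
      funext z; simp [ofFun, Algebra.algebraMap_eq_smul_one]
    rw [h2, h]
    simp
  have h2 : ∀ k : Fin n, HasFDerivAt (fun y => fderiv ℝ f y (e k))
      ((fderiv ℝ (fderiv ℝ f) x).flip (e k)) x := fun k => by
    have := (hf2 x).hasFDerivAt.clm_apply (hasFDerivAt_const (e k) x)
    simpa using this
  rw [d, bilinForm, h1]
  refine Finset.sum_congr rfl fun j _ => ?_
  rw [coeffDeriv_sum_smul _ _ fun k => (h2 k).differentiableAt, Finset.mul_sum]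
  refine Finset.sum_congr rfl fun k _ => ?_
  rw [(h2 k).fderiv, mul_smul_comm]
  rfl

theorem J_prod_dx {p : ℕ} (v : Fin p → Space n) :
    J (List.ofFn fun i => dx (v i)).prod = (List.ofFn fun i => dxi (v i)).prod := by
  rw [map_list_prod, List.map_ofFn]
  congr 2
  funext i
  exact J_dx _

theorem finrank_normal {m : ℕ} {M : Set (Space n)} {x : Space n}
    (hT : Module.finrank ℝ (tangent M x) = m) : Module.finrank ℝ (normal M x) = n - m := by
  have := Submodule.finrank_add_finrank_orthogonal (tangent M x)
  rw [hT, finrank_euclideanSpace_fin] at this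
  rw [normal]
  omega

theorem current_density {m : ℕ} {M : Set (Space n)} {x : Space n}
    (hT : Module.finrank ℝ (tangent M x) = m) :
    (current m M).density x =
      pairProd (fun i => ((stdOrthonormalBasis ℝ (normal M x) i : normal M x) : Space n)) := by
  have h : signC (n - m) = signC (Module.finrank ℝ (normal M x)) := by rw [finrank_normal hT]
  rw [pairProd, ← signC_smul_prod, ← h]
  rfl

theorem berezin_volForm {m : ℕ} (hm : 1 ≤ m) {M : Set (Space n)} {x : Space n}
    (hT : Module.finrank ℝ (tangent M x) = m) :
    berezin n ((volForm m M).density x) = 1 := by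
  obtain ⟨k, rfl⟩ : ∃ k, m = k + 1 := ⟨m - 1, by omega⟩
  obtain ⟨b, hb1, -⟩ := exists_adapted_orthonormalBasis _ hT
  have h := pairProd_mul_betaPow_succ b
  simp only [hb1] at h
  change berezin n ((current (k + 1) M).density x * betaPow n (k + 1)) = 1
  rw [current_density hT]
  exact h

theorem hessTrace_eq_sum {m : ℕ} {T : Submodule ℝ (Space n)} (hT : Module.finrank ℝ T = m)
    (f : Space n → ℝ) (x : Space n) : hessTrace T f x =
      ∑ i : Fin m, hess f x ((stdOrthonormalBasis ℝ T (Fin.cast hT.symm i) : T) : Space n)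
        ((stdOrthonormalBasis ℝ T (Fin.cast hT.symm i) : T) : Space n) := by
  subst hT
  rfl

theorem berezin_dd_currentS {m : ℕ} (hm : 1 ≤ m) {M : Set (Space n)} {x : Space n}
    (hT : Module.finrank ℝ (tangent M x) = m) {f : Space n → ℝ} (hf : ContDiff ℝ 2 f) :
    berezin n (d (dsharp (ofFun f)) x * (currentS m M).density x) =
      hessTrace (tangent M x) f x := by
  obtain ⟨k, rfl⟩ : ∃ k, m = k + 1 := ⟨m - 1, by omega⟩
  obtain ⟨b, hb1, hb2⟩ := exists_adapted_orthonormalBasis _ hT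
  have h := berezin_bilinForm_mul (hess f x) b
  simp only [hb1, hb2] at h
  change berezin n (d (dsharp (ofFun f)) x * ((current (k + 1) M).density x * betaPow n k)) = _
  rw [current_density hT, d_dsharp_ofFun hf, hessTrace_eq_sum hT]
  exact h

theorem volIntegral_eq {m : ℕ} (hm : 1 ≤ m) {M : Set (Space n)} (hM : MeasurableSet M)
    (hT : ∀ x ∈ M, Module.finrank ℝ (tangent M x) = m) (f : Space n → ℝ) :
    volIntegral m M f = ∫ x in M, f x ∂(Measure.euclideanHausdorffMeasure m) := by
  refine setIntegral_congr_fun hM fun x hx => ?_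
  change berezin n ((volForm m M).density x * algebraMap ℝ (SuperAlg n) (f x)) = f x
  rw [← Algebra.commutes, ← Algebra.smul_def, map_smul, berezin_volForm hm (hT x hx), smul_eq_mul,
    mul_one]

theorem superIntegral_dd_currentS {m : ℕ} (hm : 1 ≤ m) {M : Set (Space n)} (hM : MeasurableSet M)
    (hT : ∀ x ∈ M, Module.finrank ℝ (tangent M x) = m) {f : Space n → ℝ} (hf : ContDiff ℝ 2 f) :
    superIntegral (wedgeLeft (d (dsharp (ofFun f))) (currentS m M)) =
      ∫ x in M, hessTrace (tangent M x) f x ∂(Measure.euclideanHausdorffMeasure m) :=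
  setIntegral_congr_fun hM fun x hx => berezin_dd_currentS hm (hT x hx) hf

/-! ### Weak positivity, convexity and $m$-subharmonicity -/

theorem prod_mem_span (D : Space n →ₗ[ℝ] SuperAlg n) {p : ℕ} (v : Fin p → Space n) :
    (List.ofFn fun i => D (v i)).prod ∈ Submodule.span ℝ
      (Set.range fun I : Fin p → Fin n => (List.ofFn fun i => D (e (I i))).prod) := by
  induction p with
  | zero => exact Submodule.subset_span ⟨fun i => i.elim0, by simp⟩
  | succ p ih =>
    rw [List.ofFn_succ, List.prod_cons]
    have h1 : v 0 = ∑ k, v 0 k • e k := by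
      ext j
      simp [e, Finset.sum_apply, Pi.single_apply]
    rw [h1, map_sum, Finset.sum_mul]
    refine Submodule.sum_mem _ fun k _ => ?_
    rw [map_smul, smul_mul_assoc]
    refine Submodule.smul_mem _ _ ?_
    have h2 := Submodule.mem_map_of_mem (f := LinearMap.mulLeft ℝ (D (e k)))
      (ih fun i => v i.succ)
    rw [Submodule.map_span] at h2
    refine Submodule.span_mono ?_ h2
    rintro _ ⟨_, ⟨I, rfl⟩, rfl⟩
    exact ⟨Fin.cons k I, by simp [List.ofFn_succ]⟩

theorem prod_mem_bidegree {p : ℕ} (v : Fin p → Space n) :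
    (List.ofFn fun i => dx (v i)).prod * (List.ofFn fun i => dxi (v i)).prod ∈
      bidegree n p p := by
  let D : Space n →ₗ[ℝ] SuperAlg n := ⟨⟨dx, dx_add⟩, dx_smul⟩
  let D' : Space n →ₗ[ℝ] SuperAlg n := ⟨⟨dxi, dxi_add⟩, dxi_smul⟩
  have h := Submodule.mul_mem_mul (prod_mem_span D v) (prod_mem_span D' v)
  rw [Submodule.span_mul_span] at h
  refine Submodule.span_mono ?_ h
  rintro _ ⟨_, ⟨I, rfl⟩, _, ⟨K, rfl⟩, rfl⟩
  exact ⟨(I, K), rfl⟩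

/-- Paired with $m$ products $v_j\wedge v_j^{\#}$, the density gives the square of the determinant
of the normal frame completed by the $v_j$. -/
theorem current_weaklyPositive {m : ℕ} (hmn : m ≤ n) {M : Set (Space n)} {x : Space n}
    (hT : Module.finrank ℝ (tangent M x) = m) :
    IsWeaklyPositive m ((current m M).density x) := by
  constructor
  · refine Submodule.smul_mem _ _ ?_
    have h := prod_mem_bidegree
      (fun i => ((stdOrthonormalBasis ℝ (normal M x) i : normal M x) : Space n))
    have hb : bidegree n (n - m) (n - m) =
        bidegree n (Module.finrank ℝ (normal M x)) (Module.finrank ℝ (normal M x)) := by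
      rw [finrank_normal hT]
    rw [← J_prod_dx] at h
    rw [hb]
    exact h
  · intro v
    set ν := fun i => ((stdOrthonormalBasis ℝ (normal M x) i : normal M x) : Space n)
    have hN : Module.finrank ℝ (normal M x) + m = n := by rw [finrank_normal hT]; omega
    have h1 : pairProd ν * (List.ofFn fun j => dx (v j) * dxi (v j)).prod =
        (List.ofFn fun i => dx (Fin.append ν v i) * dxi (Fin.append ν v i)).prod := by
      have : (fun i => dx (Fin.append ν v i) * dxi (Fin.append ν v i)) =
          Fin.append (fun i => dx (ν i) * dxi (ν i)) (fun j => dx (v j) * dxi (v j)) := by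
        funext i
        refine Fin.addCases (fun i => ?_) (fun i => ?_) i <;> simp
      rw [this, List.ofFn_fin_append, List.prod_append]
      rfl
    simp only [J_dx]
    rw [current_density hT, h1, berezin_prod hN]
    exact mul_self_nonneg _

/-- The definition of $m$-subharmonicity is tested on the density of $[M]_s$ at `x`; only the factor
$1/(m-1)!$ and the order of the product differ. -/
theorem hessTrace_nonneg_of_mSubharmonic {m : ℕ} (hm : 1 ≤ m) (hmn : m ≤ n) {M : Set (Space n)}
    {x : Space n} (hT : Module.finrank ℝ (tangent M x) = m) {f : Space n → ℝ}
    (hf : ContDiff ℝ 2 f) (hs : IsMSubharmonic m f) : 0 ≤ hessTrace (tangent M x) f x := by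
  have h := hs _ (current_weaklyPositive hmn hT) x
  rw [← berezin_dd_currentS hm hT hf]
  have h1 : d (dsharp (ofFun f)) x * (currentS m M).density x =
      (((m - 1)! : ℝ)⁻¹) •
        (d (dsharp (ofFun f)) x * beta n ^ (m - 1) * (current m M).density x) := by
    change d (dsharp (ofFun f)) x * ((current m M).density x * betaPow n (m - 1)) = _
    rw [betaPow, mul_smul_comm, mul_smul_comm, current_density hT,
      (pairProd_commute _ (beta n ^ (m - 1))).eq, mul_assoc]
  rw [h1, map_smul]
  exact mul_nonneg (by positivity) h

theorem hess_symm {f : Space n → ℝ} (hf : ContDiff ℝ 2 f) (x v w : Space n) :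
    hess f x v w = hess f x w v :=
  (hf.contDiffAt.isSymmSndFDerivAt (by simp)).eq v w

/-- On a line the derivative of a convex function is monotone, and the Hessian in the direction of
the line is its derivative. -/
theorem hess_nonneg_of_convexOn {f : Space n → ℝ} (hf : ContDiff ℝ 2 f)
    (hc : ConvexOn ℝ univ f) (x v : Space n) : 0 ≤ hess f x v v := by
  have hf1 : Differentiable ℝ f := hf.differentiable (by norm_num)
  have hf2 : Differentiable ℝ (fderiv ℝ f) :=
    (hf.fderiv_right (m := 1) (by norm_num)).differentiable (by norm_num)
  have hline : ∀ s : ℝ, HasDerivAt (fun s : ℝ => x + s • v) v s := fun s => by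
    simpa using ((hasDerivAt_id s).smul_const v).const_add x
  have h1 : ∀ s : ℝ, HasDerivAt (fun s : ℝ => f (x + s • v)) (fderiv ℝ f (x + s • v) v) s :=
    fun s => (hf1 _).hasFDerivAt.comp_hasDerivAt s (hline s)
  have h2 : HasDerivAt (fun s : ℝ => fderiv ℝ f (x + s • v) v) (hess f x v v) 0 := by
    have h3 : HasFDerivAt (fun y => fderiv ℝ f y v) ((fderiv ℝ (fderiv ℝ f) x).flip v)
        (x + (0 : ℝ) • v) := by
      have := (hf2 x).hasFDerivAt.clm_apply (hasFDerivAt_const v x)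
      simpa using this
    exact h3.comp_hasDerivAt (0 : ℝ) (hline 0)
  have h3 : ConvexOn ℝ univ fun s : ℝ => f (x + s • v) := by
    refine ⟨convex_univ, fun s _ t _ a b ha hb hab => ?_⟩
    have := hc.2 (mem_univ (x + s • v)) (mem_univ (x + t • v)) ha hb hab
    convert this using 2
    rw [smul_add, smul_add, smul_smul, smul_smul, add_add_add_comm, ← add_smul, hab, one_smul,
      ← add_smul, smul_eq_mul, smul_eq_mul]
  have h4 : Monotone fun s : ℝ => fderiv ℝ f (x + s • v) v := by
    have := h3.monotoneOn_deriv (fun s _ => (h1 s).differentiableAt)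
    rw [monotoneOn_univ, funext fun s => (h1 s).deriv] at this
    exact this
  rw [← h2.deriv]
  exact h4.deriv_nonneg

/-- The basis consists of eigenvectors of the self-adjoint operator `L` that represents the Hessian.
-/
theorem bilinForm_eq_sum_diag {f : Space n → ℝ} (hf : ContDiff ℝ 2 f) (x : Space n) :
    ∃ b : OrthonormalBasis (Fin n) ℝ (Space n),
      bilinForm (hess f x) = ∑ i, hess f x (b i) (b i) • (dx (b i) * dxi (b i)) := by
  let L : Space n →ₗ[ℝ] Space n :=
    (InnerProductSpace.toDual ℝ (Space n)).symm.toLinearEquiv.toLinearMap.comp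
      (fderiv ℝ (fderiv ℝ f) x).toLinearMap
  have hL : ∀ v w, inner ℝ (L v) w = hess f x v w := fun v w => by
    simp [L]
  have hs : L.IsSymmetric := fun v w => by
    rw [hL, ← real_inner_comm, hL, hess_symm hf]
  have hn : Module.finrank ℝ (Space n) = n := by simp
  refine ⟨hs.eigenvectorBasis hn, ?_⟩
  rw [bilinForm_eq_sum _ (hs.eigenvectorBasis hn)]
  refine Finset.sum_congr rfl fun i _ => ?_
  rw [Finset.sum_eq_single i]
  · intro j _ hj
    rw [← hL, hs.apply_eigenvectorBasis, real_inner_smul_left,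
      (hs.eigenvectorBasis hn).orthonormal.2 hj.symm, mul_zero, zero_smul]
  · simp

/-- $\beta$ has the same shape in the Hessian eigenbasis. Each term of the expansion is then a
non-negative Hessian value times $\alpha$ paired with $m$ factors $b\wedge b^{\#}$, non-negative by
weak positivity. -/
theorem isMSubharmonic_of_convexOn {m : ℕ} (hm : 1 ≤ m) {f : Space n → ℝ} (hf : ContDiff ℝ 2 f)
    (hc : ConvexOn ℝ univ f) : IsMSubharmonic m f := by
  obtain ⟨k, rfl⟩ : ∃ k, m = k + 1 := ⟨m - 1, by omega⟩
  intro α hα x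
  obtain ⟨b, hb⟩ := bilinForm_eq_sum_diag hf x
  rw [d_dsharp_ofFun hf, hb, beta_eq_sum b, sum_pow_eq_sum_prod, Finset.sum_mul, Finset.sum_mul,
    map_sum]
  refine Finset.sum_nonneg fun i _ => ?_
  rw [Finset.mul_sum, Finset.sum_mul, map_sum]
  refine Finset.sum_nonneg fun g _ => ?_
  rw [smul_mul_assoc, smul_mul_assoc, map_smul]
  refine mul_nonneg (hess_nonneg_of_convexOn hf hc x _) ?_
  have h := hα.2 (Fin.cons (b i) fun j => b (g j))
  simp only [J_dx] at h
  rw [← (prod_ofFn_commute _ _ _).eq, List.ofFn_succ, List.prod_cons] at h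
  simpa using h

end GeometricDensities

/-! ### The Jacobian of an injective linear map -/

section Jacobian

variable {m n : ℕ}

/-- The Gram matrix of the images of the standard basis. -/
def gram (A : Space m →L[ℝ] Space n) : Matrix (Fin m) (Fin m) ℝ :=
  Matrix.of fun i j => inner ℝ (A (e i)) (A (e j))

/-- The `m`-dimensional Jacobian `√det(Aᵀ A)`. -/
def jac (A : Space m →L[ℝ] Space n) : ℝ := √(gram A).det

/-- An orthonormal basis of the range identifies it isometrically with $\mathbb R^m$. The
factorization reduces statements on Jacobians to determinants of square matrices. -/
theorem exists_isometry_comp (A : Space m →L[ℝ] Space n) (hA : Function.Injective A) :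
    ∃ (ι : Space m →ₗᵢ[ℝ] Space n) (L : Space m ≃L[ℝ] Space m),
      A = ι.toContinuousLinearMap.comp (L : Space m →L[ℝ] Space m) := by
  set W := LinearMap.range (A : Space m →ₗ[ℝ] Space n)
  let E := LinearEquiv.ofInjective (A : Space m →ₗ[ℝ] Space n) hA
  have hW : Module.finrank ℝ W = m := by
    rw [← E.finrank_eq]; simp
  let b := (stdOrthonormalBasis ℝ W).reindex (finCongr hW)
  refine ⟨W.subtypeₗᵢ.comp b.repr.symm.toLinearIsometry,
    (E.trans b.repr.toLinearEquiv).toContinuousLinearEquiv, ?_⟩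
  ext1 v
  simp [E]

theorem sum_smul_e (v : Space m) : ∑ k, v k • e k = v := by
  ext j
  simp [e, Finset.sum_apply, Pi.single_apply]

/-- The Gram matrix is a quadratic form in the columns: precomposing with matrix $S$ replaces $G$ by
$S^{T}GS$. -/
theorem gram_comp (X : Space m →L[ℝ] Space n) (L : Space m →L[ℝ] Space m) :
    (gram (X.comp L)).det = LinearMap.det (L : Space m →ₗ[ℝ] Space m) ^ 2 * (gram X).det := by
  set b := EuclideanSpace.basisFun (Fin m) ℝ
  set S := LinearMap.toMatrix b.toBasis b.toBasis (L : Space m →ₗ[ℝ] Space m)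
  have h1 : gram (X.comp L) = S.transpose * gram X * S := by
    ext i j
    have hS : ∀ i, X (L (e i)) = ∑ k, S k i • X (e k) := fun i => by
      conv_lhs => rw [← sum_smul_e (L (e i)), map_sum]
      refine Finset.sum_congr rfl fun k _ => ?_
      simp [S, LinearMap.toMatrix_apply, b, e]
    simp only [gram, Matrix.of_apply, ContinuousLinearMap.comp_apply, hS, Matrix.mul_apply,
      Matrix.transpose_apply, sum_inner, inner_sum, real_inner_smul_left, real_inner_smul_right,
      Finset.sum_mul]
    refine Finset.sum_congr rfl fun k _ => Finset.sum_congr rfl fun l _ => ?_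
    rw [real_inner_comm (X (e k))]
    ring
  rw [h1, Matrix.det_mul, Matrix.det_mul, Matrix.det_transpose, LinearMap.det_toMatrix]
  ring

theorem gram_isometry (ι : Space m →ₗᵢ[ℝ] Space n) : gram ι.toContinuousLinearMap = 1 := by
  ext i j
  simp [gram, e, Matrix.one_apply, EuclideanSpace.inner_single_left]

theorem gram_isometry_comp (ι : Space m →ₗᵢ[ℝ] Space n) (L : Space m →L[ℝ] Space m) :
    (gram (ι.toContinuousLinearMap.comp L)).det =
      LinearMap.det (L : Space m →ₗ[ℝ] Space m) ^ 2 := by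
  rw [gram_comp, gram_isometry, Matrix.det_one, mul_one]

theorem jac_isometry_comp (ι : Space m →ₗᵢ[ℝ] Space n) (L : Space m →L[ℝ] Space m) :
    jac (ι.toContinuousLinearMap.comp L) = |LinearMap.det (L : Space m →ₗ[ℝ] Space m)| := by
  rw [jac, gram_isometry_comp, Real.sqrt_sq_eq_abs]

theorem jac_nonneg (A : Space m →L[ℝ] Space n) : 0 ≤ jac A := Real.sqrt_nonneg _

theorem gram_det_pos {A : Space m →L[ℝ] Space n} (hA : Function.Injective A) :
    0 < (gram A).det := by
  obtain ⟨ι, L, rfl⟩ := exists_isometry_comp A hA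
  rw [gram_isometry_comp]
  have : LinearMap.det ((L : Space m →L[ℝ] Space m) : Space m →ₗ[ℝ] Space m) ≠ 0 :=
    (LinearEquiv.isUnit_det' L.toLinearEquiv).ne_zero
  positivity

theorem jac_pos {A : Space m →L[ℝ] Space n} (hA : Function.Injective A) : 0 < jac A :=
  Real.sqrt_pos.2 (gram_det_pos hA)

open scoped MeasureTheory in
-- The isometric factor preserves the measure, and the square factor scales Lebesgue measure by
-- $|\det|$.
theorem euclideanHausdorffMeasure_image_linear {A : Space m →L[ℝ] Space n}
    (hA : Function.Injective A) (s : Set (Space m)) :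
    μHE[m] (A '' s) = ENNReal.ofReal (jac A) * volume s := by
  obtain ⟨ι, L, rfl⟩ := exists_isometry_comp A hA
  rw [jac_isometry_comp, ContinuousLinearMap.coe_comp, image_comp]
  erw [ι.isometry.euclideanHausdorffMeasure_image]
  rw [EuclideanSpace.euclideanHausdorffMeasure_eq_volume]
  exact Measure.addHaar_image_linearMap volume (L : Space m →ₗ[ℝ] Space m) s

theorem contDiff_gram_det : ContDiff ℝ ∞ fun A : Space m →L[ℝ] Space n => (gram A).det := by
  simp only [Matrix.det_apply, gram, Matrix.of_apply]
  refine ContDiff.sum fun σ _ => ContDiff.const_smul _ (contDiff_prod fun i _ => ?_)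
  exact (ContinuousLinearMap.apply ℝ (Space n) (e (σ i))).contDiff.inner ℝ
    (ContinuousLinearMap.apply ℝ (Space n) (e i)).contDiff

theorem contDiffAt_jac {A : Space m →L[ℝ] Space n} (hA : Function.Injective A) :
    ContDiffAt ℝ ∞ jac A :=
  contDiff_gram_det.contDiffAt.sqrt (gram_det_pos hA).ne'

theorem continuous_jac : Continuous (jac : (Space m →L[ℝ] Space n) → ℝ) :=
  contDiff_gram_det.continuous.sqrt

/-- The derivative of the determinant at the identity is the trace. -/
theorem hasDerivAt_det_of_eq_one {M : ℝ → Matrix (Fin m) (Fin m) ℝ} {M' : Matrix (Fin m) (Fin m) ℝ}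
    (hM : ∀ i j, HasDerivAt (fun s => M s i j) (M' i j) 0) (h0 : M 0 = 1) :
    HasDerivAt (fun s => (M s).det) M'.trace 0 := by
  let D : (Fin m → Fin m → ℝ) → ℝ := fun M => (Matrix.of M).det
  have hD : ContDiff ℝ 1 D := by
    simp only [D, Matrix.det_apply, Matrix.of_apply]
    fun_prop
  let c : ℝ → Fin m → Fin m → ℝ := fun s i j => M s i j
  have hc : HasDerivAt c (fun i j => M' i j) 0 :=
    hasDerivAt_pi.2 fun i => hasDerivAt_pi.2 fun j => hM i j
  -- Only the first-order part of the curve matters, so it is replaced by the line $1+sM'$, along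
  -- which the determinant is a polynomial with linear coefficient the trace.
  let c1 : ℝ → Fin m → Fin m → ℝ := fun s i j => (1 : Matrix (Fin m) (Fin m) ℝ) i j + s * M' i j
  have hc1 : HasDerivAt c1 (fun i j => M' i j) 0 := by
    refine hasDerivAt_pi.2 fun i => hasDerivAt_pi.2 fun j => ?_
    simpa [c1] using ((hasDerivAt_id (0 : ℝ)).mul_const (M' i j)).const_add
      ((1 : Matrix (Fin m) (Fin m) ℝ) i j)
  have hcc : c 0 = c1 0 := by
    funext i j; simp [c, c1, h0]
  have hDd : HasFDerivAt D (fderiv ℝ D (c 0)) (c 0) :=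
    (hD.differentiable (by norm_num) _).hasFDerivAt
  have e1 : HasDerivAt (fun s => D (c s)) (fderiv ℝ D (c 0) fun i j => M' i j) 0 :=
    hDd.comp_hasDerivAt 0 hc
  have e2 : HasDerivAt (fun s => D (c1 s)) (fderiv ℝ D (c 0) fun i j => M' i j) 0 := by
    rw [hcc] at hDd ⊢
    exact hDd.comp_hasDerivAt 0 hc1
  have e3 : HasDerivAt (fun s => D (c1 s)) M'.trace 0 := by
    set P := (Matrix.det (1 + (Polynomial.X : Polynomial ℝ) • M'.map Polynomial.C)).divX.divX
    have h1 : (fun s => D (c1 s)) = fun s => 1 + M'.trace * s + P.eval s * s ^ 2 := by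
      funext s
      rw [← Matrix.det_one_add_smul]
      rfl
    rw [h1]
    have h2 := (((hasDerivAt_id' (0 : ℝ)).const_mul M'.trace).const_add 1).fun_add
      ((P.hasDerivAt 0).fun_mul ((hasDerivAt_id' (0 : ℝ)).fun_pow 2))
    exact h2.congr_deriv (by simp)
  rw [e2.unique e3] at e1
  exact e1

/-- A linear left inverse of `A` that vanishes on the orthogonal complement of the range. -/
def IsPseudoInverse (A : Space m →L[ℝ] Space n) (P : Space n →L[ℝ] Space m) : Prop :=
  (∀ v, P (A v) = v) ∧ ∀ y, (∀ v, inner ℝ (A v) y = 0) → P y = 0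

/-- The trace of an endomorphism of `ℝᵐ`. -/
def tr (L : Space m →L[ℝ] Space m) : ℝ := LinearMap.trace ℝ _ (L : Space m →ₗ[ℝ] Space m)

theorem tr_eq_sum (L : Space m →L[ℝ] Space m) : tr L = ∑ i, L (e i) i := by
  rw [tr, LinearMap.trace_eq_matrix_trace ℝ (EuclideanSpace.basisFun (Fin m) ℝ).toBasis,
    Matrix.trace]
  refine Finset.sum_congr rfl fun i _ => ?_
  simp [LinearMap.toMatrix_apply, e]

/-- With $A=\iota L$ one takes $P=L^{-1}\iota^{*}$. -/
theorem exists_isPseudoInverse (A : Space m →L[ℝ] Space n) (hA : Function.Injective A) :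
    ∃ P, IsPseudoInverse A P := by
  obtain ⟨ι, L, rfl⟩ := exists_isometry_comp A hA
  refine ⟨(L.symm : Space m →L[ℝ] Space m).comp
    (ContinuousLinearMap.adjoint ι.toContinuousLinearMap), fun v => ?_, fun y hy => ?_⟩
  · have h : ∀ w, ContinuousLinearMap.adjoint ι.toContinuousLinearMap (ι w) = w := fun w =>
      ext_inner_right ℝ fun z => by
        rw [ContinuousLinearMap.adjoint_inner_left]; exact ι.inner_map_map _ _
    simp [h]
  · have h : ContinuousLinearMap.adjoint ι.toContinuousLinearMap y = 0 := by
      refine ext_inner_left ℝ fun z => ?_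
      rw [ContinuousLinearMap.adjoint_inner_right, inner_zero_right]
      simpa using hy (L.symm z)
    simp [h]

/-- $AP$ is the orthogonal projection onto the range of $A$. -/
theorem IsPseudoInverse.inner_eq {A : Space m →L[ℝ] Space n} {P : Space n →L[ℝ] Space m}
    (hP : IsPseudoInverse A P) (v : Space m) (y : Space n) :
    inner ℝ (A v) (A (P y)) = inner ℝ (A v) y := by
  set W := LinearMap.range (A : Space m →ₗ[ℝ] Space n)
  obtain ⟨w, hw⟩ := (W.starProjection_apply_mem y : W.starProjection y ∈ W)
  have hw' : A w = W.starProjection y := hw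
  have h1 : ∀ v, inner ℝ (A v) (y - W.starProjection y) = 0 := fun v =>
    Submodule.inner_right_of_mem_orthogonal (K := W) (LinearMap.mem_range_self _ v)
      (W.sub_starProjection_mem_orthogonal y)
  have h2 := hP.2 _ h1
  rw [map_sub, ← hw', hP.1, sub_eq_zero] at h2
  have h3 := h1 v
  rw [inner_sub_right, ← hw'] at h3
  rw [h2]
  linarith

theorem add_zero_smul (A B : Space m →L[ℝ] Space n) : A + (0 : ℝ) • B = A := by
  ext1 v
  simp

/-- Factoring $L$ out of $A=\iota L$ makes the Gram matrix start at the identity, where the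
determinant has derivative the trace. The symmetric derivative of the Gram matrix gives twice the
trace of $PB$, conjugated by $L$; the square root removes the $2$. -/
theorem hasDerivAt_jac_line {A : Space m →L[ℝ] Space n} {P : Space n →L[ℝ] Space m}
    (hA : Function.Injective A) (hP : IsPseudoInverse A P) (B : Space m →L[ℝ] Space n) :
    HasDerivAt (fun s : ℝ => jac (A + s • B)) (jac A * tr (P.comp B)) 0 := by
  obtain ⟨ι, L, hL⟩ := exists_isometry_comp A hA
  set ιc := ι.toContinuousLinearMap
  set L' : Space m →L[ℝ] Space m := (L : Space m →L[ℝ] Space m)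
  set K : Space m →L[ℝ] Space m := (L.symm : Space m →L[ℝ] Space m)
  have hAK : ∀ v, A (K v) = ιc v := fun v => by rw [hL]; simp [L', K]
  set C : Space m →L[ℝ] Space n := B.comp K
  set δ := LinearMap.det (L' : Space m →ₗ[ℝ] Space m)
  have hι : ∀ v w, inner ℝ (ιc v) (ιc w) = inner ℝ v w := ι.inner_map_map
  have h1 : ∀ s : ℝ, (gram (A + s • B)).det = δ ^ 2 * (gram (ιc + s • C)).det := by
    intro s
    rw [← gram_comp]
    congr 2
    ext1 v
    simp [hL, C, L', K]
  have htr : Matrix.trace (Matrix.of fun i j => inner ℝ (ιc (e i)) (C (e j)) +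
      inner ℝ (C (e i)) (ιc (e j))) = 2 * tr (P.comp B) := by
    have h3 : ∀ i, inner ℝ (ιc (e i)) (C (e i)) = (L'.comp ((P.comp B).comp K)) (e i) i := by
      intro i
      rw [← hAK, ← hP.inner_eq, hL, ContinuousLinearMap.comp_apply, ContinuousLinearMap.comp_apply,
        hι]
      simp [L', K, C, e, EuclideanSpace.inner_single_left]
    have h4 : tr (L'.comp ((P.comp B).comp K)) = tr (P.comp B) :=
      LinearMap.trace_conj' ((P.comp B : Space m →L[ℝ] Space m) : Space m →ₗ[ℝ] Space m)
        L.toLinearEquiv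
    rw [Matrix.trace, ← h4, tr_eq_sum, Finset.mul_sum]
    refine Finset.sum_congr rfl fun i _ => ?_
    rw [Matrix.diag_apply, Matrix.of_apply, real_inner_comm (ιc (e i)) (C (e i)), h3]
    ring
  have h2 : HasDerivAt (fun s : ℝ => (gram (ιc + s • C)).det)
      (Matrix.trace (Matrix.of fun i j => inner ℝ (ιc (e i)) (C (e j)) +
        inner ℝ (C (e i)) (ιc (e j)))) 0 := by
    refine hasDerivAt_det_of_eq_one (fun i j => ?_) ?_
    · have hl : ∀ v, HasDerivAt (fun s : ℝ => (ιc + s • C) v) (C v) 0 := fun v => by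
        simpa using ((hasDerivAt_id (0 : ℝ)).smul_const (C v)).const_add (ιc v)
      have := (hl (e i)).inner ℝ (hl (e j))
      simpa [gram] using this
    · rw [add_zero_smul, gram_isometry]
  have hδ : δ ^ 2 ≠ 0 := pow_ne_zero 2 (LinearEquiv.isUnit_det' L.toLinearEquiv).ne_zero
  have h0 : (gram (ιc + (0 : ℝ) • C)).det = 1 := by
    rw [add_zero_smul, gram_isometry, Matrix.det_one]
  have hj : jac A = |δ| := by rw [hL, jac_isometry_comp]
  have h5 := (h2.const_mul (δ ^ 2)).sqrt (by rw [h0, mul_one]; exact hδ)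
  rw [h0, mul_one, Real.sqrt_sq_eq_abs, htr] at h5
  have h6 : (fun s : ℝ => jac (A + s • B)) = fun s => √(δ ^ 2 * (gram (ιc + s • C)).det) := by
    funext s
    rw [jac, h1]
  rw [h6, hj]
  convert h5 using 1
  have : |δ| ≠ 0 := abs_ne_zero.2 fun h => hδ (by rw [h]; simp)
  field_simp
  rw [sq_abs]
  ring

theorem hasFDerivAt_jac {A : Space m →L[ℝ] Space n} (hA : Function.Injective A) :
    HasFDerivAt jac (fderiv ℝ jac A) A :=
  ((contDiffAt_jac hA).differentiableAt (by simp)).hasFDerivAt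

theorem fderiv_jac {A : Space m →L[ℝ] Space n} {P : Space n →L[ℝ] Space m}
    (hA : Function.Injective A) (hP : IsPseudoInverse A P) (B : Space m →L[ℝ] Space n) :
    fderiv ℝ jac A B = jac A * tr (P.comp B) := by
  have h1 : HasDerivAt (fun s : ℝ => A + s • B) B 0 := by
    simpa using ((hasDerivAt_id (0 : ℝ)).smul_const B).const_add A
  have h3 : HasDerivAt (fun s : ℝ => jac (A + s • B)) (fderiv ℝ jac A B) 0 :=
    (hasFDerivAt_jac hA).comp_hasDerivAt_of_eq (0 : ℝ) h1 (add_zero_smul A B).symm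
  exact h3.unique (hasDerivAt_jac_line hA hP B)

/-- The trace over a subspace of an endomorphism of `ℝⁿ`. -/
def tangentTrace (W : Submodule ℝ (Space n)) (D : Space n →L[ℝ] Space n) : ℝ :=
  ∑ i, inner ℝ (D ((stdOrthonormalBasis ℝ W i : W) : Space n))
    ((stdOrthonormalBasis ℝ W i : W) : Space n)

/-- Conjugating by the isomorphism of $\mathbb R^m$ with the range keeps the trace and turns $PDA$
into $D$ followed by the projection to the range. The result no longer depends on the
parametrization. -/
theorem tr_comp_eq_tangentTrace {A : Space m →L[ℝ] Space n} {P : Space n →L[ℝ] Space m}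
    (hA : Function.Injective A) (hP : IsPseudoInverse A P) (D : Space n →L[ℝ] Space n) :
    tr (P.comp (D.comp A)) = tangentTrace (LinearMap.range (A : Space m →ₗ[ℝ] Space n)) D := by
  set W := LinearMap.range (A : Space m →ₗ[ℝ] Space n)
  let E := LinearEquiv.ofInjective (A : Space m →ₗ[ℝ] Space n) hA
  set b := stdOrthonormalBasis ℝ W
  have h1 : tr (P.comp (D.comp A)) = LinearMap.trace ℝ W
      (E.conj (P.comp (D.comp A) : Space m →ₗ[ℝ] Space m)) := (LinearMap.trace_conj' _ E).symm
  rw [h1, LinearMap.trace_eq_matrix_trace ℝ b.toBasis, Matrix.trace, tangentTrace]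
  refine Finset.sum_congr rfl fun i _ => ?_
  have h2 : A (E.symm (b i)) = b i := congrArg Subtype.val (E.apply_symm_apply (b i))
  rw [Matrix.diag_apply, LinearMap.toMatrix_apply, OrthonormalBasis.coe_toBasis_repr_apply,
    OrthonormalBasis.repr_apply_apply, OrthonormalBasis.coe_toBasis, Submodule.coe_inner]
  change inner ℝ ((b i : W) : Space n) (A (P (D (A (E.symm (b i)))))) = _
  rw [← h2, hP.inner_eq, real_inner_comm, h2]

end Jacobian

/-! ### The area formula for injective immersions -/

section AreaFormula

open Filter Topology
open scoped MeasureTheory NNReal ENNReal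

/-- The bound makes `f` constant on the fibres of `g` in `s`, so $f\circ g^{-1}$ is a well-defined
$C$-Lipschitz map on $g(s)$. -/
theorem euclideanHausdorffMeasure_image_le {X Y Z : Type*} [MetricSpace Y] [MeasurableSpace Y]
    [BorelSpace Y] [MetricSpace Z] [MeasurableSpace Z] [BorelSpace Z] {f : X → Y} {g : X → Z}
    {s : Set X} {C : ℝ≥0}
    (h : ∀ a ∈ s, ∀ b ∈ s, dist (f a) (f b) ≤ C * dist (g a) (g b)) (k : ℕ) :
    μHE[k] (f '' s) ≤ (C : ℝ≥0∞) ^ k * μHE[k] (g '' s) := by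
  rcases s.eq_empty_or_nonempty with rfl | ⟨x₀, -⟩
  · simp
  have : Nonempty X := ⟨x₀⟩
  set G := f ∘ Function.invFunOn g s
  have hinv : ∀ z ∈ g '' s, Function.invFunOn g s z ∈ s ∧ g (Function.invFunOn g s z) = z :=
    fun z hz => ⟨Function.invFunOn_mem hz, Function.invFunOn_eq hz⟩
  have hG : LipschitzOnWith C G (g '' s) := LipschitzOnWith.of_dist_le_mul fun y hy z hz => by
    have := h _ (hinv y hy).1 _ (hinv z hz).1
    rwa [(hinv y hy).2, (hinv z hz).2] at this
  have himg : f '' s ⊆ G '' (g '' s) := by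
    rintro _ ⟨a, ha, rfl⟩
    refine ⟨g a, ⟨a, ha, rfl⟩, ?_⟩
    have h1 := hinv (g a) ⟨a, ha, rfl⟩
    have h2 := h _ h1.1 a ha
    rw [h1.2, dist_self, mul_zero] at h2
    exact dist_le_zero.1 h2
  have h1 := hG.hausdorffMeasure_image_le (d := k) (by positivity)
  rw [ENNReal.rpow_natCast] at h1
  rw [Measure.euclideanHausdorffMeasure_def, Measure.euclideanHausdorffMeasure_def,
    Measure.smul_apply, Measure.smul_apply, ENNReal.smul_def, ENNReal.smul_def, smul_eq_mul,
    smul_eq_mul, mul_left_comm]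
  gcongr
  exact (measure_mono himg).trans h1

variable {m n : ℕ} {ψ : Space m → Space n}

theorem exists_nhds_dist_le {u : Space m} (hψ : ContDiffAt ℝ 1 ψ u)
    (hinj : Function.Injective (fderiv ℝ ψ u)) {t : ℝ≥0} (ht : 1 < t) :
    ∀ᶠ p in 𝓝 (u, u), dist (ψ p.1) (ψ p.2) ≤ t * dist (fderiv ℝ ψ u p.1) (fderiv ℝ ψ u p.2) ∧
      dist (fderiv ℝ ψ u p.1) (fderiv ℝ ψ u p.2) ≤ t * dist (ψ p.1) (ψ p.2) := by
  set A := fderiv ℝ ψ u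
  obtain ⟨K, hK, hA⟩ := LinearMap.exists_antilipschitzWith (A : Space m →ₗ[ℝ] Space n)
    (LinearMap.ker_eq_bot.2 hinj)
  have hK' : (0 : ℝ) < K := hK
  have ht' : (1 : ℝ) < t := ht
  have hstrict : HasStrictFDerivAt ψ A u := hψ.hasStrictFDerivAt (by norm_num)
  -- With $|w|\le K|Aw|$, this constant bounds the linearization error by $(1-1/t)|Aw|$. The lower
  -- estimate is then exactly $|Aw|/t$, and the upper one uses $2-1/t\le t$.
  set c : ℝ := (1 - (t : ℝ)⁻¹) / K
  have hc0 : 0 < c := div_pos (sub_pos.2 (inv_lt_one_of_one_lt₀ ht')) hK'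
  filter_upwards [hstrict.isLittleO.def hc0] with p hp
  set w := p.1 - p.2
  have h1 : ‖w‖ ≤ K * ‖A w‖ := by
    have := hA.le_mul_dist p.1 p.2
    rw [dist_eq_norm, dist_eq_norm] at this
    simpa only [ContinuousLinearMap.coe_coe, ← map_sub] using this
  have h2 : ‖ψ p.1 - ψ p.2 - A w‖ ≤ (1 - (t : ℝ)⁻¹) * ‖A w‖ := by
    refine hp.trans ?_
    calc c * ‖w‖ ≤ c * (K * ‖A w‖) := by gcongr
      _ = _ := by simp only [c]; field_simp
  have h3 : ‖ψ p.1 - ψ p.2‖ ≤ ‖A w‖ + ‖ψ p.1 - ψ p.2 - A w‖ := by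
    have := norm_add_le (A w) (ψ p.1 - ψ p.2 - A w)
    rwa [add_sub_cancel] at this
  have h4 : ‖A w‖ ≤ ‖ψ p.1 - ψ p.2‖ + ‖ψ p.1 - ψ p.2 - A w‖ := by
    have := norm_sub_le (ψ p.1 - ψ p.2) (ψ p.1 - ψ p.2 - A w)
    rwa [sub_sub_cancel] at this
  have ht0 : (0 : ℝ) < t := by positivity
  have h5 : 2 - (t : ℝ)⁻¹ ≤ t := by
    have : 0 ≤ ((t : ℝ) - 1) ^ 2 / t := by positivity
    have h6 : ((t : ℝ) - 1) ^ 2 / t = t - 2 + (t : ℝ)⁻¹ := by field_simp; ring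
    linarith
  rw [dist_eq_norm, dist_eq_norm, ← map_sub]
  constructor
  · calc ‖ψ p.1 - ψ p.2‖ ≤ (2 - (t : ℝ)⁻¹) * ‖A w‖ := by linarith
      _ ≤ t * ‖A w‖ := by gcongr
  · have h6 : (t : ℝ)⁻¹ * ‖A w‖ ≤ ‖ψ p.1 - ψ p.2‖ := by linarith
    rwa [inv_mul_le_iff₀ ht0] at h6

/-- The density of the area formula. -/
def areaDensity (ψ : Space m → Space n) (x : Space m) : ℝ≥0∞ := ENNReal.ofReal (jac (fderiv ℝ ψ x))

/-- Near `u` the map is compared with its differential, whose images have known measure. Of the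
exponent $m+1$, the part $m$ comes from the Lipschitz comparison and the extra factor from the
continuity of the Jacobian. -/
theorem exists_nhds_area {u : Space m} (hψ : ContDiffAt ℝ 1 ψ u)
    (hinj : Function.Injective (fderiv ℝ ψ u)) {t : ℝ≥0} (ht : 1 < t) :
    ∃ V, IsOpen V ∧ u ∈ V ∧ ∀ s ⊆ V, MeasurableSet s →
      μHE[m] (ψ '' s) ≤ (t : ℝ≥0∞) ^ (m + 1) * ∫⁻ x in s, areaDensity ψ x ∧
      ∫⁻ x in s, areaDensity ψ x ≤ (t : ℝ≥0∞) ^ (m + 1) * μHE[m] (ψ '' s) := by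
  have h1 := exists_nhds_dist_le hψ hinj ht
  rw [nhds_prod_eq] at h1
  obtain ⟨V₁, hV₁, hd'⟩ := mem_prod_self_iff.1 h1
  have hd : ∀ a ∈ V₁, ∀ b ∈ V₁, _ := fun a ha b hb => hd' (mk_mem_prod ha hb)
  have ht' : (1 : ℝ) < t := ht
  have hpos := jac_pos hinj
  have hcont : ContinuousAt (fun x => jac (fderiv ℝ ψ x)) u :=
    continuous_jac.continuousAt.comp
      (hψ.fderiv_right (m := 0) (by norm_num)).continuousAt
  have h2 : ∀ᶠ x in 𝓝 u, jac (fderiv ℝ ψ x) < t * jac (fderiv ℝ ψ u) :=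
    hcont.eventually_lt_const (by nlinarith)
  have h3 : ∀ᶠ x in 𝓝 u, jac (fderiv ℝ ψ u) < t * jac (fderiv ℝ ψ x) :=
    (hcont.const_mul (t : ℝ)).eventually_const_lt (by nlinarith)
  obtain ⟨V, hV, hVo, huV⟩ := mem_nhds_iff.1 (inter_mem hV₁ (h2.and h3))
  refine ⟨V, hVo, huV, fun s hs hsm => ?_⟩
  set A := fderiv ℝ ψ u
  have hA : μHE[m] (A '' s) = ∫⁻ _ in s, areaDensity ψ u := by
    rw [euclideanHausdorffMeasure_image_linear hinj, setLIntegral_const]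
    rfl
  have i1 : ∫⁻ _ in s, areaDensity ψ u ≤ t * ∫⁻ x in s, areaDensity ψ x := by
    rw [← lintegral_const_mul' _ _ ENNReal.coe_ne_top]
    refine setLIntegral_mono' hsm fun x hx => ?_
    rw [areaDensity, areaDensity, ← ENNReal.ofReal_coe_nnreal, ← ENNReal.ofReal_mul t.coe_nonneg]
    exact ENNReal.ofReal_le_ofReal (hV (hs hx)).2.2.le
  have i2 : ∫⁻ x in s, areaDensity ψ x ≤ t * ∫⁻ _ in s, areaDensity ψ u := by
    rw [← lintegral_const_mul' _ _ ENNReal.coe_ne_top]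
    refine setLIntegral_mono' hsm fun x hx => ?_
    rw [areaDensity, areaDensity, ← ENNReal.ofReal_coe_nnreal, ← ENNReal.ofReal_mul t.coe_nonneg]
    exact ENNReal.ofReal_le_ofReal (hV (hs hx)).2.1.le
  have i3 : μHE[m] (ψ '' s) ≤ (t : ℝ≥0∞) ^ m * μHE[m] (A '' s) :=
    euclideanHausdorffMeasure_image_le
      (fun a ha b hb => (hd a (hV (hs ha)).1 b (hV (hs hb)).1).1) m
  have i4 : μHE[m] (A '' s) ≤ (t : ℝ≥0∞) ^ m * μHE[m] (ψ '' s) :=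
    euclideanHausdorffMeasure_image_le
      (fun a ha b hb => (hd a (hV (hs ha)).1 b (hV (hs hb)).1).2) m
  constructor
  · calc μHE[m] (ψ '' s) ≤ (t : ℝ≥0∞) ^ m * (t * ∫⁻ x in s, areaDensity ψ x) := by
          refine i3.trans ?_
          rw [hA]
          gcongr
      _ = _ := by rw [pow_succ, mul_assoc]
  · calc ∫⁻ x in s, areaDensity ψ x ≤ t * ((t : ℝ≥0∞) ^ m * μHE[m] (ψ '' s)) := by
          refine i2.trans ?_
          rw [← hA]
          gcongr
      _ = _ := by rw [pow_succ', mul_assoc]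

variable {Ω : Set (Space m)}

/-- An injective immersion of class `C¹` on an open set. -/
structure IsInjImmersion (ψ : Space m → Space n) (Ω : Set (Space m)) : Prop where
  isOpen : IsOpen Ω
  contDiffAt : ∀ u ∈ Ω, ContDiffAt ℝ 1 ψ u
  injOn : InjOn ψ Ω
  injective : ∀ u ∈ Ω, Function.Injective (fderiv ℝ ψ u)

theorem IsInjImmersion.continuousOn (h : IsInjImmersion ψ Ω) : ContinuousOn ψ Ω :=
  fun u hu => (h.contDiffAt u hu).continuousAt.continuousWithinAt

theorem IsInjImmersion.measurableSet_image (h : IsInjImmersion ψ Ω) {s : Set (Space m)}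
    (hs : MeasurableSet s) (hsΩ : s ⊆ Ω) : MeasurableSet (ψ '' s) :=
  hs.image_of_continuousOn_injOn (h.continuousOn.mono hsΩ) (h.injOn.mono hsΩ)

theorem IsInjImmersion.continuousOn_jac (h : IsInjImmersion ψ Ω) :
    ContinuousOn (fun u => jac (fderiv ℝ ψ u)) Ω := fun u hu =>
  (continuous_jac.continuousAt.comp
    ((h.contDiffAt u hu).fderiv_right (m := 0) (by norm_num)).continuousAt).continuousWithinAt

/-- The area formula. -/
theorem IsInjImmersion.measure_image (h : IsInjImmersion ψ Ω) {s : Set (Space m)}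
    (hs : MeasurableSet s) (hsΩ : s ⊆ Ω) :
    μHE[m] (ψ '' s) = ∫⁻ x in s, areaDensity ψ x := by
  rcases Ω.eq_empty_or_nonempty with rfl | hne
  · rw [subset_empty_iff.1 hsΩ]; simp
  -- For fixed $t>1$ the local two-sided estimate is summed over a countable disjoint decomposition
  -- subordinate to the good neighbourhoods; injectivity keeps the images disjoint. Letting $t\to1$
  -- gives equality.
  have key : ∀ t : ℝ≥0, 1 < t →
      μHE[m] (ψ '' s) ≤ (t : ℝ≥0∞) ^ (m + 1) * ∫⁻ x in s, areaDensity ψ x ∧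
      ∫⁻ x in s, areaDensity ψ x ≤ (t : ℝ≥0∞) ^ (m + 1) * μHE[m] (ψ '' s) := by
    intro t ht
    choose! V hVo huV hV using fun u (hu : u ∈ Ω) =>
      exists_nhds_area (h.contDiffAt u hu) (h.injective u hu) ht
    obtain ⟨T, hTΩ, hTc, hT⟩ := TopologicalSpace.countable_cover_nhdsWithin
      (f := V) (s := Ω) fun u hu => mem_nhdsWithin_of_mem_nhds ((hVo u hu).mem_nhds (huV u hu))
    have hTne : T.Nonempty := by
      by_contra hempty
      rw [not_nonempty_iff_eq_empty] at hempty
      obtain ⟨u, hu⟩ := hne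
      have := hT hu
      simp [hempty] at this
    obtain ⟨c, rfl⟩ := hTc.exists_eq_range hTne
    rw [biUnion_range] at hT
    have hcΩ : ∀ i, c i ∈ Ω := fun i => hTΩ ⟨i, rfl⟩
    set D := disjointed fun i => V (c i)
    have hDm : ∀ i, MeasurableSet (s ∩ D i) := fun i =>
      hs.inter (MeasurableSet.disjointed (fun i => (hVo _ (hcΩ i)).measurableSet) i)
    have hDd : Pairwise (Function.onFun Disjoint fun i => s ∩ D i) := fun i j hij =>
      (disjoint_disjointed _ hij).mono inter_subset_right inter_subset_right
    have hsU : s = ⋃ i, s ∩ D i := by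
      rw [← inter_iUnion, iUnion_disjointed, inter_eq_left.2 (hsΩ.trans hT)]
    have e1 : μHE[m] (ψ '' s) = ∑' i, μHE[m] (ψ '' (s ∩ D i)) := by
      conv_lhs => rw [hsU, image_iUnion]
      refine measure_iUnion (fun i j hij => ?_) fun i =>
        h.measurableSet_image (hDm i) (inter_subset_left.trans hsΩ)
      rw [Function.onFun, disjoint_iff_inter_eq_empty, ← h.injOn.image_inter
        (inter_subset_left.trans hsΩ) (inter_subset_left.trans hsΩ), (hDd hij).inter_eq, image_empty]
    have e2 : ∫⁻ x in s, areaDensity ψ x = ∑' i, ∫⁻ x in s ∩ D i, areaDensity ψ x := by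
      conv_lhs => rw [hsU]
      exact lintegral_iUnion hDm hDd _
    have hloc := fun i => hV (c i) (hcΩ i) (s ∩ D i)
      (inter_subset_right.trans (disjointed_subset _ i)) (hDm i)
    rw [e1, e2, ← ENNReal.tsum_mul_left, ← ENNReal.tsum_mul_left]
    exact ⟨ENNReal.tsum_le_tsum fun i => (hloc i).1, ENNReal.tsum_le_tsum fun i => (hloc i).2⟩
  have lim : ∀ a b : ℝ≥0∞, (∀ t : ℝ≥0, 1 < t → a ≤ (t : ℝ≥0∞) ^ (m + 1) * b) → a ≤ b := by
    intro a b hab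
    have h1 : Tendsto (fun t : ℝ≥0 => (t : ℝ≥0∞) ^ (m + 1) * b) (𝓝[>] 1) (𝓝 (1 * b)) := by
      refine ENNReal.Tendsto.mul_const ?_ (Or.inl one_ne_zero)
      have h2 : Tendsto (fun t : ℝ≥0 => ((t ^ (m + 1) : ℝ≥0) : ℝ≥0∞)) (𝓝[>] 1)
          (𝓝 ((1 ^ (m + 1) : ℝ≥0) : ℝ≥0∞)) :=
        (ENNReal.continuous_coe.comp (continuous_pow (m + 1))).continuousAt.mono_left
          nhdsWithin_le_nhds
      simpa using h2
    rw [one_mul] at h1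
    exact ge_of_tendsto h1 (eventually_mem_nhdsWithin.mono fun t ht => hab t ht)
  exact le_antisymm (lim _ _ fun t ht => (key t ht).1) (lim _ _ fun t ht => (key t ht).2)

theorem IsInjImmersion.measurableEmbedding (h : IsInjImmersion ψ Ω) {s : Set (Space m)}
    (hs : MeasurableSet s) (hsΩ : s ⊆ Ω) : MeasurableEmbedding (s.domRestrict ψ) :=
  (h.continuousOn.mono hsΩ).measurableEmbedding hs (h.injOn.mono hsΩ)

theorem IsInjImmersion.aemeasurable_jac (h : IsInjImmersion ψ Ω) {s : Set (Space m)}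
    (hs : MeasurableSet s) (hsΩ : s ⊆ Ω) :
    AEMeasurable (fun x => (jac (fderiv ℝ ψ x)).toNNReal) (volume.restrict s) :=
  ((h.continuousOn_jac.mono hsΩ).aemeasurable hs).real_toNNReal

/-- Stating the area formula as an equality of measures transfers it to integrals of arbitrary
functions and to integrability. -/
theorem IsInjImmersion.map_withDensity (h : IsInjImmersion ψ Ω) {s : Set (Space m)}
    (hs : MeasurableSet s) (hsΩ : s ⊆ Ω) :
    Measure.map (s.domRestrict ψ) (Measure.comap (↑) (volume.withDensity (areaDensity ψ))) =
      μHE[m].restrict (ψ '' s) := by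
  ext t ht
  rw [(h.measurableEmbedding hs hsΩ).map_apply, Measure.restrict_apply ht,
    (MeasurableEmbedding.subtype_coe hs).comap_apply]
  have h1 : ((↑) : s → Space m) '' (s.domRestrict ψ ⁻¹' t) = s ∩ ψ ⁻¹' t := by
    ext x; simp [and_comm]
  have h2 : MeasurableSet (s ∩ ψ ⁻¹' t) := by
    rw [← h1]
    exact (MeasurableEmbedding.subtype_coe hs).measurableSet_image.2
      ((h.measurableEmbedding hs hsΩ).measurable ht)
  rw [h1, withDensity_apply _ h2, ← h.measure_image h2 (inter_subset_left.trans hsΩ)]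
  congr 1
  rw [image_inter_preimage, inter_comm]

/-- Change of variables. -/
theorem IsInjImmersion.setIntegral_image (h : IsInjImmersion ψ Ω) {s : Set (Space m)}
    (hs : MeasurableSet s) (hsΩ : s ⊆ Ω) (f : Space n → ℝ) :
    ∫ y in ψ '' s, f y ∂μHE[m] = ∫ x in s, f (ψ x) * jac (fderiv ℝ ψ x) := by
  rw [← h.map_withDensity hs hsΩ, (h.measurableEmbedding hs hsΩ).integral_map]
  simp only [Set.domRestrict_apply, ← Function.comp_apply (f := f)]
  have h3 : areaDensity ψ = fun x => ((jac (fderiv ℝ ψ x)).toNNReal : ℝ≥0∞) := rfl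
  rw [← (MeasurableEmbedding.subtype_coe hs).integral_map, map_comap_subtype_coe hs, h3,
    setIntegral_withDensity_eq_setIntegral_smul₀ (h.aemeasurable_jac hs hsΩ) _ hs]
  congr with x
  rw [NNReal.smul_def, Real.coe_toNNReal _ (jac_nonneg _), smul_eq_mul, mul_comm]

theorem IsInjImmersion.integrableOn_image_iff (h : IsInjImmersion ψ Ω) {s : Set (Space m)}
    (hs : MeasurableSet s) (hsΩ : s ⊆ Ω) (f : Space n → ℝ) :
    IntegrableOn f (ψ '' s) μHE[m] ↔ IntegrableOn (fun x => f (ψ x) * jac (fderiv ℝ ψ x)) s := by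
  rw [IntegrableOn, ← h.map_withDensity hs hsΩ, (h.measurableEmbedding hs hsΩ).integrable_map_iff]
  have h3 : areaDensity ψ = fun x => ((jac (fderiv ℝ ψ x)).toNNReal : ℝ≥0∞) := rfl
  simp only [Set.domRestrict_eq, ← Function.comp_assoc, h3]
  rw [← (MeasurableEmbedding.subtype_coe hs).integrable_map_iff, map_comap_subtype_coe hs,
    restrict_withDensity hs, integrable_withDensity_iff_integrable_coe_smul₀
      (h.aemeasurable_jac hs hsΩ)]
  simp_rw [IntegrableOn, Real.coe_toNNReal _ (jac_nonneg _), Function.comp_apply, smul_eq_mul,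
    mul_comm]

end AreaFormula

/-! ### Local parametrizations of submanifolds -/

section Charts

open Filter Topology

variable {m n : ℕ}

/-- `ψ : Ω → M ∩ V` is a parametrization of class `C²`, with a linear left inverse `π`. -/
structure IsChart (M V : Set (Space n)) (ψ : Space m → Space n) (Ω : Set (Space m))
    (π : Space n →L[ℝ] Space m) : Prop where
  isOpen : IsOpen Ω
  isOpen_image : IsOpen V
  contDiffAt : ∀ u ∈ Ω, ContDiffAt ℝ 2 ψ u
  image_eq : ψ '' Ω = M ∩ V
  left_inv : ∀ u ∈ Ω, π (ψ u) = u

theorem two_le_infty : (2 : WithTop ℕ∞) ≤ ∞ :=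
  WithTop.coe_le_coe.2 (le_top : (2 : ℕ∞) ≤ ⊤)

theorem hasFDerivAt_pi_defining {p : ℕ} {ρ : Fin p → Space n → ℝ} {x : Space n}
    (h : ∀ j, DifferentiableAt ℝ (ρ j) x) :
    HasFDerivAt (fun y j => ρ j y) (ContinuousLinearMap.pi fun j => fderiv ℝ (ρ j) x) x :=
  hasFDerivAt_pi.2 fun j => (h j).hasFDerivAt

theorem inner_gradient {f : Space n → ℝ} {x v : Space n} :
    inner ℝ (gradient f x) v = fderiv ℝ f x v := by
  simp [gradient]

/-- The inverse function theorem is applied to $\Phi=(\rho,\pi)$, with $\pi$ the projection to the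
common kernel of the $d\rho_j$ at `x`. Then $\psi=\Phi^{-1}(0,\cdot)$ parametrizes $M$ and has the
linear left inverse $\pi$. -/
theorem exists_isChart (hmn : m ≤ n) {M U : Set (Space n)} {ρ : Fin (n - m) → Space n → ℝ}
    (h : IsDefinedBy M U ρ) {x : Space n} (hx : x ∈ M ∩ U)
    (hli : LinearIndependent ℝ fun j => gradient (ρ j) x) :
    ∃ V ψ Ω π, x ∈ V ∧ V ⊆ U ∧ IsChart (m := m) M V ψ Ω π := by
  obtain ⟨hU, hρ, hMU⟩ := h
  set S : Submodule ℝ (Space n) := Submodule.span ℝ (range fun j => gradient (ρ j) x)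
  have hS : Module.finrank ℝ S = n - m := by
    rw [finrank_span_eq_card hli, Fintype.card_fin]
  have hK : Module.finrank ℝ Sᗮ = m := by
    have := Submodule.finrank_add_finrank_orthogonal S
    rw [hS, finrank_euclideanSpace_fin] at this
    omega
  let I : Sᗮ ≃ₗᵢ[ℝ] Space m := ((stdOrthonormalBasis ℝ Sᗮ).reindex (finCongr hK)).repr
  let π : Space n →L[ℝ] Space m :=
    (I : Sᗮ →L[ℝ] Space m).comp Sᗮ.orthogonalProjectionOnto
  have hρx : ∀ y ∈ U, ∀ j, ContDiffAt ℝ ∞ (ρ j) y := fun y hy j =>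
    (hρ j).contDiffAt (hU.mem_nhds hy)
  let Φ : Space n → (Fin (n - m) → ℝ) × Space m := fun y => (fun j => ρ j y, π y)
  let D : Space n →L[ℝ] (Fin (n - m) → ℝ) × Space m :=
    (ContinuousLinearMap.pi fun j => fderiv ℝ (ρ j) x).prod π
  have hΦ : ContDiffAt ℝ 2 Φ x :=
    (contDiffAt_pi.2 fun j => (hρx x hx.2 j).of_le two_le_infty).prodMk
      π.contDiff.contDiffAt
  have hD : HasFDerivAt Φ D x :=
    (hasFDerivAt_pi_defining fun j => (hρx x hx.2 j).differentiableAt (by simp)).prodMk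
      π.hasFDerivAt
  have hDinj : Function.Injective (D : Space n →ₗ[ℝ] (Fin (n - m) → ℝ) × Space m) := by
    refine (injective_iff_map_eq_zero _).2 fun v hv => ?_
    have h1 : ∀ j, fderiv ℝ (ρ j) x v = 0 := fun j => congrFun (congrArg Prod.fst hv) j
    have h2 : π v = 0 := congrArg Prod.snd hv
    have h3 : v ∈ Sᗮ := by
      rw [Submodule.mem_orthogonal]
      intro w hw
      induction hw using Submodule.span_induction with
      | mem w hw => obtain ⟨j, rfl⟩ := hw; rw [inner_gradient, h1]
      | zero => exact inner_zero_left _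
      | add a b _ _ ha hb => rw [inner_add_left, ha, hb, add_zero]
      | smul c a _ ha => rw [inner_smul_left, ha, mul_zero]
    have h4 : Sᗮ.orthogonalProjectionOnto v = 0 := I.map_eq_zero_iff.1 h2
    have h5 := Submodule.orthogonalProjectionOnto_mem_subspace_eq_self (K := Sᗮ) ⟨v, h3⟩
    rw [h4] at h5
    exact (congrArg Subtype.val h5).symm
  have hdim : Module.finrank ℝ (Space n) = Module.finrank ℝ ((Fin (n - m) → ℝ) × Space m) := by
    simp; omega
  let D' : Space n ≃L[ℝ] (Fin (n - m) → ℝ) × Space m :=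
    (LinearEquiv.ofInjectiveOfFinrankEq
      (D : Space n →ₗ[ℝ] (Fin (n - m) → ℝ) × Space m) hDinj hdim).toContinuousLinearEquiv
  have hD' : HasFDerivAt Φ (D' : Space n →L[ℝ] (Fin (n - m) → ℝ) × Space m) x := by
    have : (D' : Space n →L[ℝ] (Fin (n - m) → ℝ) × Space m) = D := by
      ext1 v
      rfl
    rw [this]
    exact hD
  let h := hΦ.toOpenPartialHomeomorph Φ hD' (by norm_num)
  have hh : ∀ y, h y = Φ y := fun y => rfl
  have hxs : x ∈ h.source := hΦ.mem_toOpenPartialHomeomorph_source hD' (by norm_num)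
  have hsymm : ContDiffAt ℝ 2 h.symm (Φ x) := hΦ.to_localInverse hD' (by norm_num)
  -- The inverse function theorem gives smoothness of the inverse at $\Phi(x)$ only. Being $C^2$ at
  -- a point is an open condition, and the chart is cut down to the neighbourhood `N` where it
  -- holds.
  obtain ⟨N, hN, hNo, hxN⟩ := eventually_nhds_iff.1 (hsymm.eventually (by simp))
  refine ⟨h.source ∩ h ⁻¹' N ∩ U, fun u => h.symm (0, u),
    (fun u : Space m => ((0 : Fin (n - m) → ℝ), u)) ⁻¹' ((h.target ∩ h.symm ⁻¹' U) ∩ N), π,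
    ⟨⟨hxs, hxN⟩, hx.2⟩, inter_subset_right, ?_, ?_, ?_, ?_, ?_⟩
  · exact ((h.symm.isOpen_inter_preimage hU).inter hNo).preimage (by fun_prop)
  · exact (h.isOpen_inter_preimage hNo).inter hU
  · intro u hu
    exact (hN _ hu.2).comp u (contDiff_prodMk_right _).contDiffAt
  · ext y
    constructor
    · rintro ⟨u, ⟨⟨hut, huU⟩, huN⟩, rfl⟩
      have e1 : Φ (h.symm (0, u)) = (0, u) := h.right_inv hut
      have e2 : h.symm (0, u) ∈ M ∩ U := by
        rw [hMU]
        exact ⟨huU, fun j => congrFun (congrArg Prod.fst e1) j⟩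
      refine ⟨e2.1, ⟨h.map_target hut, ?_⟩, huU⟩
      change Φ _ ∈ N
      rw [e1]; exact huN
    · rintro ⟨hyM, ⟨hys, hyN⟩, hyU⟩
      have e1 : Φ y = (0, π y) := by
        have : y ∈ M ∩ U := ⟨hyM, hyU⟩
        rw [hMU] at this
        exact Prod.ext (funext this.2) rfl
      have e2 : h.symm (0, π y) = y := by rw [← e1]; exact h.left_inv hys
      refine ⟨π y, ⟨⟨?_, ?_⟩, ?_⟩, e2⟩
      · change ((0 : Fin (n - m) → ℝ), π y) ∈ h.target
        rw [← e1]; exact h.map_source hys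
      · change h.symm (0, π y) ∈ U
        rw [e2]; exact hyU
      · change ((0 : Fin (n - m) → ℝ), π y) ∈ N
        rw [← e1]; exact hyN
  · intro u hu
    exact congrArg Prod.snd (h.right_inv hu.1.1 : Φ (h.symm (0, u)) = (0, u))

theorem exists_isChart_of_isSubmanifold {M : Set (Space n)} (hM : IsSubmanifold m M) {x : Space n}
    (hx : x ∈ M) : ∃ V ψ Ω π, x ∈ V ∧ IsChart (m := m) M V ψ Ω π := by
  obtain ⟨U, ρ, hxU, hdef, hli⟩ := hM.2 x hx
  obtain ⟨V, ψ, Ω, π, hxV, -, h⟩ := exists_isChart hM.1 hdef ⟨hx, hxU⟩ (hli x ⟨hx, hxU⟩)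
  exact ⟨V, ψ, Ω, π, hxV, h⟩

variable {M V : Set (Space n)} {ψ : Space m → Space n} {Ω : Set (Space m)}
  {π : Space n →L[ℝ] Space m}

theorem IsChart.hasFDerivAt (h : IsChart M V ψ Ω π) {u : Space m} (hu : u ∈ Ω) :
    HasFDerivAt ψ (fderiv ℝ ψ u) u :=
  ((h.contDiffAt u hu).differentiableAt (by norm_num)).hasFDerivAt

theorem IsChart.left_inv_fderiv (h : IsChart M V ψ Ω π) {u : Space m} (hu : u ∈ Ω) (v : Space m) :
    π (fderiv ℝ ψ u v) = v := by
  have h1 : HasFDerivAt (fun u => π (ψ u)) (π.comp (fderiv ℝ ψ u)) u :=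
    π.hasFDerivAt.comp u (h.hasFDerivAt hu)
  have h2 : HasFDerivAt (fun u => π (ψ u)) (ContinuousLinearMap.id ℝ (Space m)) u :=
    (hasFDerivAt_id u).congr_of_eventuallyEq
      (eventually_of_mem (h.isOpen.mem_nhds hu) h.left_inv)
  exact DFunLike.congr_fun (h1.unique h2) v

theorem IsChart.injective (h : IsChart M V ψ Ω π) {u : Space m} (hu : u ∈ Ω) :
    Function.Injective (fderiv ℝ ψ u) :=
  Function.LeftInverse.injective (h.left_inv_fderiv hu)

theorem IsChart.injOn (h : IsChart M V ψ Ω π) : InjOn ψ Ω := fun u hu v hv huv => by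
  rw [← h.left_inv u hu, huv, h.left_inv v hv]

theorem IsChart.isInjImmersion (h : IsChart M V ψ Ω π) : IsInjImmersion ψ Ω :=
  ⟨h.isOpen, fun u hu => (h.contDiffAt u hu).of_le (by norm_num), h.injOn,
    fun _ hu => h.injective hu⟩

theorem IsChart.mem (h : IsChart M V ψ Ω π) {u : Space m} (hu : u ∈ Ω) : ψ u ∈ M ∩ V :=
  h.image_eq ▸ mem_image_of_mem ψ hu

theorem IsChart.right_inv (h : IsChart M V ψ Ω π) {y : Space n} (hy : y ∈ M ∩ V) :
    π y ∈ Ω ∧ ψ (π y) = y := by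
  rw [← h.image_eq] at hy
  obtain ⟨u, hu, rfl⟩ := hy
  rw [h.left_inv u hu]
  exact ⟨hu, rfl⟩

/-- On $M\cap V$ the map $\psi\circ\pi$ is the identity, so the two derivatives agree on the tangent
cone: $y=d\psi(\pi y)$. -/
theorem IsChart.tangentCone_subset (h : IsChart M V ψ Ω π) {u : Space m} (hu : u ∈ Ω) :
    tangentConeAt ℝ M (ψ u) ⊆ LinearMap.range (fderiv ℝ ψ u : Space m →ₗ[ℝ] Space n) := by
  intro y hy
  have hVn : V ∈ 𝓝 (ψ u) := h.isOpen_image.mem_nhds (h.mem hu).2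
  rw [← tangentConeAt_inter_nhds hVn] at hy
  have hd := h.hasFDerivAt hu
  have h1 : HasFDerivWithinAt (fun y => ψ (π y)) ((fderiv ℝ ψ u).comp π) (M ∩ V) (ψ u) := by
    rw [← h.left_inv u hu] at hd
    have := hd.comp (ψ u) π.hasFDerivAt
    rw [h.left_inv u hu] at this
    exact this.hasFDerivWithinAt
  have h2 : HasFDerivWithinAt (fun y => ψ (π y)) (ContinuousLinearMap.id ℝ (Space n)) (M ∩ V)
      (ψ u) :=
    (hasFDerivWithinAt_id _ _).congr (fun y hy => (h.right_inv hy).2)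
      (h.right_inv (h.mem hu)).2
  exact ⟨π y, h1.unique_on h2 hy⟩

theorem IsChart.mem_tangentCone (h : IsChart M V ψ Ω π) {u : Space m} (hu : u ∈ Ω) (v : Space m) :
    fderiv ℝ ψ u v ∈ tangentConeAt ℝ M (ψ u) := by
  have hv : v ∈ tangentConeAt ℝ Ω u := by
    rw [tangentConeAt_of_mem_nhds (h.isOpen.mem_nhds hu)]
    trivial
  have h1 := (h.hasFDerivAt hu).hasFDerivWithinAt.mapsTo_tangent_cone hv
  rw [h.image_eq] at h1
  exact tangentConeAt_mono inter_subset_left h1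

theorem IsChart.tangent_eq (h : IsChart M V ψ Ω π) {u : Space m} (hu : u ∈ Ω) :
    tangent M (ψ u) = LinearMap.range (fderiv ℝ ψ u : Space m →ₗ[ℝ] Space n) := by
  refine le_antisymm (Submodule.span_le.2 (h.tangentCone_subset hu)) ?_
  rintro _ ⟨v, rfl⟩
  exact Submodule.subset_span (h.mem_tangentCone hu v)

theorem finrank_tangent (hM : IsSubmanifold m M) {x : Space n} (hx : x ∈ M) :
    Module.finrank ℝ (tangent M x) = m := by
  obtain ⟨V, ψ, Ω, π, hxV, h⟩ := exists_isChart_of_isSubmanifold hM hx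
  obtain ⟨hu, hux⟩ := h.right_inv ⟨hx, hxV⟩
  rw [← hux, h.tangent_eq hu, LinearMap.finrank_range_of_inj (h.injective hu)]
  simp

/-- The tangent cone of a submanifold is already a linear space, so uniqueness of derivatives on the
cone applies to all tangent vectors. -/
theorem mem_tangentCone_of_mem_tangent (hM : IsSubmanifold m M) {x : Space n} (hx : x ∈ M)
    {v : Space n} (hv : v ∈ tangent M x) : v ∈ tangentConeAt ℝ M x := by
  obtain ⟨V, ψ, Ω, π, hxV, h⟩ := exists_isChart_of_isSubmanifold hM hx
  obtain ⟨hu, hux⟩ := h.right_inv ⟨hx, hxV⟩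
  rw [← hux, h.tangent_eq hu] at hv
  obtain ⟨w, rfl⟩ := hv
  have := h.mem_tangentCone hu w
  rw [hux] at this
  exact this

/-- A function that vanishes on `M` near `x` has zero derivative along `M`. -/
theorem fderiv_eq_zero_of_tangent {E : Type*} [NormedAddCommGroup E] [NormedSpace ℝ E]
    (hM : IsSubmanifold m M) {x : Space n} (hx : x ∈ M) {f : Space n → E} {f' : Space n →L[ℝ] E}
    (hf : HasFDerivAt f f' x) (h0 : ∀ᶠ y in 𝓝[M] x, f y = 0) {v : Space n}
    (hv : v ∈ tangent M x) : f' v = 0 := by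
  have h1 : HasFDerivWithinAt f (0 : Space n →L[ℝ] E) M x :=
    (hasFDerivWithinAt_const (0 : E) x M).congr_of_eventuallyEq h0 (h0.self_of_nhdsWithin hx)
  exact hf.hasFDerivWithinAt.unique_on h1 (mem_tangentCone_of_mem_tangent hM hx hv)

theorem IsDefinedBy.contDiffAt {p : ℕ} {U : Set (Space n)} {ρ : Fin p → Space n → ℝ}
    (h : IsDefinedBy M U ρ) {x : Space n} (hx : x ∈ U) (j : Fin p) : ContDiffAt ℝ ∞ (ρ j) x :=
  (h.2.1 j).contDiffAt (h.1.mem_nhds hx)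

theorem gradient_mem_normal (hM : IsSubmanifold m M) {p : ℕ} {U : Set (Space n)}
    {ρ : Fin p → Space n → ℝ} (h : IsDefinedBy M U ρ) {x : Space n} (hx : x ∈ M ∩ U) (j : Fin p) :
    gradient (ρ j) x ∈ normal M x := by
  rw [normal, Submodule.mem_orthogonal']
  intro v hv
  rw [inner_gradient]
  refine fderiv_eq_zero_of_tangent hM hx.1
    ((h.contDiffAt hx.2 j).differentiableAt (by simp)).hasFDerivAt ?_ hv
  filter_upwards [self_mem_nhdsWithin, mem_nhdsWithin_of_mem_nhds (h.1.mem_nhds hx.2)] with y hy hyU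
  have : y ∈ M ∩ U := ⟨hy, hyU⟩
  rw [h.2.2] at this
  exact this.2 j

/-- Expansion of a normal vector in an orthonormal frame of gradients of defining functions. -/
theorem normal_eq_sum (hM : IsSubmanifold m M) {U : Set (Space n)}
    {ρ : Fin (n - m) → Space n → ℝ} (h : IsDefinedBy M U ρ) {x : Space n} (hx : x ∈ M ∩ U)
    (ho : Orthonormal ℝ fun j => gradient (ρ j) x) {v : Space n} (hv : v ∈ normal M x) :
    v = ∑ j, inner ℝ v (gradient (ρ j) x) • gradient (ρ j) x := by
  have hle : Submodule.span ℝ (range fun j => gradient (ρ j) x) ≤ normal M x :=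
    Submodule.span_le.2 (by rintro _ ⟨j, rfl⟩; exact gradient_mem_normal hM h hx j)
  have heq : Submodule.span ℝ (range fun j => gradient (ρ j) x) = normal M x := by
    refine Submodule.eq_of_le_of_finrank_eq hle ?_
    rw [finrank_span_eq_card ho.linearIndependent, Fintype.card_fin,
      finrank_normal (finrank_tangent hM hx.1)]
  rw [← heq, Submodule.mem_span_range_iff_exists_fun] at hv
  obtain ⟨c, rfl⟩ := hv
  refine Finset.sum_congr rfl fun j _ => ?_
  rw [ho.inner_left_fintype]
  simp

end Charts

/-! ### The divergence theorem on a compact submanifold -/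

section Divergence

open Filter Topology
open scoped MeasureTheory

variable {m n : ℕ}

theorem tangentTrace_add (W : Submodule ℝ (Space n)) (D D' : Space n →L[ℝ] Space n) :
    tangentTrace W (D + D') = tangentTrace W D + tangentTrace W D' := by
  simp [tangentTrace, inner_add_left, Finset.sum_add_distrib]

theorem tangentTrace_sum {ι : Type*} (s : Finset ι) (W : Submodule ℝ (Space n))
    (D : ι → Space n →L[ℝ] Space n) :
    tangentTrace W (∑ i ∈ s, D i) = ∑ i ∈ s, tangentTrace W (D i) := by
  classical
  induction s using Finset.induction_on with
  | empty => simp [tangentTrace]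
  | insert a s ha ih => rw [Finset.sum_insert ha, Finset.sum_insert ha, tangentTrace_add, ih]

theorem tangentTrace_zero (W : Submodule ℝ (Space n)) : tangentTrace W 0 = 0 := by
  simp [tangentTrace]

theorem contDiffAt_gradient {f : Space n → ℝ} {x : Space n} {k l : WithTop ℕ∞}
    (hf : ContDiffAt ℝ k f x) (hl : l + 1 ≤ k) : ContDiffAt ℝ l (gradient f) x :=
  (InnerProductSpace.toDual ℝ (Space n)).symm.toContinuousLinearEquiv.contDiff.contDiffAt.comp x
    (hf.fderiv_right hl)

theorem inner_fderiv_gradient {f : Space n → ℝ} {x : Space n} (hf : ContDiffAt ℝ 2 f x)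
    (v w : Space n) :
    inner ℝ (fderiv ℝ (gradient f) x v) w = fderiv ℝ (fderiv ℝ f) x v w := by
  have h1 : HasFDerivAt (fun y => inner ℝ (gradient f y) w)
      ((innerSL ℝ w).comp (fderiv ℝ (gradient f) x)) x := by
    have := (innerSL ℝ w).hasFDerivAt.comp x
      ((contDiffAt_gradient (l := 1) hf (by norm_num)).differentiableAt (by norm_num)).hasFDerivAt
    refine this.congr_of_eventuallyEq (Eventually.of_forall fun y => ?_)
    simp
  have h2 : HasFDerivAt (fun y => fderiv ℝ f y w) ((fderiv ℝ (fderiv ℝ f) x).flip w) x := by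
    have h3 : DifferentiableAt ℝ (fderiv ℝ f) x :=
      (hf.fderiv_right (m := 1) (by norm_num)).differentiableAt (by norm_num)
    have := h3.hasFDerivAt.clm_apply (hasFDerivAt_const w x)
    simpa using this
  simp only [inner_gradient] at h1
  have := DFunLike.congr_fun (h1.unique h2) v
  simpa [real_inner_comm] using this

theorem tangentTrace_fderiv_gradient {f : Space n → ℝ} {x : Space n} (hf : ContDiffAt ℝ 2 f x)
    (W : Submodule ℝ (Space n)) :
    tangentTrace W (fderiv ℝ (gradient f) x) = hessTrace W f x := by
  simp only [tangentTrace, hessTrace, inner_fderiv_gradient hf]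

variable {M V : Set (Space n)}

theorem IsMeanCurvatureVector.mem_normal (hM : IsSubmanifold m M) {x h : Space n} (hx : x ∈ M)
    (hh : IsMeanCurvatureVector m M x h) : h ∈ normal M x := by
  obtain ⟨U, ρ, hxU, hdef, -, rfl⟩ := hh
  exact Submodule.sum_mem _ fun j _ => Submodule.smul_mem _ _
    (gradient_mem_normal hM hdef ⟨hx, hxU⟩ j)

/-- The tangential divergence of a normal field is its scalar product with the mean curvature
vector. -/
theorem tangentTrace_of_normal (hM : IsSubmanifold m M) {x h : Space n} (hx : x ∈ M)
    (hh : IsMeanCurvatureVector m M x h) {N : Space n → Space n} {N' : Space n →L[ℝ] Space n}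
    (hN : HasFDerivAt N N' x) (hn : ∀ᶠ y in 𝓝[M] x, N y ∈ normal M y) :
    tangentTrace (tangent M x) N' = inner ℝ (N x) h := by
  obtain ⟨U, ρ, hxU, hdef, ho, rfl⟩ := hh
  set g := fun j => gradient (ρ j)
  have hρ2 : ∀ j, ContDiffAt ℝ 2 (ρ j) x := fun j => (hdef.contDiffAt hxU j).of_le two_le_infty
  set G := fun j => fderiv ℝ (g j) x
  have hg : ∀ j, HasFDerivAt (g j) (G j) x := fun j =>
    ((contDiffAt_gradient (l := 1) (hρ2 j) (by norm_num)).differentiableAt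
      (by norm_num)).hasFDerivAt
  have hf : HasFDerivAt (fun y => N y - ∑ j, inner ℝ (N y) (g j y) • g j y) _ x :=
    hN.sub (HasFDerivAt.fun_sum (u := Finset.univ) fun j _ => (hN.inner ℝ (hg j)).smul (hg j))
  -- On $M$ a normal field equals its expansion in the frame $g_j=\nabla\rho_j$. Differentiating
  -- this identity along a tangent vector `t` and pairing with `t` removes every term in which $g_j$
  -- itself is not differentiated.
  have h0 : ∀ᶠ y in 𝓝[M] x, N y - ∑ j, inner ℝ (N y) (g j y) • g j y = 0 := by
    filter_upwards [hn, self_mem_nhdsWithin,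
      mem_nhdsWithin_of_mem_nhds (hdef.1.mem_nhds hxU)] with y hy hyM hyU
    exact sub_eq_zero.2 (normal_eq_sum hM hdef ⟨hyM, hyU⟩ (ho y ⟨hyM, hyU⟩) hy)
  have key : ∀ t ∈ tangent M x, inner ℝ (N' t) t =
      ∑ j, inner ℝ (N x) (g j x) * inner ℝ (G j t) t := by
    intro t ht
    have h1 := fderiv_eq_zero_of_tangent hM hx hf h0 ht
    have h2 : ∀ j, inner ℝ (g j x) t = 0 := fun j =>
      Submodule.inner_left_of_mem_orthogonal ht (gradient_mem_normal hM hdef ⟨hx, hxU⟩ j)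
    have h3 := congrArg (fun z => inner ℝ z t) h1
    simp only [_root_.sub_apply, _root_.sum_apply,
      _root_.add_apply, _root_.smul_apply,
      ContinuousLinearMap.smulRight_apply, inner_sub_left, sum_inner, inner_add_left,
      real_inner_smul_left, h2, mul_zero, add_zero, inner_zero_left] at h3
    linarith
  have h4 : ∀ j, hessTrace (tangent M x) (ρ j) x = tangentTrace (tangent M x) (G j) := fun j =>
    (tangentTrace_fderiv_gradient (hρ2 j) _).symm
  simp only [inner_sum, real_inner_smul_right, h4]
  rw [tangentTrace]
  simp only [key _ (Subtype.property _)]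
  rw [Finset.sum_comm]
  refine Finset.sum_congr rfl fun j _ => ?_
  rw [tangentTrace, ← Finset.mul_sum, mul_comm]

/-- Integration by parts against the constant $1$. -/
theorem integral_fderiv_eq_zero {g : Space m → ℝ} (hg : ContDiff ℝ 1 g) (hs : HasCompactSupport g)
    (v : Space m) : ∫ u, fderiv ℝ g u v = 0 := by
  have hc : Continuous fun u => fderiv ℝ g u v := (hg.continuous_fderiv (by norm_num)).clm_apply
    continuous_const
  have hi : Integrable fun u => fderiv ℝ g u v := by
    refine hc.integrable_of_hasCompactSupport ?_
    exact (hs.fderiv ℝ).comp_left (g := fun L : Space m →L[ℝ] ℝ => L v) rfl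
  have h := integral_mul_fderiv_eq_neg_fderiv_mul_of_integrable (𝕜 := ℝ) (μ := volume)
    (f := fun _ : Space m => (1 : ℝ)) (g := g) (v := v) (by simp) (by simpa using hi)
    (by simpa using hg.continuous.integrable_of_hasCompactSupport hs)
    (fun x _ => differentiableAt_const _) (fun x _ => hg.differentiable (by norm_num) x)
  simpa using h

variable {ψ : Space m → Space n} {Ω : Set (Space m)} {π : Space n →L[ℝ] Space m}

theorem IsChart.apply_left_inv_of_tangent (h : IsChart M V ψ Ω π) {u : Space m} (hu : u ∈ Ω)
    {z : Space n} (hz : z ∈ tangent M (ψ u)) : fderiv ℝ ψ u (π z) = z := by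
  rw [h.tangent_eq hu] at hz
  obtain ⟨w, rfl⟩ := hz
  exact congrArg _ (h.left_inv_fderiv hu w)

/-- The divergence of a tangential field in local coordinates. -/
theorem IsChart.divergence (h : IsChart M V ψ Ω π) {Z : Space n → Space n}
    (hZ : ContDiff ℝ 1 Z) (hZt : ∀ y ∈ M ∩ V, Z y ∈ tangent M y) {u : Space m} (hu : u ∈ Ω) :
    ContDiffAt ℝ 1 (fun u => jac (fderiv ℝ ψ u) • π (Z (ψ u))) u ∧
    tangentTrace (tangent M (ψ u)) (fderiv ℝ Z (ψ u)) * jac (fderiv ℝ ψ u) =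
      tr (fderiv ℝ (fun u => jac (fderiv ℝ ψ u) • π (Z (ψ u))) u) := by
  have hψ2 := h.contDiffAt u hu
  have hψ' : ContDiffAt ℝ 1 (fderiv ℝ ψ) u := hψ2.fderiv_right (by norm_num)
  have hinj := h.injective hu
  set A := fderiv ℝ ψ u
  have hj : ContDiffAt ℝ 1 (fun u => jac (fderiv ℝ ψ u)) u :=
    ((contDiffAt_jac hinj).of_le (by norm_num)).comp u hψ'
  have hw : ContDiffAt ℝ 1 (fun u => π (Z (ψ u))) u :=
    π.contDiff.contDiffAt.comp u (hZ.contDiffAt.comp u (hψ2.of_le (by norm_num)))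
  refine ⟨hj.smul hw, ?_⟩
  obtain ⟨P, hP⟩ := exists_isPseudoInverse A hinj
  set B := fderiv ℝ (fderiv ℝ ψ) u
  set w := π (Z (ψ u))
  set w' := fderiv ℝ (fun u => π (Z (ψ u))) u
  have hB : HasFDerivAt (fderiv ℝ ψ) B u := (hψ'.differentiableAt (by norm_num)).hasFDerivAt
  have hw' : HasFDerivAt (fun u => π (Z (ψ u))) w' u :=
    (hw.differentiableAt (by norm_num)).hasFDerivAt
  have hsymm : ∀ v, B v w = B w v := fun v =>
    (hψ2.isSymmSndFDerivAt (by simp)).eq v w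
  -- With $w=\pi(Z\circ\psi)$, tangency gives $Z\circ\psi=d\psi(w)$, which is differentiated by the
  -- product rule.
  have e1 : (fderiv ℝ Z (ψ u)).comp A = B.flip w + A.comp w' := by
    have h1 : HasFDerivAt (fun u => Z (ψ u)) ((fderiv ℝ Z (ψ u)).comp A) u :=
      ((hZ.differentiable (by norm_num) _).hasFDerivAt).comp u (h.hasFDerivAt hu)
    have h2 : HasFDerivAt (fun u => fderiv ℝ ψ u (π (Z (ψ u)))) (A.comp w' + B.flip w) u :=
      hB.clm_apply hw'
    have h3 : (fun u => Z (ψ u)) =ᶠ[𝓝 u] fun u => fderiv ℝ ψ u (π (Z (ψ u))) :=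
      eventually_of_mem (h.isOpen.mem_nhds hu) fun u hu =>
        (h.apply_left_inv_of_tangent hu (hZt _ (h.mem hu))).symm
    rw [add_comm]
    exact h1.unique (h2.congr_of_eventuallyEq h3)
  have e2 : tangentTrace (tangent M (ψ u)) (fderiv ℝ Z (ψ u)) = tr (P.comp (B w)) + tr w' := by
    rw [h.tangent_eq hu, ← tr_comp_eq_tangentTrace hinj hP, e1]
    -- Symmetry of $D^2\psi$ turns the first term into the derivative of $d\psi$ in the direction
    -- $w$, whose trace is the relative derivative of the Jacobian. Hence the divergence times `jac`
    -- is the Euclidean divergence of `jac • w`.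
    have : P.comp (B.flip w + A.comp w') = P.comp (B w) + w' := by
      ext1 v
      simp [hP.1, hsymm]
    rw [this]
    simp only [tr_eq_sum]
    simp [Finset.sum_add_distrib]
  have e3 : HasFDerivAt (fun u => jac (fderiv ℝ ψ u)) ((fderiv ℝ jac A).comp B) u :=
    (hasFDerivAt_jac hinj).comp u hB
  have e4 := (e3.smul hw').fderiv
  rw [show (fun u => jac (fderiv ℝ ψ u) • π (Z (ψ u))) =
    (fun u => jac (fderiv ℝ ψ u)) • fun u => π (Z (ψ u)) from rfl, e4, e2]
  have e5 : ∑ i, fderiv ℝ jac A (B (e i)) * w i = jac A * tr (P.comp (B w)) := by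
    rw [← fderiv_jac hinj hP]
    conv_rhs => rw [← sum_smul_e w]
    simp [map_sum, mul_comm]
  have e6 : ∑ i, w' (e i) i = tr w' := (tr_eq_sum _).symm
  have e7 : ∀ i : Fin m, (jac A • w' + ((fderiv ℝ jac A).comp B).smulRight w) (e i) i =
      jac A * w' (e i) i + fderiv ℝ jac A (B (e i)) * w i := fun i => by
    simp
  refine Eq.trans ?_ ((Finset.sum_congr rfl fun i _ => (e7 i).symm).trans (tr_eq_sum _).symm)
  rw [Finset.sum_add_distrib, ← Finset.mul_sum, e5, e6]
  ring

end Divergence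

/-! ### From one chart to the whole submanifold -/

section DivergenceTheorem

open Filter Topology
open scoped MeasureTheory

variable {m n : ℕ} {M V : Set (Space n)} {ψ : Space m → Space n} {Ω : Set (Space m)}
  {π : Space n →L[ℝ] Space m}

theorem contDiff_of_tsupport {E F : Type*} [NormedAddCommGroup E] [NormedSpace ℝ E]
    [NormedAddCommGroup F] [NormedSpace ℝ F] {f : E → F} {k : WithTop ℕ∞}
    (h : ∀ x ∈ tsupport f, ContDiffAt ℝ k f x) : ContDiff ℝ k f :=
  contDiff_iff_contDiffAt.2 fun x => by
    by_cases hx : x ∈ tsupport f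
    · exact h x hx
    · exact contDiffAt_const.congr_of_eventuallyEq (notMem_tsupport_iff_eventuallyEq.1 hx)

theorem IsChart.integral_divergence (h : IsChart M V ψ Ω π) (hM : IsCompact M)
    {Z : Space n → Space n} (hZ : ContDiff ℝ 1 Z) (hZt : ∀ y ∈ M ∩ V, Z y ∈ tangent M y)
    (hs : tsupport Z ⊆ V) :
    IntegrableOn (fun x => tangentTrace (tangent M x) (fderiv ℝ Z x)) M μHE[m] ∧
      ∫ x in M, tangentTrace (tangent M x) (fderiv ℝ Z x) ∂μHE[m] = 0 := by
  classical
  set q : Space n → ℝ := fun x => tangentTrace (tangent M x) (fderiv ℝ Z x)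
  set K : Set (Space m) := π '' (tsupport Z ∩ M)
  have hK : IsCompact K := (hM.inter_left (isClosed_tsupport Z)).image π.continuous
  have hKΩ : K ⊆ Ω := by
    rintro _ ⟨y, ⟨hyZ, hyM⟩, rfl⟩
    exact (h.right_inv ⟨hyM, hs hyZ⟩).1
  set Y₀ : Space m → Space m := fun u => jac (fderiv ℝ ψ u) • π (Z (ψ u))
  -- Extended by zero, the coordinate field is $C^1$ with support in the compact set
  -- $K\subset\Omega$, so the integral of its Euclidean divergence vanishes.
  set Y : Space m → Space m := Ω.indicator Y₀
  have hY0 : ∀ u, u ∉ K → Y u = 0 := by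
    intro u hu
    by_cases huΩ : u ∈ Ω
    · have : Z (ψ u) = 0 := by
        by_contra hne
        exact hu ⟨ψ u, ⟨subset_tsupport Z hne, (h.mem huΩ).1⟩, h.left_inv u huΩ⟩
      simp [Y, Y₀, this]
    · exact indicator_of_notMem huΩ _
  have hYts : tsupport Y ⊆ K :=
    closure_minimal (fun u hu => by_contra fun hn => hu (hY0 u hn)) hK.isClosed
  have hYcs : HasCompactSupport Y := HasCompactSupport.intro hK hY0
  have hYeq : ∀ u ∈ Ω, Y =ᶠ[𝓝 u] Y₀ := fun u hu =>
    eventually_of_mem (h.isOpen.mem_nhds hu) fun v hv => indicator_of_mem hv _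
  have hY : ContDiff ℝ 1 Y := contDiff_of_tsupport fun u hu =>
    (h.divergence hZ hZt (hKΩ (hYts hu))).1.congr_of_eventuallyEq (hYeq u (hKΩ (hYts hu)))
  have hYc : Continuous fun u => tr (fderiv ℝ Y u) := by
    simp only [tr_eq_sum]
    refine continuous_finsetSum _ fun i _ => ?_
    exact (EuclideanSpace.proj i).continuous.comp
      ((hY.continuous_fderiv (by norm_num)).clm_apply continuous_const)
  have hYi : Integrable fun u => tr (fderiv ℝ Y u) :=
    hYc.integrable_of_hasCompactSupport
      ((hYcs.fderiv ℝ).comp_left (g := fun L : Space m →L[ℝ] Space m => tr L) (by simp [tr]))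
  have hYz : ∫ u, tr (fderiv ℝ Y u) = 0 := by
    have hi : ∀ i : Fin m, ContDiff ℝ 1 (fun u => Y u i) := fun i =>
      (EuclideanSpace.proj (𝕜 := ℝ) i).contDiff.comp hY
    have hic : ∀ i : Fin m, HasCompactSupport (fun u => Y u i) := fun i =>
      hYcs.comp_left (g := fun z : Space m => z i) rfl
    have h1 : ∀ (i : Fin m) u, (fderiv ℝ Y u (e i)) i = fderiv ℝ (fun u => Y u i) u (e i) := by
      intro i u
      have := ((EuclideanSpace.proj (𝕜 := ℝ) i).hasFDerivAt (x := Y u)).comp u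
        (hY.differentiable (by norm_num) u).hasFDerivAt
      have h2 : fderiv ℝ (fun u => Y u i) u = _ := this.fderiv
      rw [h2]
      rfl
    simp only [tr_eq_sum, h1]
    rw [integral_finsetSum]
    · exact Finset.sum_eq_zero fun i _ => integral_fderiv_eq_zero (hi i) (hic i) _
    · intro i _
      refine Continuous.integrable_of_hasCompactSupport
        (((hi i).continuous_fderiv (by norm_num)).clm_apply continuous_const) ?_
      exact ((hic i).fderiv ℝ).comp_left (g := fun L : Space m →L[ℝ] ℝ => L (e i)) rfl
  have hpt : ∀ u ∈ Ω, q (ψ u) * jac (fderiv ℝ ψ u) = tr (fderiv ℝ Y u) := fun u hu => by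
    rw [(hYeq u hu).fderiv_eq]
    exact (h.divergence hZ hZt hu).2
  have hΩm := h.isOpen.measurableSet
  have hVm := h.isOpen_image.measurableSet
  have hq0 : ∀ x, x ∉ V → q x = 0 := by
    intro x hx
    have : fderiv ℝ Z x = 0 := by
      by_contra hne
      exact hx (hs (support_fderiv_subset ℝ hne))
    simp only [q, this, tangentTrace_zero]
  have hMV : M \ (M ∩ V) ⊆ Vᶜ := fun x hx hxV => hx.2 ⟨hx.1, hxV⟩
  have hint : IntegrableOn q (M ∩ V) μHE[m] := by
    rw [← h.image_eq, h.isInjImmersion.integrableOn_image_iff hΩm subset_rfl]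
    exact (hYi.integrableOn (s := Ω)).congr_fun (fun u hu => (hpt u hu).symm) hΩm
  constructor
  · exact hint.of_forall_sdiff_eq_zero hM.measurableSet fun x hx => hq0 x (hMV hx)
  · rw [setIntegral_eq_of_subset_of_forall_sdiff_eq_zero hM.measurableSet
      (s := M ∩ V) inter_subset_left fun x hx => hq0 x (hMV hx), ← h.image_eq,
      h.isInjImmersion.setIntegral_image hΩm subset_rfl, setIntegral_congr_fun hΩm hpt,
      setIntegral_eq_integral_of_forall_compl_eq_zero, hYz]
    intro u hu
    have : fderiv ℝ Y u = 0 := by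
      by_contra hne
      exact hu (hKΩ (hYts (support_fderiv_subset ℝ hne)))
    simp [this, tr]

/-- Every point has a neighbourhood in $M$ that lies in the image of a compact coordinate set, on
which the Jacobian is bounded. -/
theorem measure_lt_top_of_isCompact (hM : IsSubmanifold m M) (hc : IsCompact M) :
    μHE[m] M < ⊤ := by
  refine hc.measure_lt_top_of_nhdsWithin fun x hx => ?_
  obtain ⟨V, ψ, Ω, π, hxV, h⟩ := exists_isChart_of_isSubmanifold hM hx
  obtain ⟨hu, hux⟩ := h.right_inv ⟨hx, hxV⟩
  obtain ⟨C, hC, hCn, hCΩ⟩ := exists_compact_subset h.isOpen hu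
  refine ⟨M ∩ (V ∩ π ⁻¹' interior C), ?_, ?_⟩
  · exact inter_mem self_mem_nhdsWithin (mem_nhdsWithin_of_mem_nhds
      (inter_mem (h.isOpen_image.mem_nhds hxV)
        ((isOpen_interior.preimage π.continuous).mem_nhds hCn)))
  · have h1 : M ∩ (V ∩ π ⁻¹' interior C) ⊆ ψ '' C := fun y hy =>
      ⟨π y, interior_subset hy.2.2, (h.right_inv ⟨hy.1, hy.2.1⟩).2⟩
    refine (measure_mono h1).trans_lt ?_
    have h2 := (h.isInjImmersion.integrableOn_image_iff hC.measurableSet hCΩ fun _ => 1).2 (by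
      simp only [one_mul]
      exact (h.isInjImmersion.continuousOn_jac.mono hCΩ).integrableOn_compact hC)
    simpa using h2

/-- The divergence theorem for a field supported in a coordinate patch. -/
theorem integral_divergence_of_tsupport (hmn : m ≤ n) (hM : IsSubmanifold m M) (hc : IsCompact M)
    {H : Space n → Space n} (hH : ∀ x ∈ M, IsMeanCurvatureVector m M x (H x))
    (hHc : ContinuousOn H M) {x : Space n} (hx : x ∈ M) :
    ∃ V, IsOpen V ∧ x ∈ V ∧ ∀ X : Space n → Space n, ContDiff ℝ 1 X → tsupport X ⊆ V →
      IntegrableOn (fun x => tangentTrace (tangent M x) (fderiv ℝ X x)) M μHE[m] ∧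
      ∫ x in M, tangentTrace (tangent M x) (fderiv ℝ X x) ∂μHE[m] =
        ∫ x in M, inner ℝ (X x) (H x) ∂μHE[m] := by
  obtain ⟨U, ρ, hxU, hdef, ho, -⟩ := hH x hx
  obtain ⟨V, ψ, Ω, π, hxV, hVU, h⟩ :=
    exists_isChart hmn hdef ⟨hx, hxU⟩ (ho x ⟨hx, hxU⟩).linearIndependent
  refine ⟨V, h.isOpen_image, hxV, fun X hX hXV => ?_⟩
  set g := fun j => gradient (ρ j)
  have hg : ∀ j, ∀ y ∈ U, ContDiffAt ℝ 1 (g j) y := fun j y hy =>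
    contDiffAt_gradient ((hdef.contDiffAt hy j).of_le two_le_infty) (by norm_num)
  -- The field is split as $X=Z+N$. On the patch $N$ is the normal part, which produces $\langle
  -- X,\vec H\rangle$, and $Z$ is tangential, with integral of the divergence equal to zero. The
  -- frame is smooth only on `U`, but the support of $X$ lies in $V\subset U$.
  set N : Space n → Space n := fun y => ∑ j, inner ℝ (X y) (g j y) • g j y
  have hNs : tsupport N ⊆ tsupport X := by
    refine closure_mono fun y hy => ?_
    by_contra hne
    refine hy ?_
    have : X y = 0 := by simpa using hne
    simp [N, this]
  have hN : ContDiff ℝ 1 N := contDiff_of_tsupport fun y hy => by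
    have hyU := hVU (hXV (hNs hy))
    exact ContDiffAt.sum fun j _ => (hX.contDiffAt.inner ℝ (hg j y hyU)).smul (hg j y hyU)
  set Z : Space n → Space n := fun y => X y - N y
  have hZ : ContDiff ℝ 1 Z := hX.sub hN
  have hZs : tsupport Z ⊆ V := by
    refine (closure_minimal (fun y hy => ?_) (isClosed_tsupport X)).trans hXV
    by_contra hne
    have h1 : X y = 0 := image_eq_zero_of_notMem_tsupport hne
    have h2 : N y = 0 := image_eq_zero_of_notMem_tsupport fun h => hne (hNs h)
    exact hy (by simp [Z, h1, h2])
  have hNn : ∀ y ∈ M ∩ V, N y ∈ normal M y := fun y hy =>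
    Submodule.sum_mem _ fun j _ => Submodule.smul_mem _ _
      (gradient_mem_normal hM hdef ⟨hy.1, hVU hy.2⟩ j)
  have hNn' : ∀ y ∈ M, N y ∈ normal M y := by
    intro y hy
    by_cases hyV : y ∈ V
    · exact hNn y ⟨hy, hyV⟩
    · have : N y = 0 := image_eq_zero_of_notMem_tsupport fun h => hyV (hXV (hNs h))
      rw [this]; exact Submodule.zero_mem _
  have hZt : ∀ y ∈ M ∩ V, Z y ∈ tangent M y := by
    intro y hy
    have hyU : y ∈ M ∩ U := ⟨hy.1, hVU hy.2⟩
    have h1 : Z y ∈ (normal M y)ᗮ := by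
      rw [Submodule.mem_orthogonal']
      intro v hv
      rw [normal_eq_sum hM hdef hyU (ho y hyU) hv, inner_sum]
      refine Finset.sum_eq_zero fun j _ => ?_
      have h2 : inner ℝ (N y) (g j y) = inner ℝ (X y) (g j y) := by
        have := (ho y hyU).inner_left_fintype (fun j => inner ℝ (X y) (g j y)) j
        simp only [conj_trivial] at this
        exact this
      rw [real_inner_smul_right, inner_sub_left, h2, sub_self, mul_zero]
    rwa [normal, Submodule.orthogonal_orthogonal] at h1
  have hZt' : ∀ y ∈ M, Z y ∈ tangent M y := by
    intro y hy
    by_cases hyV : y ∈ V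
    · exact hZt y ⟨hy, hyV⟩
    · have : Z y = 0 := image_eq_zero_of_notMem_tsupport fun h => hyV (hZs h)
      rw [this]; exact Submodule.zero_mem _
  obtain ⟨hi, hz⟩ := h.integral_divergence hc hZ hZt hZs
  have hdec : ∀ y ∈ M, tangentTrace (tangent M y) (fderiv ℝ X y) =
      tangentTrace (tangent M y) (fderiv ℝ Z y) + inner ℝ (X y) (H y) := by
    intro y hy
    have hN' := (hN.differentiable (by norm_num) y).hasFDerivAt
    have hZ' := (hZ.differentiable (by norm_num) y).hasFDerivAt
    have h1 : HasFDerivAt X (fderiv ℝ Z y + fderiv ℝ N y) y :=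
      (hZ'.add hN').congr_of_eventuallyEq (Eventually.of_forall fun z => by simp [Z])
    have h2 := tangentTrace_of_normal hM hy (hH y hy) hN' (eventually_mem_nhdsWithin.mono hNn')
    have h3 : inner ℝ (Z y) (H y) = 0 :=
      Submodule.inner_right_of_mem_orthogonal (hZt' y hy)
        (IsMeanCurvatureVector.mem_normal hM hy (hH y hy))
    have h4 : inner ℝ (X y) (H y) = inner ℝ (N y) (H y) := by
      rw [inner_sub_left] at h3
      linarith
    rw [h1.fderiv, tangentTrace_add, h2, h4]
  have hfin := measure_lt_top_of_isCompact hM hc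
  have hi2 : IntegrableOn (fun y => inner ℝ (X y) (H y)) M μHE[m] :=
    (hX.continuous.continuousOn.inner hHc).integrableOn_of_subset_isCompact hc hc.measurableSet
      subset_rfl hfin.ne
  refine ⟨(hi.add hi2).congr_fun (fun y hy => (hdec y hy).symm) hc.measurableSet, ?_⟩
  rw [setIntegral_congr_fun hc.measurableSet hdec, integral_add hi hi2, hz, zero_add]

/-- The divergence theorem on a compact submanifold without boundary. -/
theorem integral_divergence (hmn : m ≤ n) (hM : IsSubmanifold m M) (hc : IsCompact M)
    {H : Space n → Space n} (hH : ∀ x ∈ M, IsMeanCurvatureVector m M x (H x))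
    (hHc : ContinuousOn H M) {X : Space n → Space n} (hX : ContDiff ℝ 1 X) :
    IntegrableOn (fun x => tangentTrace (tangent M x) (fderiv ℝ X x)) M μHE[m] ∧
    ∫ x in M, tangentTrace (tangent M x) (fderiv ℝ X x) ∂μHE[m] =
      ∫ x in M, inner ℝ (X x) (H x) ∂μHE[m] := by
  choose! V hVo hxV hV using fun x (hx : x ∈ M) =>
    integral_divergence_of_tsupport hmn hM hc hH hHc hx
  obtain ⟨T, hTM, hT⟩ := hc.elim_nhds_subcover V fun x hx => (hVo x hx).mem_nhds (hxV x hx)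
  have hTo : IsOpen (⋃ x ∈ T, V x) := isOpen_biUnion fun x hx => hVo x (hTM x hx)
  -- The partition of unity must sum to $1$ near $M$ and not only on it, because ambient derivatives
  -- of the pieces are added up.
  obtain ⟨δ, hδ, hδT⟩ := hc.exists_cthickening_subset_open hTo hT
  obtain ⟨f, hf⟩ := SmoothPartitionOfUnity.exists_isSubordinate
    (modelWithCornersSelf ℝ (Space n)) (Metric.isClosed_cthickening (δ := δ) (E := M))
    (fun x : T => V x) (fun x => hVo x (hTM x x.2)) (by rwa [iUnion_subtype])
  set Xk : T → Space n → Space n := fun k y => f k y • X y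
  have hXk : ∀ k, ContDiff ℝ 1 (Xk k) := fun k =>
    (((f k).contMDiff.contDiff).of_le (by norm_num)).smul hX
  have hXs : ∀ k : T, tsupport (Xk k) ⊆ V k := fun k =>
    (closure_mono (Function.support_smul_subset_left _ _)).trans (hf k)
  have hkey := fun k : T => hV k (hTM k k.2) (Xk k) (hXk k) (hXs k)
  have hsum : ∀ y ∈ Metric.cthickening δ M, X y = ∑ k, Xk k y := by
    intro y hy
    have := f.sum_eq_one hy
    rw [finsum_eq_sum_of_fintype] at this
    rw [← Finset.sum_smul, this, one_smul]
  have hdec : ∀ y ∈ M, tangentTrace (tangent M y) (fderiv ℝ X y) =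
      ∑ k, tangentTrace (tangent M y) (fderiv ℝ (Xk k) y) := by
    intro y hy
    rw [← tangentTrace_sum]
    congr 1
    have h1 : X =ᶠ[𝓝 y] fun y => ∑ k, Xk k y :=
      eventually_of_mem (mem_of_superset (Metric.isOpen_thickening.mem_nhds
        (Metric.self_subset_thickening hδ M hy)) (Metric.thickening_subset_cthickening δ M)) hsum
    rw [h1.fderiv_eq]
    exact fderiv_fun_sum fun k _ => (hXk k).differentiable (by norm_num) y
  have hdec2 : ∀ y ∈ M, inner ℝ (X y) (H y) = ∑ k, inner ℝ (Xk k y) (H y) := by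
    intro y hy
    conv_lhs => rw [hsum y (Metric.self_subset_cthickening M hy)]
    exact sum_inner _ _ _
  have hfin := measure_lt_top_of_isCompact hM hc
  constructor
  · have h1 : IntegrableOn (fun y => ∑ k, tangentTrace (tangent M y) (fderiv ℝ (Xk k) y)) M μHE[m] :=
      integrable_finsetSum _ fun k _ => (hkey k).1
    exact h1.congr_fun (fun y hy => (hdec y hy).symm) hc.measurableSet
  · rw [setIntegral_congr_fun hc.measurableSet hdec, setIntegral_congr_fun hc.measurableSet hdec2,
      integral_finsetSum _ fun k _ => (hkey k).1, integral_finsetSum]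
    · exact Finset.sum_congr rfl fun k _ => (hkey k).2
    · intro k _
      exact ((hXk k).continuous.continuousOn.inner hHc).integrableOn_of_subset_isCompact hc
        hc.measurableSet subset_rfl hfin.ne

end DivergenceTheorem

/-! ### The flow of a time-dependent vector field -/

section Flow

open Filter Topology
open scoped NNReal

variable {n : ℕ} {I : Set ℝ}

theorem interior_nonempty_of_ordConnected (hI : I.OrdConnected) (hI' : I.Nontrivial) :
    (interior I).Nonempty := by
  obtain ⟨a, ha, b, hb, hab⟩ := hI'.exists_lt
  have h : Ioo a b ⊆ interior I :=
    interior_maximal (Ioo_subset_Icc_self.trans (hI.out ha hb)) isOpen_Ioo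
  exact (nonempty_Ioo.2 hab).mono h

theorem uniqueDiffOn_of_ordConnected (hI : I.OrdConnected) (hI' : I.Nontrivial) :
    UniqueDiffOn ℝ I :=
  uniqueDiffOn_convex hI.convex (interior_nonempty_of_ordConnected hI hI')

theorem uniqueDiffOn_slab (hI : I.OrdConnected) (hI' : I.Nontrivial) :
    UniqueDiffOn ℝ (I ×ˢ (univ : Set (Space n))) :=
  (uniqueDiffOn_of_ordConnected hI hI').prod uniqueDiffOn_univ

/-- The spatial derivative of a function on `I × ℝⁿ`. -/
def spatialDeriv (I : Set ℝ) (G : ℝ → Space n → Space n) (t : ℝ) (x : Space n) :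
    Space n →L[ℝ] Space n :=
  (fderivWithin ℝ (fun q : ℝ × Space n => G q.1 q.2) (I ×ˢ univ) (t, x)).comp
    (ContinuousLinearMap.inr ℝ ℝ (Space n))

variable {G : ℝ → Space n → Space n}

theorem hasFDerivWithinAt_slab
    (hG : ContDiffOn ℝ ∞ (fun q : ℝ × Space n => G q.1 q.2) (I ×ˢ univ)) {t : ℝ} (ht : t ∈ I)
    (x : Space n) :
    HasFDerivWithinAt (fun q : ℝ × Space n => G q.1 q.2)
      (fderivWithin ℝ (fun q : ℝ × Space n => G q.1 q.2) (I ×ˢ univ) (t, x)) (I ×ˢ univ) (t, x) :=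
  (hG.differentiableOn (by simp) (t, x) ⟨ht, mem_univ x⟩).hasFDerivWithinAt

theorem hasFDerivAt_spatialDeriv
    (hG : ContDiffOn ℝ ∞ (fun q : ℝ × Space n => G q.1 q.2) (I ×ˢ univ)) {t : ℝ} (ht : t ∈ I)
    (x : Space n) : HasFDerivAt (G t) (spatialDeriv I G t x) x := by
  have h2 : HasFDerivAt (fun y : Space n => (t, y)) (ContinuousLinearMap.inr ℝ ℝ (Space n)) x :=
    hasFDerivAt_prodMk_right t x
  have := (hasFDerivWithinAt_slab hG ht x).comp x (h2.hasFDerivWithinAt (s := univ))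
    (fun y _ => ⟨ht, mem_univ y⟩)
  rwa [hasFDerivWithinAt_univ] at this

theorem contDiff_slice (hG : ContDiffOn ℝ ∞ (fun q : ℝ × Space n => G q.1 q.2) (I ×ˢ univ))
    {t : ℝ} (ht : t ∈ I) : ContDiff ℝ ∞ (G t) := by
  have h : ContDiff ℝ ∞ fun y : Space n => (t, y) := contDiff_prodMk_right t
  exact contDiffOn_univ.1 (hG.comp h.contDiffOn fun y _ => ⟨ht, mem_univ y⟩)

theorem continuousOn_spatialDeriv (hI : I.OrdConnected) (hI' : I.Nontrivial)
    (hG : ContDiffOn ℝ ∞ (fun q : ℝ × Space n => G q.1 q.2) (I ×ˢ univ)) :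
    ContinuousOn (fun q : ℝ × Space n => spatialDeriv I G q.1 q.2) (I ×ˢ univ) := by
  have h := hG.continuousOn_fderivWithin (uniqueDiffOn_slab hI hI') (by simp)
  exact h.clm_comp continuousOn_const

variable {X F : ℝ → Space n → Space n}

theorem IsFlow.fderivWithin_time (hF : IsFlow I X F) (hI : I.OrdConnected) (hI' : I.Nontrivial)
    {t : ℝ} (ht : t ∈ I) (x : Space n) :
    fderivWithin ℝ (fun q : ℝ × Space n => F q.1 q.2) (I ×ˢ univ) (t, x) (1, 0) = X t (F t x) := by
  have h2 : HasDerivWithinAt (fun s : ℝ => (s, x)) ((1 : ℝ), (0 : Space n)) I t :=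
    (hasDerivWithinAt_id t I).prodMk (hasDerivWithinAt_const t I x)
  have hmaps : MapsTo (fun s : ℝ => (s, x)) I (I ×ˢ univ) := fun s hs => ⟨hs, mem_univ x⟩
  have h3 := (hasFDerivWithinAt_slab hF.smooth ht x).comp_hasDerivWithinAt t h2 hmaps
  exact (uniqueDiffOn_of_ordConnected hI hI' t ht).eq_deriv _ h3 (hF.ode x t ht)

/-- The linearized equation along the flow. -/
theorem IsFlow.hasDerivWithinAt_spatialDeriv (hF : IsFlow I X F) (hI : I.OrdConnected)
    (hI' : I.Nontrivial)
    {t : ℝ} (ht : t ∈ I) (x : Space n) {X' : Space n →L[ℝ] Space n}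
    (hX : HasFDerivAt (X t) X' (F t x)) :
    HasDerivWithinAt (fun s => spatialDeriv I F s x) (X'.comp (spatialDeriv I F t x)) I t := by
  set S := I ×ˢ (univ : Set (Space n))
  set Fu := fun q : ℝ × Space n => F q.1 q.2
  set d1 := fderivWithin ℝ Fu S
  have hS : UniqueDiffOn ℝ S := uniqueDiffOn_slab hI hI'
  have hmem : (t, x) ∈ S := ⟨ht, mem_univ x⟩
  have hd1 : ContDiffOn ℝ 1 d1 S := hF.smooth.fderivWithin hS (by exact two_le_infty)
  set d2 := fderivWithin ℝ d1 S (t, x)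
  have hd2 : HasFDerivWithinAt d1 d2 S (t, x) :=
    (hd1.differentiableOn (by norm_num) _ hmem).hasFDerivWithinAt
  -- Every point of the interval is a limit of interior points, which gives the symmetry of second
  -- derivatives at end times as well.
  have hcl : (t, x) ∈ closure (interior S) := by
    rw [interior_prod_eq, interior_univ, closure_prod_eq, closure_univ]
    refine ⟨?_, mem_univ x⟩
    have hc := Convex.closure_interior_eq_closure_of_nonempty_interior (𝕜 := ℝ) hI.convex
      (interior_nonempty_of_ordConnected hI hI')
    exact hc ▸ subset_closure ht
  have hsymm : IsSymmSndFDerivWithinAt ℝ Fu S (t, x) :=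
    ((hF.smooth (t, x) hmem).of_le two_le_infty).isSymmSndFDerivWithinAt (by simp) hS hcl hmem
  have h2 : HasDerivWithinAt (fun s : ℝ => (s, x)) ((1 : ℝ), (0 : Space n)) I t :=
    (hasDerivWithinAt_id t I).prodMk (hasDerivWithinAt_const t I x)
  have hmaps : MapsTo (fun s : ℝ => (s, x)) I S := fun s hs => ⟨hs, mem_univ x⟩
  have h3 : HasDerivWithinAt (fun s => d1 (s, x)) (d2 (1, 0)) I t :=
    hd2.comp_hasDerivWithinAt t h2 hmaps
  have h4 : HasDerivWithinAt (fun s => spatialDeriv I F s x)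
      ((d2 (1, 0)).comp (ContinuousLinearMap.inr ℝ ℝ (Space n))) I t := by
    have := h3.clm_comp (hasDerivWithinAt_const t I (ContinuousLinearMap.inr ℝ ℝ (Space n)))
    exact this.congr_deriv (by simp)
  refine h4.congr_deriv ?_
  ext1 v
  -- The time derivative of the spatial derivative becomes the spatial derivative of the time
  -- derivative, and the latter is $X_t\circ F_t$.
  have e1 : d2 (1, 0) (0, v) = d2 (0, v) (1, 0) := hsymm.eq _ _
  have e2 : HasFDerivAt (fun y => d1 (t, y) (1, 0))
      ((d2.comp (ContinuousLinearMap.inr ℝ ℝ (Space n))).flip (1, 0)) x := by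
    have h5 : HasFDerivAt (fun y => d1 (t, y)) (d2.comp (ContinuousLinearMap.inr ℝ ℝ (Space n))) x := by
      have := hd2.comp x ((hasFDerivAt_prodMk_right t x).hasFDerivWithinAt (s := univ))
        (fun y _ => ⟨ht, mem_univ y⟩)
      rwa [hasFDerivWithinAt_univ] at this
    have := h5.clm_apply (hasFDerivAt_const ((1 : ℝ), (0 : Space n)) x)
    simpa using this
  have e3 : (fun y => d1 (t, y) (1, 0)) = fun y => X t (F t y) :=
    funext fun y => hF.fderivWithin_time hI hI' ht y
  rw [e3] at e2
  have e4 := e2.unique (hX.comp x (hasFDerivAt_spatialDeriv hF.smooth ht x))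
  have e5 := DFunLike.congr_fun e4 v
  simp only [ContinuousLinearMap.comp_apply, ContinuousLinearMap.inr_apply] at e5 ⊢
  rw [e1, ← e5]
  rfl

/-- The flow map is bounded below on bounded sets. -/
theorem IsFlow.exists_dist_le (hF : IsFlow I X F) (hI : I.OrdConnected) (hI' : I.Nontrivial)
    (h0 : (0 : ℝ) ∈ I)
    (hX : ContDiffOn ℝ ∞ (fun q : ℝ × Space n => X q.1 q.2) (I ×ˢ univ))
    {t : ℝ} (ht : t ∈ I) (r : ℝ) :
    ∃ C : ℝ, 0 < C ∧ ∀ x ∈ Metric.closedBall (0 : Space n) r,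
      ∀ y ∈ Metric.closedBall (0 : Space n) r, dist x y ≤ C * dist (F t x) (F t y) := by
  have hJ : uIcc 0 t ⊆ I := hI.uIcc_subset h0 ht
  have hτ : ∀ s ∈ Icc (0 : ℝ) 1, t * (1 - s) ∈ uIcc 0 t := by
    intro s hs
    rcases le_total 0 t with h | h
    · rw [uIcc_of_le h]
      exact ⟨by nlinarith [hs.1, hs.2], by nlinarith [hs.1, hs.2]⟩
    · rw [uIcc_of_ge h]
      exact ⟨by nlinarith [hs.1, hs.2], by nlinarith [hs.1, hs.2]⟩
  have hcF : ContinuousOn (fun q : ℝ × Space n => F q.1 q.2)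
      (uIcc 0 t ×ˢ Metric.closedBall 0 r) :=
    hF.smooth.continuousOn.mono (prod_mono hJ (subset_univ _))
  -- The field is only locally Lipschitz: its Lipschitz constant is taken on a ball containing all
  -- trajectories from the given ball up to time `t`.
  obtain ⟨R, hR⟩ := ((isCompact_uIcc.prod (isCompact_closedBall (0 : Space n) r)).image_of_continuousOn
    hcF).isBounded.subset_closedBall 0
  have hcX : ContinuousOn (fun q : ℝ × Space n => spatialDeriv I X q.1 q.2)
      (uIcc 0 t ×ˢ Metric.closedBall 0 R) :=
    (continuousOn_spatialDeriv hI hI' hX).mono (prod_mono hJ (subset_univ _))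
  obtain ⟨K, hK⟩ := (isCompact_uIcc.prod (isCompact_closedBall (0 : Space n) R)).exists_bound_of_continuousOn
    hcX
  set L : ℝ≥0 := (|t| * |K|).toNNReal
  have hL : (L : ℝ) = |t| * |K| := Real.coe_toNNReal _ (by positivity)
  set v : ℝ → Space n → Space n := fun s y => (-t) • X (t * (1 - s)) y
  have hv : ∀ s ∈ Ico (0 : ℝ) 1, LipschitzOnWith L (v s) (Metric.closedBall 0 R) := by
    intro s hs
    have hs' := hτ s ⟨hs.1, hs.2.le⟩
    refine (convex_closedBall (0 : Space n) R).lipschitzOnWith_of_nnnorm_hasFDerivWithin_le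
      (f' := fun y => (-t) • spatialDeriv I X (t * (1 - s)) y)
      (fun y _ => ((hasFDerivAt_spatialDeriv hX (hJ hs') y).const_smul (-t)).hasFDerivWithinAt)
      fun y hy => ?_
    rw [← NNReal.coe_le_coe, coe_nnnorm, hL, norm_smul, norm_neg, Real.norm_eq_abs]
    gcongr
    exact (hK (t * (1 - s), y) ⟨hs', hy⟩).trans (le_abs_self K)
  -- The trajectory is run backwards on $[0,1]$, from $F_t(x)$ to $x$; Grönwall's inequality for the
  -- reversed equation bounds the distance of initial points by that of end points.
  set p : Space n → ℝ → Space n := fun x s => F (t * (1 - s)) x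
  have hpd : ∀ x, ∀ s ∈ Icc (0 : ℝ) 1, HasDerivWithinAt (p x) (v s (p x s)) (Icc 0 1) s := by
    intro x s hs
    have h1 : HasDerivWithinAt (fun s : ℝ => t * (1 - s)) (-t) (Icc 0 1) s := by
      have := (((hasDerivAt_id s).const_sub 1).const_mul t).hasDerivWithinAt (s := Icc 0 1)
      simpa using this
    exact (hF.ode x (t * (1 - s)) (hJ (hτ s hs))).scomp s h1 fun s hs => hJ (hτ s hs)
  have hpc : ∀ x, ContinuousOn (p x) (Icc 0 1) := fun x s hs => (hpd x s hs).continuousWithinAt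
  have hpd' : ∀ x, ∀ s ∈ Ico (0 : ℝ) 1, HasDerivWithinAt (p x) (v s (p x s)) (Ici s) s :=
    fun x s hs => (hpd x s ⟨hs.1, hs.2.le⟩).mono_of_mem_nhdsWithin (Icc_mem_nhdsGE_of_mem hs)
  have hpm : ∀ x ∈ Metric.closedBall (0 : Space n) r, ∀ s ∈ Ico (0 : ℝ) 1,
      p x s ∈ Metric.closedBall (0 : Space n) R := fun x hx s hs =>
    hR ⟨(t * (1 - s), x), ⟨hτ s ⟨hs.1, hs.2.le⟩, hx⟩, rfl⟩
  refine ⟨Real.exp L, Real.exp_pos _, fun x hx y hy => ?_⟩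
  have h := dist_le_of_trajectories_ODE_of_mem hv (hpc x) (hpd' x) (hpm x hx) (hpc y) (hpd' y)
    (hpm y hy) le_rfl 1 (by simp)
  simp only [p, sub_self, mul_zero, sub_zero, mul_one, hF.initial] at h
  rw [mul_comm]
  exact h

theorem IsFlow.injective (hF : IsFlow I X F) (hI : I.OrdConnected) (hI' : I.Nontrivial)
    (h0 : (0 : ℝ) ∈ I)
    (hX : ContDiffOn ℝ ∞ (fun q : ℝ × Space n => X q.1 q.2) (I ×ˢ univ))
    {t : ℝ} (ht : t ∈ I) : Function.Injective (F t) := by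
  intro x y hxy
  obtain ⟨C, -, hC⟩ := hF.exists_dist_le hI hI' h0 hX ht (max ‖x‖ ‖y‖)
  have := hC x (by simp) y (by simp)
  rw [hxy, dist_self, mul_zero] at this
  exact dist_le_zero.1 this

/-- A kernel vector would give a displacement of order $o(s)$ at time `t`, against the linear lower
bound of `IsFlow.exists_dist_le`. -/
theorem IsFlow.injective_spatialDeriv (hF : IsFlow I X F) (hI : I.OrdConnected)
    (hI' : I.Nontrivial) (h0 : (0 : ℝ) ∈ I)
    (hX : ContDiffOn ℝ ∞ (fun q : ℝ × Space n => X q.1 q.2) (I ×ˢ univ))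
    {t : ℝ} (ht : t ∈ I) (x : Space n) : Function.Injective (spatialDeriv I F t x) := by
  refine (injective_iff_map_eq_zero _).2 fun v hv => ?_
  obtain ⟨C, hC0, hC⟩ := hF.exists_dist_le hI hI' h0 hX ht (‖x‖ + 1)
  have hd : HasDerivAt (fun s : ℝ => F t (x + s • v)) 0 0 := by
    have h1 : HasDerivAt (fun s : ℝ => x + s • v) v 0 := by
      simpa using ((hasDerivAt_id (0 : ℝ)).smul_const v).const_add x
    have := (hasFDerivAt_spatialDeriv hF.smooth ht x).comp_hasDerivAt_of_eq (0 : ℝ) h1 (by simp)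
    rwa [hv] at this
  by_contra hne
  have hvpos : 0 < ‖v‖ := norm_pos_iff.2 hne
  -- With this constant the two bounds combine to $|s||v|\le|s||v|/2$.
  have hc : (0 : ℝ) < (2 * C)⁻¹ * ‖v‖ := by positivity
  have hlo := (hasDerivAt_iff_isLittleO.1 hd).def hc
  have h2 : ∀ᶠ s : ℝ in 𝓝 0, ‖x + s • v‖ < ‖x‖ + 1 := by
    have hcont : ContinuousAt (fun s : ℝ => ‖x + s • v‖) 0 := by fun_prop
    exact hcont.eventually_lt_const (by simp)
  obtain ⟨s, ⟨hs1, hs2⟩, hs0⟩ :=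
    (((hlo.and h2).filter_mono nhdsWithin_le_nhds).and
      (self_mem_nhdsWithin (s := ({0}ᶜ : Set ℝ)) (a := 0))).exists
  have hs : 0 < |s| := abs_pos.2 hs0
  have h3 := hC (x + s • v) (by simpa using hs2.le) x (by simp)
  simp only [zero_smul, add_zero, sub_zero, smul_zero, Real.norm_eq_abs] at hs1
  rw [dist_eq_norm, dist_eq_norm, add_sub_cancel_left, norm_smul, Real.norm_eq_abs] at h3
  have h4 : |s| * ‖v‖ ≤ C * ((2 * C)⁻¹ * ‖v‖ * |s|) :=
    h3.trans (mul_le_mul_of_nonneg_left hs1 hC0.le)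
  have h5 : C * ((2 * C)⁻¹ * ‖v‖ * |s|) = |s| * ‖v‖ / 2 := by field_simp
  have h6 : 0 < |s| * ‖v‖ := by positivity
  linarith

end Flow

/-! ### The first variation of the volume along the flow -/

section Variation

open Filter Topology
open scoped NNReal

/-- Differentiation under the integral sign. -/
theorem hasDerivWithinAt_integral_of_bounded {α : Type*} [MeasurableSpace α] {μ : Measure α}
    [IsFiniteMeasure μ] {h h' : ℝ → α → ℝ} {J : Set ℝ} (hJ : Convex ℝ J) {t₀ : ℝ} (ht₀ : t₀ ∈ J)
    (hint : ∀ t ∈ J, Integrable (h t) μ) {K : ℝ}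
    (hd : ∀ᵐ u ∂μ, ∀ t ∈ J, HasDerivWithinAt (fun s => h s u) (h' t u) J t)
    (hK : ∀ᵐ u ∂μ, ∀ t ∈ J, ‖h' t u‖ ≤ K) :
    HasDerivWithinAt (fun t => ∫ u, h t u ∂μ) (∫ u, h' t₀ u ∂μ) J t₀ := by
  rw [hasDerivWithinAt_iff_tendsto_slope]
  have hmem : ∀ᶠ t in 𝓝[J \ {t₀}] t₀, t ∈ J \ {t₀} := self_mem_nhdsWithin
  have heq : ∀ᶠ t in 𝓝[J \ {t₀}] t₀,
      ∫ u, slope (fun s => h s u) t₀ t ∂μ = slope (fun s => ∫ u, h s u ∂μ) t₀ t := by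
    filter_upwards [hmem] with t ht
    simp only [slope, vsub_eq_sub, smul_eq_mul]
    rw [integral_const_mul, integral_sub (hint t ht.1) (hint t₀ ht₀)]
  refine Tendsto.congr' heq ?_
  refine tendsto_integral_filter_of_dominated_convergence (fun _ => K) ?_ ?_
    (integrable_const K) ?_
  · filter_upwards [hmem] with t ht
    simp only [slope, vsub_eq_sub, smul_eq_mul]
    exact (((hint t ht.1).sub (hint t₀ ht₀)).const_mul _).aestronglyMeasurable
  · filter_upwards [hmem] with t ht
    filter_upwards [hd, hK] with u hu hKu
    -- The mean value inequality bounds the difference quotients by the same `K`, which serves as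
    -- dominating function.
    have := hJ.norm_image_sub_le_of_norm_hasDerivWithin_le hu hKu ht₀ ht.1
    have hpos : 0 < ‖t - t₀‖ := norm_pos_iff.2 (sub_ne_zero.2 ht.2)
    simp only [slope, vsub_eq_sub, smul_eq_mul, norm_mul, norm_inv]
    rw [inv_mul_le_iff₀ hpos, mul_comm]
    exact this
  · filter_upwards [hd] with u hu
    exact hasDerivWithinAt_iff_tendsto_slope.1 (hu t₀ ht₀)

/-- Localizes in time to a compact interval, also at an end point of `I`, so that compactness
supplies uniform bounds. -/
theorem exists_Icc_mem_nhdsWithin {I : Set ℝ} (hI : I.OrdConnected) {t : ℝ} (ht : t ∈ I) :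
    ∃ a b, t ∈ Icc a b ∧ Icc a b ⊆ I ∧ Icc a b ∈ 𝓝[I] t := by
  have h1 : ∃ a ∈ I, a ≤ t ∧ ∀ᶠ s in 𝓝[I] t, a ≤ s := by
    by_cases h : ∃ c ∈ I, c < t
    · obtain ⟨c, hc, hct⟩ := h
      exact ⟨c, hc, hct.le, mem_nhdsWithin_of_mem_nhds (Ici_mem_nhds hct)⟩
    · push Not at h
      exact ⟨t, ht, le_rfl, eventually_of_mem self_mem_nhdsWithin h⟩
  have h2 : ∃ b ∈ I, t ≤ b ∧ ∀ᶠ s in 𝓝[I] t, s ≤ b := by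
    by_cases h : ∃ c ∈ I, t < c
    · obtain ⟨c, hc, hct⟩ := h
      exact ⟨c, hc, hct.le, mem_nhdsWithin_of_mem_nhds (Iic_mem_nhds hct)⟩
    · push Not at h
      exact ⟨t, ht, le_rfl, eventually_of_mem self_mem_nhdsWithin h⟩
  obtain ⟨a, ha, hat, ha'⟩ := h1
  obtain ⟨b, hb, hbt, hb'⟩ := h2
  exact ⟨a, b, ⟨hat, hbt⟩, hI.out ha hb, ha'.and hb'⟩

variable {m n : ℕ}

/-- The derivative maps one tangent cone into the other; injectivity and equal dimensions give
equality of the spans. -/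
theorem map_tangent_eq {M : Set (Space n)} {x : Space n} {G : Space n → Space n}
    {D : Space n →L[ℝ] Space n} (hG : HasFDerivAt G D x) (hD : Function.Injective D)
    (hr : Module.finrank ℝ (tangent (G '' M) (G x)) = Module.finrank ℝ (tangent M x)) :
    (tangent M x).map (D : Space n →ₗ[ℝ] Space n) = tangent (G '' M) (G x) := by
  refine Submodule.eq_of_le_of_finrank_eq ?_ ?_
  · rw [tangent, Submodule.map_span, Submodule.span_le]
    rintro _ ⟨v, hv, rfl⟩
    exact Submodule.subset_span (hG.hasFDerivWithinAt.mapsTo_tangent_cone hv)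
  · rw [hr]
    exact (Submodule.equivMapOfInjective (D : Space n →ₗ[ℝ] Space n) hD (tangent M x)).finrank_eq.symm

variable {I : Set ℝ} {M : ℝ → Set (Space n)} {H F : ℝ → Space n → Space n}
  {V : Set (Space n)} {ψ : Space m → Space n} {Ω : Set (Space m)} {π : Space n →L[ℝ] Space m}

/-- The differential at `u` of the parametrization `F_t ∘ ψ` of `M_t`. -/
def flowDeriv (I : Set ℝ) (F : ℝ → Space n → Space n) (ψ : Space m → Space n) (t : ℝ)
    (u : Space m) : Space m →L[ℝ] Space n :=
  (spatialDeriv I F t (ψ u)).comp (fderiv ℝ ψ u)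

theorem IsFlow.hasFDerivAt_comp_chart {X : ℝ → Space n → Space n} (hF : IsFlow I X F)
    {M₀ : Set (Space n)} (h : IsChart M₀ V ψ Ω π) {t : ℝ} (ht : t ∈ I) {u : Space m} (hu : u ∈ Ω) :
    HasFDerivAt (F t ∘ ψ) (flowDeriv I F ψ t u) u :=
  (hasFDerivAt_spatialDeriv hF.smooth ht (ψ u)).comp u (h.hasFDerivAt hu)

theorem IsFlow.injective_flowDeriv (hI : I.OrdConnected) (hI' : I.Nontrivial) (h0 : (0 : ℝ) ∈ I)
    {X : ℝ → Space n → Space n} (hF : IsFlow I X F)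
    (hX : ContDiffOn ℝ ∞ (fun q : ℝ × Space n => X q.1 q.2) (I ×ˢ univ))
    {M₀ : Set (Space n)} (h : IsChart M₀ V ψ Ω π) {t : ℝ} (ht : t ∈ I) {u : Space m} (hu : u ∈ Ω) :
    Function.Injective (flowDeriv I F ψ t u) :=
  (hF.injective_spatialDeriv hI hI' h0 hX ht (ψ u)).comp (h.injective hu)

theorem IsFlow.isInjImmersion (hI : I.OrdConnected) (hI' : I.Nontrivial) (h0 : (0 : ℝ) ∈ I)
    {X : ℝ → Space n → Space n} (hF : IsFlow I X F)
    (hX : ContDiffOn ℝ ∞ (fun q : ℝ × Space n => X q.1 q.2) (I ×ˢ univ))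
    {M₀ : Set (Space n)} (h : IsChart M₀ V ψ Ω π) {t : ℝ} (ht : t ∈ I) :
    IsInjImmersion (F t ∘ ψ) Ω where
  isOpen := h.isOpen
  contDiffAt u hu := ((contDiff_slice hF.smooth ht).contDiffAt.of_le (by norm_num)).comp u
    ((h.contDiffAt u hu).of_le (by norm_num))
  injOn := (hF.injective hI hI' h0 hX ht).comp_injOn h.injOn
  injective u hu := by
    rw [(hF.hasFDerivAt_comp_chart h ht hu).fderiv]
    exact hF.injective_flowDeriv hI hI' h0 hX h ht hu

theorem IsFlow.continuousOn_flowDeriv (hI : I.OrdConnected) (hI' : I.Nontrivial)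
    {X : ℝ → Space n → Space n} (hF : IsFlow I X F) {M₀ : Set (Space n)}
    (h : IsChart M₀ V ψ Ω π) :
    ContinuousOn (fun q : ℝ × Space m => flowDeriv I F ψ q.1 q.2) (I ×ˢ Ω) := by
  have hψ : ContinuousOn (fun q : ℝ × Space m => ψ q.2) (I ×ˢ Ω) :=
    h.isInjImmersion.continuousOn.comp continuousOn_snd fun q hq => hq.2
  have hψ' : ContinuousOn (fun q : ℝ × Space m => fderiv ℝ ψ q.2) (I ×ˢ Ω) := by
    have h1 : ContinuousOn (fderiv ℝ ψ) Ω := fun u hu =>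
      ((h.contDiffAt u hu).fderiv_right (m := 0) (by norm_num)).continuousAt.continuousWithinAt
    exact h1.comp continuousOn_snd fun q hq => hq.2
  have h2 : ContinuousOn (fun q : ℝ × Space m => spatialDeriv I F q.1 (ψ q.2)) (I ×ˢ Ω) :=
    (continuousOn_spatialDeriv hI hI' hF.smooth).comp (continuousOn_fst.prodMk hψ)
      fun q hq => ⟨hq.1, mem_univ _⟩
  exact h2.clm_comp hψ'

/-- The rate of change of `ρ dS` along the flow of `-H`, with respect to `dS`. -/
def variationRate (ρ : Space n → ℝ) (H : ℝ → Space n → Space n) (t : ℝ) (y : Space n) : ℝ :=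
  -(inner ℝ (gradient ρ y) (H t y) + ρ y * ‖H t y‖ ^ 2)

theorem continuousOn_variationRate {ρ : Space n → ℝ} (hρ : ContDiff ℝ 2 ρ)
    (hH : ContDiffOn ℝ ∞ (fun q : ℝ × Space n => H q.1 q.2) (I ×ˢ univ)) :
    ContinuousOn (fun q : ℝ × Space n => variationRate ρ H q.1 q.2) (I ×ˢ univ) := by
  have h1 : Continuous (gradient ρ) := continuous_iff_continuousAt.2 fun x =>
    (contDiffAt_gradient (l := 1) hρ.contDiffAt (by norm_num)).continuousAt
  have h2 : ContinuousOn (fun q : ℝ × Space n => gradient ρ q.2) (I ×ˢ univ) :=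
    (h1.comp continuous_snd).continuousOn
  have h3 : ContinuousOn (fun q : ℝ × Space n => ρ q.2) (I ×ˢ univ) :=
    (hρ.continuous.comp continuous_snd).continuousOn
  exact ((h2.inner hH.continuousOn).add (h3.mul (hH.continuousOn.norm.pow 2))).neg

/-- The factor $\rho$ changes at the rate $-\langle\nabla\rho,\vec H\rangle$. The relative rate of
the Jacobian is the trace over $TM_t$ of $-D\vec H$, which is $-|\vec H|^2$ because $-\vec H$ is a
normal field. -/
theorem IsMeanCurvatureFlow.hasDerivWithinAt_density (hI : I.OrdConnected) (hI' : I.Nontrivial)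
    (h0 : (0 : ℝ) ∈ I) (hflow : IsMeanCurvatureFlow m I M H)
    (hF : IsFlow I (fun t x => -H t x) F) (hFM : ∀ t ∈ I, F t '' M 0 = M t)
    {ρ : Space n → ℝ} (hρ : ContDiff ℝ 2 ρ) (h : IsChart (M 0) V ψ Ω π)
    {t : ℝ} (ht : t ∈ I) {u : Space m} (hu : u ∈ Ω) :
    HasDerivWithinAt (fun s => ρ (F s (ψ u)) * jac (flowDeriv I F ψ s u))
      (variationRate ρ H t (F t (ψ u)) * jac (flowDeriv I F ψ t u)) I t := by
  set x := F t (ψ u)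
  have hx : x ∈ M t := hFM t ht ▸ mem_image_of_mem _ (h.mem hu).1
  set B := flowDeriv I F ψ t u
  have hB : Function.Injective B := hF.injective_flowDeriv hI hI' h0 hflow.smooth.neg h ht hu
  have hH : HasFDerivAt (fun y => -H t y) (-spatialDeriv I H t x) x :=
    (hasFDerivAt_spatialDeriv hflow.smooth ht x).neg
  obtain ⟨P, hP⟩ := exists_isPseudoInverse B hB
  have hrange : LinearMap.range (B : Space m →ₗ[ℝ] Space n) = tangent (M t) x := by
    have h1 := map_tangent_eq (M := M 0) (hasFDerivAt_spatialDeriv hF.smooth ht (ψ u))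
      (hF.injective_spatialDeriv hI hI' h0 hflow.smooth.neg ht (ψ u)) (by
        rw [hFM t ht, finrank_tangent (hflow.submanifold t ht) hx,
          finrank_tangent (hflow.submanifold 0 h0) (h.mem hu).1])
    rw [hFM t ht, h.tangent_eq hu] at h1
    rw [← h1, ← LinearMap.range_comp]
    rfl
  have htr : tangentTrace (tangent (M t) x) (-spatialDeriv I H t x) = -‖H t x‖ ^ 2 := by
    rw [tangentTrace_of_normal (hflow.submanifold t ht) hx (hflow.meanCurvature t ht x hx) hH,
      inner_neg_left, real_inner_self_eq_norm_sq]
    filter_upwards [self_mem_nhdsWithin] with y hy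
    exact Submodule.neg_mem _
      ((hflow.meanCurvature t ht y hy).mem_normal (hflow.submanifold t ht) hy)
  have hB' : HasDerivWithinAt (fun s => flowDeriv I F ψ s u)
      ((-spatialDeriv I H t x).comp B) I t := by
    have := (hF.hasDerivWithinAt_spatialDeriv hI hI' ht (ψ u) hH).clm_comp
      (hasDerivWithinAt_const t I (fderiv ℝ ψ u))
    exact this.congr_deriv (by simp [B, flowDeriv, ContinuousLinearMap.comp_assoc])
  have hjac : HasDerivWithinAt (fun s => jac (flowDeriv I F ψ s u)) (jac B * -‖H t x‖ ^ 2) I t := by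
    refine ((hasFDerivAt_jac hB).comp_hasDerivWithinAt t hB').congr_deriv ?_
    rw [fderiv_jac hB hP, tr_comp_eq_tangentTrace hB hP, hrange, htr]
  have hρ' : HasDerivWithinAt (fun s => ρ (F s (ψ u))) (fderiv ℝ ρ x (-H t x)) I t :=
    ((hρ.differentiable (by norm_num)) x).hasFDerivAt.comp_hasDerivWithinAt t (hF.ode (ψ u) t ht)
  refine (hρ'.mul hjac).congr_deriv ?_
  rw [variationRate, inner_gradient, map_neg]
  ring

end Variation

/-! ### Assembling the first variation formula -/

section FirstVariation

open Filter Topology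

variable {m n : ℕ} {I : Set ℝ} {M : ℝ → Set (Space n)} {H F : ℝ → Space n → Space n}
  {V : Set (Space n)} {ψ : Space m → Space n} {Ω : Set (Space m)} {π : Space n →L[ℝ] Space m}
  {ρ : Space n → ℝ}

theorem integrableOn_of_continuousOn {M : Set (Space n)} (hM : IsSubmanifold m M)
    (hc : IsCompact M) {f : Space n → ℝ} (hf : ContinuousOn f M) : IntegrableOn f M μHE[m] := by
  obtain ⟨K, hK⟩ := hc.exists_bound_of_continuousOn hf
  exact IntegrableOn.of_bound (measure_lt_top_of_isCompact hM hc)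
    (hf.aestronglyMeasurable hc.measurableSet) K
    ((ae_restrict_iff' hc.measurableSet).2 (ae_of_all _ hK))

theorem continuous_variationRate (hρ : ContDiff ℝ 2 ρ)
    (hH : ContDiffOn ℝ ∞ (fun q : ℝ × Space n => H q.1 q.2) (I ×ˢ univ)) {t : ℝ} (ht : t ∈ I) :
    Continuous (variationRate ρ H t) := by
  have hmaps : MapsTo (fun y : Space n => (t, y)) univ (I ×ˢ univ) := fun y _ => ⟨ht, mem_univ y⟩
  have hc : Continuous fun y : Space n => (t, y) := by fun_prop
  have h := (continuousOn_variationRate hρ hH).comp hc.continuousOn hmaps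
  exact (continuousOn_univ.1 h).congr fun y => by simp only [Function.comp_apply]

/-- The first variation formula holds for the part of `M_t` flowing out of `B ⊆ M₀`. -/
def HasFirstVariation (m : ℕ) (I : Set ℝ) (H F : ℝ → Space n → Space n) (ρ : Space n → ℝ)
    (B : Set (Space n)) : Prop :=
  ∀ t ∈ I, MeasurableSet (F t '' B) ∧
    HasDerivWithinAt (fun s => ∫ y in F s '' B, ρ y ∂μHE[m])
      (∫ y in F t '' B, variationRate ρ H t y ∂μHE[m]) I t

/-- Pulled back by $F_t\circ\psi$, the domain of integration no longer moves. On a compact time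
interval times `C` the rate is bounded, and one may differentiate under the integral. -/
theorem IsMeanCurvatureFlow.hasFirstVariation_chart (hI : I.OrdConnected) (hI' : I.Nontrivial)
    (h0 : (0 : ℝ) ∈ I) (hflow : IsMeanCurvatureFlow m I M H)
    (hF : IsFlow I (fun t x => -H t x) F) (hFM : ∀ t ∈ I, F t '' M 0 = M t)
    (hρ : ContDiff ℝ 2 ρ) (h : IsChart (M 0) V ψ Ω π) {C s : Set (Space m)} (hC : IsCompact C)
    (hCΩ : C ⊆ Ω) (hs : MeasurableSet s) (hsC : s ⊆ C) :
    HasFirstVariation m I H F ρ (ψ '' s) := by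
  intro t ht
  have himm : ∀ r ∈ I, IsInjImmersion (F r ∘ ψ) Ω := fun r hr =>
    hF.isInjImmersion hI hI' h0 hflow.smooth.neg h hr
  have hsΩ := hsC.trans hCΩ
  have hint : ∀ r ∈ I, ∀ f : Space n → ℝ, ∫ y in F r '' (ψ '' s), f y ∂μHE[m] =
      ∫ u in s, f (F r (ψ u)) * jac (flowDeriv I F ψ r u) := by
    intro r hr f
    rw [← image_comp, (himm r hr).setIntegral_image hs hsΩ]
    refine setIntegral_congr_fun hs fun u hu => ?_
    simp only [(hF.hasFDerivAt_comp_chart h hr (hsΩ hu)).fderiv, Function.comp_apply]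
  refine ⟨by rw [← image_comp]; exact (himm t ht).measurableSet_image hs hsΩ, ?_⟩
  obtain ⟨a, b, htJ, hJI, hJn⟩ := exists_Icc_mem_nhdsWithin hI ht
  have hjac : ContinuousOn (fun q : ℝ × Space m => jac (flowDeriv I F ψ q.1 q.2)) (I ×ˢ Ω) :=
    continuous_jac.comp_continuousOn (hF.continuousOn_flowDeriv hI hI' h)
  have hFψ : ContinuousOn (fun q : ℝ × Space m => F q.1 (ψ q.2)) (I ×ˢ Ω) :=
    hF.smooth.continuousOn.comp (continuousOn_fst.prodMk
      (h.isInjImmersion.continuousOn.comp continuousOn_snd fun q hq => hq.2))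
      fun q hq => ⟨hq.1, mem_univ _⟩
  have hrate : ContinuousOn (fun q : ℝ × Space m => variationRate ρ H q.1 (F q.1 (ψ q.2)) *
      jac (flowDeriv I F ψ q.1 q.2)) (I ×ˢ Ω) :=
    ((continuousOn_variationRate hρ hflow.smooth).comp (continuousOn_fst.prodMk hFψ)
      fun q hq => ⟨hq.1, mem_univ _⟩).mul hjac
  have hdens : ContinuousOn (fun q : ℝ × Space m => ρ (F q.1 (ψ q.2)) *
      jac (flowDeriv I F ψ q.1 q.2)) (I ×ˢ Ω) :=
    (hρ.continuous.comp_continuousOn hFψ).mul hjac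
  obtain ⟨K, hK⟩ := (isCompact_Icc.prod hC).exists_bound_of_continuousOn
    (hrate.mono (prod_mono hJI hCΩ))
  have : IsFiniteMeasure (volume.restrict s) :=
    isFiniteMeasure_restrict.2 ((measure_mono hsC).trans_lt hC.measure_lt_top).ne
  have key := hasDerivWithinAt_integral_of_bounded (μ := volume.restrict s) (convex_Icc a b) htJ
    (h := fun r u => ρ (F r (ψ u)) * jac (flowDeriv I F ψ r u))
    (h' := fun r u => variationRate ρ H r (F r (ψ u)) * jac (flowDeriv I F ψ r u)) (K := K)
    (fun r hr => by
      have hc : ContinuousOn (fun u => ρ (F r (ψ u)) * jac (flowDeriv I F ψ r u)) C :=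
        hdens.comp (continuousOn_const.prodMk continuousOn_id) fun u hu => ⟨hJI hr, hCΩ hu⟩
      exact (hc.integrableOn_compact hC).mono_set hsC)
    ((ae_restrict_iff' hs).2 (ae_of_all _ fun u hu r hr =>
      (hflow.hasDerivWithinAt_density hI hI' h0 hF hFM hρ h (hJI hr) (hsΩ hu)).mono hJI))
    ((ae_restrict_iff' hs).2 (ae_of_all _ fun u hu r hr => hK (r, u) ⟨hr, hsC hu⟩))
  rw [hint t ht]
  exact (key.mono_of_mem_nhdsWithin hJn).congr (fun r hr => hint r hr ρ) (hint t ht ρ)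

theorem IsMeanCurvatureFlow.hasFirstVariation_union (hI : I.OrdConnected) (hI' : I.Nontrivial)
    (h0 : (0 : ℝ) ∈ I) (hflow : IsMeanCurvatureFlow m I M H)
    (hF : IsFlow I (fun t x => -H t x) F) (hFM : ∀ t ∈ I, F t '' M 0 = M t)
    (hc : ∀ t ∈ I, IsCompact (M t)) (hρ : ContDiff ℝ 2 ρ) {A B : Set (Space n)}
    (hA : HasFirstVariation m I H F ρ A) (hB : HasFirstVariation m I H F ρ B)
    (hAM : A ⊆ M 0) (hBM : B ⊆ M 0) (hAB : Disjoint A B) :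
    HasFirstVariation m I H F ρ (A ∪ B) := by
  have hint : ∀ t ∈ I, ∀ f : Space n → ℝ, ContinuousOn f (M t) →
      ∫ y in F t '' (A ∪ B), f y ∂μHE[m] =
        ∫ y in F t '' A, f y ∂μHE[m] + ∫ y in F t '' B, f y ∂μHE[m] := by
    intro t ht f hf
    have hi := integrableOn_of_continuousOn (hflow.submanifold t ht) (hc t ht) hf
    rw [image_union]
    exact setIntegral_union
      ((disjoint_image_iff (hF.injective hI hI' h0 hflow.smooth.neg ht)).2 hAB) (hB t ht).1
      (hi.mono_set (by rw [← hFM t ht]; exact image_mono hAM))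
      (hi.mono_set (by rw [← hFM t ht]; exact image_mono hBM))
  intro t ht
  refine ⟨by rw [image_union]; exact (hA t ht).1.union (hB t ht).1, ?_⟩
  have hcont : ContinuousOn (variationRate ρ H t) (M t) :=
    (continuous_variationRate hρ hflow.smooth ht).continuousOn
  rw [hint t ht _ hcont]
  have hadd : HasDerivWithinAt
      (fun s => ∫ y in F s '' A, ρ y ∂μHE[m] + ∫ y in F s '' B, ρ y ∂μHE[m])
      (∫ y in F t '' A, variationRate ρ H t y ∂μHE[m] +
        ∫ y in F t '' B, variationRate ρ H t y ∂μHE[m]) I t := (hA t ht).2.add (hB t ht).2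
  exact hadd.congr
    (fun s hs => hint s hs ρ hρ.continuous.continuousOn) (hint t ht ρ hρ.continuous.continuousOn)

theorem IsMeanCurvatureFlow.hasFirstVariation (hI : I.OrdConnected) (hI' : I.Nontrivial)
    (h0 : (0 : ℝ) ∈ I) (hflow : IsMeanCurvatureFlow m I M H)
    (hF : IsFlow I (fun t x => -H t x) F) (hFM : ∀ t ∈ I, F t '' M 0 = M t)
    (hc : ∀ t ∈ I, IsCompact (M t)) (hρ : ContDiff ℝ 2 ρ) :
    HasFirstVariation m I H F ρ (M 0) := by
  have key : ∃ B₁, MeasurableSet B₁ ∧ M 0 ⊆ B₁ ∧ ∀ B, MeasurableSet B → B ⊆ B₁ ∩ M 0 →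
      HasFirstVariation m I H F ρ B := by
    -- The property inducted on is hereditary: the formula is required for all Borel subsets of
    -- $B_1\cap M_0$. This lets a union of two pieces be made disjoint before adding.
    refine (hc 0 h0).induction_on (p := fun A => ∃ B₁, MeasurableSet B₁ ∧ A ⊆ B₁ ∧
      ∀ B, MeasurableSet B → B ⊆ B₁ ∩ M 0 → HasFirstVariation m I H F ρ B) ?_ ?_ ?_ ?_
    · refine ⟨∅, .empty, Subset.rfl, fun B _ hB t _ => ?_⟩
      obtain rfl : B = ∅ := by simpa using hB
      simpa using hasDerivWithinAt_const t I (0 : ℝ)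
    · rintro A A' hAA' ⟨B₁, hB₁, hA', h⟩
      exact ⟨B₁, hB₁, hAA'.trans hA', h⟩
    · rintro A A' ⟨B₁, hB₁, hA, h⟩ ⟨B₂, hB₂, hA', h'⟩
      refine ⟨B₁ ∪ B₂, hB₁.union hB₂, union_subset_union hA hA', fun B hB hBs => ?_⟩
      rw [← inter_union_sdiff B B₁]
      refine hflow.hasFirstVariation_union hI hI' h0 hF hFM hc hρ
        (h _ (hB.inter hB₁) fun y hy => ⟨hy.2, (hBs hy.1).2⟩)
        (h' _ (hB.diff hB₁) fun y hy => ⟨(hBs hy.1).1.resolve_left hy.2, (hBs hy.1).2⟩)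
        (fun y hy => (hBs hy.1).2) (fun y hy => (hBs hy.1).2) ?_
      exact disjoint_sdiff_right.mono_left inter_subset_right
    · intro x hx
      obtain ⟨V, ψ, Ω, π, hxV, h⟩ := exists_isChart_of_isSubmanifold (hflow.submanifold 0 h0) hx
      obtain ⟨C, hC, hxC, hCΩ⟩ := exists_compact_subset h.isOpen (h.right_inv ⟨hx, hxV⟩).1
      have hopen : IsOpen (V ∩ π ⁻¹' interior C) :=
        h.isOpen_image.inter (isOpen_interior.preimage π.continuous)
      refine ⟨V ∩ π ⁻¹' interior C, mem_nhdsWithin_of_mem_nhds (hopen.mem_nhds ⟨hxV, hxC⟩),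
        V ∩ π ⁻¹' interior C, hopen.measurableSet, Subset.rfl, fun B hB hBs => ?_⟩
      have hinv : ∀ y ∈ B, ψ (π y) = y := fun y hy =>
        (h.right_inv ⟨(hBs hy).2, (hBs hy).1.1⟩).2
      have hinj : InjOn π B := fun y hy z hz hyz => by rw [← hinv y hy, hyz, hinv z hz]
      have himg : ψ '' (π '' B) = B := by
        rw [← image_comp]
        exact (image_congr hinv).trans (image_id' B)
      rw [← himg]
      refine hflow.hasFirstVariation_chart hI hI' h0 hF hFM hρ h hC hCΩ
        (hB.image_of_continuousOn_injOn π.continuous.continuousOn hinj) ?_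
      rintro _ ⟨y, hy, rfl⟩
      exact interior_subset (hBs hy).1.2
  obtain ⟨B₁, -, hM, h⟩ := key
  exact h (M 0) (hc 0 h0).measurableSet fun y hy => ⟨hM hy, hy⟩

/-- The first variation of the volume of a family moving by the mean curvature flow. -/
theorem IsMeanCurvatureFlow.hasDerivWithinAt_volIntegral (hm : 1 ≤ m) (hmn : m ≤ n)
    (hI : I.OrdConnected) (hI' : I.Nontrivial) (h0 : (0 : ℝ) ∈ I)
    (hflow : IsMeanCurvatureFlow m I M H) (hc : ∀ t ∈ I, IsCompact (M t)) (hρ : ContDiff ℝ 2 ρ)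
    {t : ℝ} (ht : t ∈ I) :
    HasDerivWithinAt (fun s => volIntegral m (M s) ρ)
      (-volIntegral m (M t) (fun x => ρ x * ‖H t x‖ ^ 2) -
        superIntegral (wedgeLeft (d (dsharp (ofFun ρ))) (currentS m (M t)))) I t := by
  obtain ⟨F, hF, hFM⟩ := hflow.flow
  have hvol : ∀ s ∈ I, ∀ f, volIntegral m (M s) f = ∫ x in M s, f x ∂μHE[m] := fun s hs f =>
    volIntegral_eq hm (hc s hs).measurableSet
      (fun x hx => finrank_tangent (hflow.submanifold s hs) hx) f
  have hMt := hflow.submanifold t ht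
  have hHc : ContinuousOn (H t) (M t) := hflow.smooth.continuousOn.comp
    (continuousOn_const.prodMk continuousOn_id) fun y _ => ⟨ht, mem_univ _⟩
  have hgrad : ContDiff ℝ 1 (gradient ρ) := contDiff_iff_contDiffAt.2 fun x =>
    contDiffAt_gradient hρ.contDiffAt (by norm_num)
  -- Applied to $\nabla\rho$, whose tangential divergence is the Hessian trace, the divergence
  -- theorem converts the gradient term of the variation.
  have hdiv := (integral_divergence hmn hMt (hc t ht) (hflow.meanCurvature t ht) hHc hgrad).2
  simp only [tangentTrace_fderiv_gradient hρ.contDiffAt] at hdiv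
  have hvar := (hflow.hasFirstVariation hI hI' h0 hF hFM hc hρ t ht).2
  rw [hFM t ht] at hvar
  refine (hvar.congr (fun s hs => ?_) ?_).congr_deriv ?_
  · rw [hvol s hs, hFM s hs]
  · rw [hvol t ht, hFM t ht]
  · rw [hvol t ht, superIntegral_dd_currentS hm (hc t ht).measurableSet
      (fun x hx => finrank_tangent hMt hx) hρ, hdiv]
    simp only [variationRate]
    rw [integral_neg, integral_add]
    · ring
    · exact integrableOn_of_continuousOn hMt (hc t ht) (hgrad.continuous.continuousOn.inner hHc)
    · exact integrableOn_of_continuousOn hMt (hc t ht)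
        (hρ.continuous.continuousOn.mul (hHc.norm.pow 2))

/-- Non-negativity of $\rho$ on $M_t$ controls the curvature term and $m$-subharmonicity controls
the Hessian term, so the derivative is non-positive. -/
theorem IsMeanCurvatureFlow.antitoneOn_volIntegral (hm : 1 ≤ m) (hmn : m ≤ n)
    (hI : I.OrdConnected) (hI' : I.Nontrivial) (h0 : (0 : ℝ) ∈ I)
    (hflow : IsMeanCurvatureFlow m I M H) (hc : ∀ t ∈ I, IsCompact (M t)) (hρ : ContDiff ℝ 2 ρ)
    (hsub : IsMSubharmonic m ρ) (hpos : ∀ t ∈ I, ∀ x ∈ M t, 0 ≤ ρ x) :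
    AntitoneOn (fun t => volIntegral m (M t) ρ) I := by
  have hder := fun t (ht : t ∈ I) =>
    hflow.hasDerivWithinAt_volIntegral hm hmn hI hI' h0 hc hρ ht
  refine antitoneOn_of_hasDerivWithinAt_nonpos hI.convex
    (fun t ht => (hder t ht).continuousWithinAt)
    (fun t ht => (hder t (interior_subset ht)).mono interior_subset) fun t ht => ?_
  replace ht := interior_subset ht
  have hT : ∀ x ∈ M t, Module.finrank ℝ (tangent (M t) x) = m := fun x hx =>
    finrank_tangent (hflow.submanifold t ht) hx
  rw [volIntegral_eq hm (hc t ht).measurableSet hT,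
    superIntegral_dd_currentS hm (hc t ht).measurableSet hT hρ]
  have h1 : 0 ≤ ∫ x in M t, ρ x * ‖H t x‖ ^ 2 ∂μHE[m] :=
    setIntegral_nonneg (hc t ht).measurableSet fun x hx =>
      mul_nonneg (hpos t ht x hx) (sq_nonneg _)
  have h2 : 0 ≤ ∫ x in M t, hessTrace (tangent (M t) x) ρ x ∂μHE[m] :=
    setIntegral_nonneg (hc t ht).measurableSet fun x hx =>
      hessTrace_nonneg_of_mSubharmonic hm hmn (hT x hx) hρ hsub
  linarith

end FirstVariation

end SuperMCF

end

theorem mainTheorem7 {n m : ℕ} (hm : 1 ≤ m) (hmn : m ≤ n)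
    {I : Set ℝ} (hI : I.OrdConnected) (hI' : I.Nontrivial) (h0 : (0 : ℝ) ∈ I)
    {M : ℝ → Set (SuperMCF.Space n)} {H : ℝ → SuperMCF.Space n → SuperMCF.Space n}
    (hflow : SuperMCF.IsMeanCurvatureFlow m I M H) (hcompact : ∀ t ∈ I, IsCompact (M t))
    {ρ : SuperMCF.Space n → ℝ} (hρ : ContDiff ℝ 2 ρ) :
    (∀ t ∈ I, HasDerivWithinAt (fun s => SuperMCF.volIntegral m (M s) ρ)
      (-SuperMCF.volIntegral m (M t) (fun x => ρ x * ‖H t x‖ ^ 2)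
        - SuperMCF.superIntegral
          (SuperMCF.wedgeLeft (SuperMCF.d (SuperMCF.dsharp (SuperMCF.ofFun ρ)))
            (SuperMCF.currentS m (M t)))) I t) ∧
    (ConvexOn ℝ Set.univ ρ → SuperMCF.IsMSubharmonic m ρ) ∧
    ((ConvexOn ℝ Set.univ ρ ∨ SuperMCF.IsMSubharmonic m ρ) →
      (∀ t ∈ I, ∀ x ∈ M t, 0 ≤ ρ x) →
        AntitoneOn (fun t => SuperMCF.volIntegral m (M t) ρ) I) := by
  have hvar := fun t (ht : t ∈ I) =>
    hflow.hasDerivWithinAt_volIntegral hm hmn hI hI' h0 hcompact hρ ht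
  have hconv : ConvexOn ℝ Set.univ ρ → SuperMCF.IsMSubharmonic m ρ :=
    SuperMCF.isMSubharmonic_of_convexOn hm hρ
  exact ⟨hvar, hconv, fun h => hflow.antitoneOn_volIntegral hm hmn hI hI' h0 hcompact hρ
    (h.elim hconv id)⟩
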